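/- **Online Vector Scheduling.** There are $m\ge 1$ machines, $r\ge 1$ resources and, for each resource $i\in[r]$, a norm $\|\cdot\|_{(i)}$ on $\mathbb{R}^m$. Jobs arrive one by one, and each can be processed with one of $k\ge 1$ options; processing job $t$ with option $c$ puts a load $C^{(t)}_{i,j,c}\ge 0$ on resource $i$ of machine $j$. (In the special case where the options are the machines and $C^{(t)}_{i,j,c}=0$ for $j\neq c$, each job is assigned to one machine.) When job $t$ arrives, an online algorithm irrevocably chooses its option $x_t\in[k]$, knowing only the jobs $1,\dots,t$, and neither the number of jobs nor the optimal value. The cost after $T$ jobs is $\max_{i\in[r]}\big\|\big(\sum_{t\le T}C^{(t)}_{i,j,x_t}\big)_{j\in[m]}\big\|_{(i)}$, and $\mathrm{OPT}$ is the minimum of this cost over all $x\in[k]^T$. The algorithm is $\beta$-competitive if its cost is at most $\beta\cdot\mathrm{OPT}$ on every finite sequence of jobs. A norm on $\mathbb{R}^m$ is *monotone* if $\|u\|\ge\|v\|$ whenever $u\ge v\ge 0$, and *symmetric* if it is invariant under permutations of the coordinates. An algorithm is *efficient given Ball-Optimization oracle access* if it is one fixed real-RAM program (unit-cost arithmetic,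 $\exp$, $\log$, comparisons, and oracle calls) that does not depend on $m,r,k$ or the norms, reads $m,r,k$ and the jobs seen so far, has access to the norms only through oracles which for $i\in[r]$ and $x\in\mathbb{R}^m$ return $\max\{\langle x,v\rangle : \|v\|_{(i)}\le 1\}$, and computes the decision for job $t$ in time polynomial in $m+r+k+t$. (Only the values of the norms on nonnegative vectors matter for the problem; a norm that does not depend on the absolute values of the coordinates only is replaced in the oracle by $v\mapsto\big\||v|\big\|_{(i)}$.) **Theorem.** (1) There are an absolute constant $K$ and a deterministic online algorithm, efficient given Ball-Optimization oracle access to the inner norms, that is $K\,(1+\log^2 m+\log r)$-competitive for Online Vector Scheduling whenever all inner norms $\|\cdot\|_{(i)}$ are monotone symmetric norms. (2) If every inner norm $\|\cdot\|_{(i)}$ is an $\ell_{p_i}$ norm with $p_i\in[1,\infty]$ (possibly different for different $i$), the same holds with competitive ratio $K\,(1+\log m+\log r)$. -/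

import Mathlib

namespace VectorScheduling

/-! ### Inner norms -/

/-- `N` is a monotone symmetric norm on `ℝ^m`: a norm that is monotone on the nonnegative orthant
and invariant under permutations of the coordinates. -/
structure IsMonotoneSymmetricNorm {m : ℕ} (N : (Fin m → ℝ) → ℝ) : Prop where
  add_le : ∀ x y, N (x + y) ≤ N x + N y
  smul : ∀ (c : ℝ) (x), N (c • x) = |c| * N x
  eq_zero : ∀ x, N x = 0 → x = 0
  mono : ∀ u v : Fin m → ℝ, 0 ≤ v → v ≤ u → N v ≤ N u
  perm : ∀ (σ : Equiv.Perm (Fin m)) (x : Fin m → ℝ), N (x ∘ σ) = N x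

/-- The `ℓ_p` norm on `ℝ^m`, for `p ∈ [1, ∞]`. -/
noncomputable def lpNorm {m : ℕ} (p : ENNReal) (x : Fin m → ℝ) : ℝ :=
  ‖(WithLp.toLp p x : PiLp p (fun _ : Fin m => ℝ))‖

/-! ### Online Vector Scheduling -/

/-- A job: `C i j c` is the load that it puts on resource `i` of machine `j` if it is processed
with option `c`. The case in which a job is assigned to one machine is the one where the options
are the machines and `C i j c = 0` for `j ≠ c`. -/
abbrev Job (m r k : ℕ) : Type := Fin r → Fin m → Fin k → ℝ

/-- All loads of all jobs are nonnegative. -/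
def Nonneg {m r k : ℕ} (js : List (Job m r k)) : Prop :=
  ∀ C ∈ js, ∀ i j c, 0 ≤ C i j c

/-- The total load on resource `i`, as a vector over the machines, if the `s`-th job of `js` is
processed with option `x s`. -/
def totalLoad {m r k : ℕ} (js : List (Job m r k)) (x : Fin js.length → Fin k) (i : Fin r) :
    Fin m → ℝ :=
  fun j => ∑ s : Fin js.length, js.get s i j (x s)

/-- The objective: the largest of the inner norms of the load vectors of the resources. -/
noncomputable def cost {m r k : ℕ} (N : Fin r → (Fin m → ℝ) → ℝ) (js : List (Job m r k))
    (x : Fin js.length → Fin k) : ℝ :=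
  ⨆ i : Fin r, N i (totalLoad js x i)

/-- The offline optimum. -/
noncomputable def opt {m r k : ℕ} (N : Fin r → (Fin m → ℝ) → ℝ) (js : List (Job m r k)) : ℝ :=
  ⨅ x : Fin js.length → Fin k, cost N js x

/-- A (deterministic) online algorithm: it maps the list of the jobs that have arrived so far to the
option that is chosen for the last job of that list. -/
abbrev OnlineAlgorithm (m r k : ℕ) : Type := List (Job m r k) → Fin k

/-- The choices of the online algorithm `A` on the job sequence `js`. -/
def OnlineAlgorithm.choices {m r k : ℕ} (A : OnlineAlgorithm m r k) (js : List (Job m r k)) :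
    Fin js.length → Fin k :=
  fun s => A (js.take (s + 1))

/-- `A` is `β`-competitive: on every finite sequence of jobs, its cost is at most `β` times the
offline optimum. -/
def IsCompetitive {m r k : ℕ} (N : Fin r → (Fin m → ℝ) → ℝ) (A : OnlineAlgorithm m r k)
    (β : ℝ) : Prop :=
  ∀ js : List (Job m r k), Nonneg js → cost N js (A.choices js) ≤ β * opt N js

/-! ### Oracle programs: a real RAM with unit-cost steps and oracle calls -/

/-- The memory: an array of natural numbers with two indices, and real arrays with any number of
indices. -/
structure State where
  ints : ℕ → ℕ → ℕ
  reals : List ℕ → ℝ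

/-- Integer expressions (indices); subtraction is truncated. -/
inductive IExp where
  | const (n : ℕ)
  | get (a b : IExp)
  | add (a b : IExp)
  | sub (a b : IExp)

def IExp.eval (σ : State) : IExp → ℕ
  | .const n => n
  | .get a b => σ.ints (a.eval σ) (b.eval σ)
  | .add a b => a.eval σ + b.eval σ
  | .sub a b => a.eval σ - b.eval σ

/-- Real expressions. The operations are total: `x / 0 = 0`, and `log` is `Real.log`. -/
inductive RExp where
  | ofNat (e : IExp)
  | get (a : List IExp)
  | add (a b : RExp)
  | sub (a b : RExp)
  | mul (a b : RExp)
  | div (a b : RExp)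
  | exp (a : RExp)
  | log (a : RExp)

noncomputable def RExp.eval (σ : State) : RExp → ℝ
  | .ofNat e => (e.eval σ : ℝ)
  | .get a => σ.reals (a.map (IExp.eval σ))
  | .add a b => a.eval σ + b.eval σ
  | .sub a b => a.eval σ - b.eval σ
  | .mul a b => a.eval σ * b.eval σ
  | .div a b => a.eval σ / b.eval σ
  | .exp a => Real.exp (a.eval σ)
  | .log a => Real.log (a.eval σ)

/-- Tests. -/
inductive Test where
  | intLt (a b : IExp)
  | realLe (a b : RExp)

def Test.Holds (σ : State) : Test → Prop
  | .intLt a b => a.eval σ < b.eval σ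
  | .realLe a b => a.eval σ ≤ b.eval σ

/-- Programs. `call a i q` asks the `i`-th oracle about the vector whose `j`-th entry is the real
cell `q ++ [j]`, and stores the answer in the real cell `a`. -/
inductive Prog where
  | skip
  | setInt (a b : IExp) (e : IExp)
  | setReal (a : List IExp) (e : RExp)
  | call (a : List IExp) (i : IExp) (q : List IExp)
  | seq (P Q : Prog)
  | ite (b : Test) (P Q : Prog)
  | while (b : Test) (P : Prog)

def State.setInt (σ : State) (a b n : ℕ) : State :=
  { σ with ints := Function.update σ.ints a (Function.update (σ.ints a) b n) }

noncomputable def State.setReal (σ : State) (a : List ℕ) (x : ℝ) : State :=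
  { σ with reals := Function.update σ.reals a x }

/-- An oracle: its answer to a query with an index `i` and a vector (of which it reads the first
entries only). -/
abbrev Oracle : Type := ℕ → (ℕ → ℝ) → ℝ

/-- `Exec O P σ n τ`: with the oracle `O`, the program `P` started in `σ` stops in `τ` after `n`
steps. Every assignment, every test and every oracle call is one step (an expression of a fixed
program has a fixed number of operations). -/
inductive Exec (O : Oracle) : Prog → State → ℕ → State → Prop where
  | skip (σ : State) : Exec O .skip σ 1 σ
  | setInt (σ : State) (a b e : IExp) :
      Exec O (.setInt a b e) σ 1 (σ.setInt (a.eval σ) (b.eval σ) (e.eval σ))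
  | setReal (σ : State) (a : List IExp) (e : RExp) :
      Exec O (.setReal a e) σ 1 (σ.setReal (a.map (IExp.eval σ)) (e.eval σ))
  | call (σ : State) (a : List IExp) (i : IExp) (q : List IExp) :
      Exec O (.call a i q) σ 1 (σ.setReal (a.map (IExp.eval σ))
        (O (i.eval σ) (fun j => σ.reals (q.map (IExp.eval σ) ++ [j]))))
  | seq {P Q : Prog} {σ τ υ : State} {n n' : ℕ} :
      Exec O P σ n τ → Exec O Q τ n' υ → Exec O (.seq P Q) σ (n + n') υ
  | ite_true {b : Test} {P Q : Prog} {σ τ : State} {n : ℕ} :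
      b.Holds σ → Exec O P σ n τ → Exec O (.ite b P Q) σ (n + 1) τ
  | ite_false {b : Test} {P Q : Prog} {σ τ : State} {n : ℕ} :
      ¬ b.Holds σ → Exec O Q σ n τ → Exec O (.ite b P Q) σ (n + 1) τ
  | while_false {b : Test} {P : Prog} {σ : State} :
      ¬ b.Holds σ → Exec O (.while b P) σ 1 σ
  | while_true {b : Test} {P : Prog} {σ τ υ : State} {n n' : ℕ} :
      b.Holds σ → Exec O P σ n τ → Exec O (.while b P) τ n' υ →
      Exec O (.while b P) σ (n + n' + 1) υ

/-- The Ball-Optimization oracles of the norms `N i`: the `i`-th one maps `x` to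
`max {⟨x, v⟩ | ‖v‖ ≤ 1}`. Only the values of `N i` on nonnegative vectors matter for the problem,
and `‖v‖` is `N i |v|`, the norm with these values that depends on the absolute values of the
coordinates only; it is `N i v` for all norms with that property. -/
noncomputable def ballOracle {m r : ℕ} (N : Fin r → (Fin m → ℝ) → ℝ) : Oracle :=
  fun i x => if h : i < r then
    sSup {z : ℝ | ∃ v : Fin m → ℝ, N ⟨i, h⟩ |v| ≤ 1 ∧ z = ∑ j : Fin m, x j * v j} else 0

/-- The memory at the start: the numbers `m`, `r`, `k` and the number of jobs seen so far are in
the integer cells `(0, 0)`, `(1, 0)`, `(2, 0)`, `(3, 0)`, the load of the `s`-th job seen so far on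
resource `i` of machine `j` under option `c` is in the real cell `[s, i, j, c]`, and all other cells
are `0`. The norms are not part of the input. -/
noncomputable def inputState {m r k : ℕ} (js : List (Job m r k)) : State where
  ints a b := match a, b with
    | 0, 0 => m
    | 1, 0 => r
    | 2, 0 => k
    | 3, 0 => js.length
    | _, _ => 0
  reals a := match a with
    | [s, i, j, c] =>
      if h : s < js.length ∧ i < r ∧ j < m ∧ c < k then
        js.get ⟨s, h.1⟩ ⟨i, h.2.1⟩ ⟨j, h.2.2.1⟩ ⟨c, h.2.2.2⟩
      else 0
    | _ => 0

/-- With access to the norms through their Ball-Optimization oracles only, the program `P` computes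
the decisions of the online algorithm `A`, each within `b * (m + r + k + t) ^ d` steps, where `t` is
the number of jobs seen so far. The decision is returned in the integer cell `(0, 0)`. -/
def Implements {m r k : ℕ} (N : Fin r → (Fin m → ℝ) → ℝ) (P : Prog) (b d : ℕ)
    (A : OnlineAlgorithm m r k) : Prop :=
  ∀ js : List (Job m r k), js ≠ [] → Nonneg js →
    ∃ (n : ℕ) (τ : State), Exec (ballOracle N) P (inputState js) n τ ∧
      n ≤ b * (m + r + k + js.length) ^ d ∧ τ.ints 0 0 = (A js : ℕ)

end VectorScheduling

/-!
The algorithm is greedy. It assigns each job to the option that increases a potential function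
least, where the potential is monotone on nonnegative loads and has monotone increments (`Ultra`).
For such a potential `Φ`, comparing each choice with that of an optimal solution of total load `y`
and summing up shows that the load `x` of the algorithm satisfies `Φ x - Φ 0 ≤ Φ (x + y) - Φ x`
(`greedy_le`). The competitive ratio then depends on two properties of `Φ`: adding a load of cost
`1` multiplies it by at most a constant, and a bound on `Φ x` gives a bound on the cost of `x`.

*Symmetric norms.* A norming functional of a nonincreasing vector can be taken nonincreasing, by
the rearrangement inequality. Rounding its layers to powers of two, in value and in size, leaves a
lattice path with `O(log m)` steps, hence only `8 m ^ 2` functionals, encoded by natural numbers,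
which are independent of the norm; normalized by their dual norms, which the oracle computes, they
determine every monotone symmetric norm up to a factor of `12`
(`IsMonotoneSymmetricNorm.exists_weight`). Each functional is a combination of `O(log m)` sums of
the `κ` largest coordinates. An exponential of such a sum need not have monotone increments, so it
is replaced by `smoothTop`, a sum of positive parts over thresholds that does and has the same
growth up to constants in the exponent. The potential is the sum over all resources and codes of
the products `codePot` of these factors. Adding a load of norm at most `1` multiplies it by at most
`3 / 2` (`codePot_add_le`), and `codePot ≤ 2 ^ b` for all codes bounds the norm by `O(b + log m)`
(`norm_le_of_codePot_le`). Since every factor is `m` at the load `0` and there are `O(log m)`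
factors, `Φ 0` is at most `r * m ^ O(log m)`; its logarithm is the ratio `log m ^ 2 + log r`.

This requires loads to be measured in units of the optimum. The scale starts at `0` and is doubled
whenever no option keeps the potential below `2 * Φ 0`; by `greedy_le` this happens only while the
scale is below the optimum, and the loads left behind at smaller scales form a geometric series
(`IsDoublingRun.invariant`, `IsDoublingRun.cost_le`). A linear approximation `crude` of the cost up
to the factor `m * r` limits the number of scales to be tried for one job.

*`ℓ_p` norms.* The exponent `p` can be replaced by `min p (1 + log m)` at the loss of a factor `e`
(`lpNorm_equiv`), and the maximum over the resources by an `ℓ_q` norm with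
`q = 1 + log m + log r`. The `q`-th power of the resulting norm has monotone increments, because
`q` is at least all inner exponents. By Minkowski's inequality, `2 Φ x ≤ Φ (x + y)` forces the norm
of `x` to be `O(q)` times that of `y` (`maxNorm_le_of_two_mul_le`), and this is homogeneous, so no
scale is needed. The exponents are not part of the input: the program reads `p` off the value
`m ^ (1 - 1 / p)` of the oracle at the vector of ones (`dualNorm_one`).

*Running time.* `Comp V f` says that `f` is computed by one program in polynomial time on the
inputs described by the context `V`. It is closed under arithmetic, `exp`, `log`, comparisons,
oracle calls and bounded sums, and so also under bounded search, minimization and products. The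
potentials and the rules of the algorithms are built from these operations, and `exists_prog` runs
the rules over all jobs, recomputing the earlier choices; `exists_algorithm` turns them into an
online algorithm, since they look only at the jobs up to the current one (`IsOnline`).
-/

namespace VectorScheduling

/-! ### Computable real functions -/

/-- The data on which one decision depends: the dimensions `m`, `r`, `k`, the number `t` of jobs
seen so far, the index `s` of the job that is being processed, the oracle `O`, an array `Y` of
earlier results and the loads `C`. The oracle reads the first `m` entries of a query only. -/
structure Base where
  (m r k t s : ℕ)
  O : Oracle
  Y : ℕ → ℝ
  C : ℕ → ℕ → ℕ → ℕ → ℝ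
  isLocal : ∀ i x y, (∀ j < m, x j = y j) → O i x = O i y

/-- The size in which running times are measured. -/
def Base.size (b : Base) : ℕ := b.m + b.r + b.k + b.t

/-- A context over `α`: it says how an element of `α` is stored in the memory. It has an underlying
`Base`, and a set `vars` of pairs `(i, v)`, where the loop variable `v` is kept in the integer cell
`(i, 0)`. -/
structure Ctx (α : Type) where
  base : α → Base
  vars : Set (ℕ × (α → ℕ))

/-- The context with one more loop variable, which is less than `B` and kept in the integer cell
`(i, 0)`. -/
def Ctx.ext {α : Type} (V : Ctx α) (i : ℕ) (B : α → ℕ) : Ctx ((a : α) × Fin (B a)) where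
  base p := V.base p.1
  vars := {q | q = (i, fun p => (p.2 : ℕ)) ∨ ∃ v ∈ V.vars, q = (v.1, fun p => v.2 p.1)}

@[simp] theorem Ctx.ext_base {α : Type} (V : Ctx α) (i : ℕ) (B : α → ℕ) (p : (a : α) × Fin (B a)) :
    (V.ext i B).base p = V.base p.1 := rfl

/-- The integer cells from `li` on are free. -/
def Ctx.Bdd {α : Type} (V : Ctx α) (li : ℕ) : Prop := 5 ≤ li ∧ ∀ v ∈ V.vars, v.1 < li

/-- The memory `σ` stores `a`. -/
structure Rep {α : Type} (V : Ctx α) (a : α) (σ : State) : Prop where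
  m : σ.ints 0 0 = (V.base a).m
  r : σ.ints 1 0 = (V.base a).r
  k : σ.ints 2 0 = (V.base a).k
  t : σ.ints 3 0 = (V.base a).t
  s : σ.ints 4 0 = (V.base a).s
  Y : ∀ n, σ.reals [n] = (V.base a).Y n
  C : ∀ s i j c, σ.reals [s, i, j, c] = (V.base a).C s i j c
  vars : ∀ v ∈ V.vars, σ.ints v.1 0 = v.2 a

/-- The real cells that a computation at depth `d` may overwrite. -/
def Scratch (d : ℕ) (l : List ℕ) : Prop :=
  ∃ d' x, d ≤ d' ∧ (l = [d', x] ∨ ∃ y, l = [d', x, y])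

/-- `τ` agrees with `σ` on the integer cells below `li` and on all real cells that are not scratch
cells at depth `d`. -/
structure Frame (li d : ℕ) (σ τ : State) : Prop where
  ints : ∀ i < li, τ.ints i = σ.ints i
  reals : ∀ l, ¬ Scratch d l → τ.reals l = σ.reals l

theorem Frame.trans {li d : ℕ} {σ τ υ : State} (h : Frame li d σ τ) (h' : Frame li d τ υ) :
    Frame li d σ υ :=
  ⟨fun i hi => (h'.ints i hi).trans (h.ints i hi), fun l hl => (h'.reals l hl).trans (h.reals l hl)⟩

theorem Scratch.mono {d d' : ℕ} {l : List ℕ} (hd : d ≤ d') (h : Scratch d' l) : Scratch d l := by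
  obtain ⟨e, x, he, h⟩ := h
  exact ⟨e, x, hd.trans he, h⟩

theorem Frame.mono {li li' d d' : ℕ} {σ τ : State} (h : Frame li' d' σ τ) (hi : li ≤ li')
    (hd : d ≤ d') : Frame li d σ τ :=
  ⟨fun i hh => h.ints i (hh.trans_le hi), fun l hl => h.reals l fun hs => hl (hs.mono hd)⟩

theorem Frame.setReal {li d : ℕ} (σ : State) {l : List ℕ} (hl : Scratch d l) (x : ℝ) :
    Frame li d σ (σ.setReal l x) := by
  refine ⟨fun _ _ => rfl, fun l' hl' => ?_⟩
  have : l' ≠ l := by rintro rfl; exact hl' hl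
  simp [State.setReal, Function.update_of_ne this]

theorem Frame.setInt {li d : ℕ} (σ : State) {i : ℕ} (hi : li ≤ i) (b n : ℕ) :
    Frame li d σ (σ.setInt i b n) := by
  refine ⟨fun j hj => ?_, fun _ _ => rfl⟩
  have : j ≠ i := by omega
  simp [State.setInt, Function.update_of_ne this]

theorem scratch_pair (d x : ℕ) : Scratch d [d, x] := ⟨d, x, le_rfl, Or.inl rfl⟩

theorem scratch_triple (d x y : ℕ) : Scratch d [d, x, y] := ⟨d, x, le_rfl, Or.inr ⟨y, rfl⟩⟩

theorem not_scratch_pair {d e : ℕ} (x : ℕ) (h : e < d) : ¬ Scratch d [e, x] := by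
  rintro ⟨d', x', hd, h' | ⟨y, h'⟩⟩ <;> simp at h'
  omega

theorem not_scratch_triple {d e : ℕ} (x y : ℕ) (h : e < d) : ¬ Scratch d [e, x, y] := by
  rintro ⟨d', x', hd, h' | ⟨z, h'⟩⟩ <;> simp at h'
  omega

theorem Rep.frame {α : Type} {V : Ctx α} {a : α} {σ τ : State} {li d : ℕ} (h : Rep V a σ)
    (hV : V.Bdd li) (hf : Frame li d σ τ) : Rep V a τ := by
  have hi : ∀ i < 5, τ.ints i = σ.ints i := fun i hi => hf.ints i (hi.trans_le hV.1)
  refine ⟨?_, ?_, ?_, ?_, ?_, fun n => ?_, fun s i j c => ?_, fun v hv => ?_⟩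
  · rw [hi 0 (by norm_num), h.m]
  · rw [hi 1 (by norm_num), h.r]
  · rw [hi 2 (by norm_num), h.k]
  · rw [hi 3 (by norm_num), h.t]
  · rw [hi 4 (by norm_num), h.s]
  · rw [hf.reals _ (by rintro ⟨d', x', hd, h' | ⟨z, h'⟩⟩ <;> simp at h'), h.Y]
  · rw [hf.reals _ (by rintro ⟨d', x', hd, h' | ⟨z, h'⟩⟩ <;> simp at h'), h.C]
  · rw [hf.ints _ (hV.2 v hv), h.vars v hv]

theorem Ctx.Bdd.ext {α : Type} {V : Ctx α} {li : ℕ} (h : V.Bdd li) (B : α → ℕ) :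
    (V.ext li B).Bdd (li + 1) := by
  refine ⟨h.1.trans (Nat.le_succ _), ?_⟩
  rintro v (rfl | ⟨v, hv, rfl⟩)
  · exact Nat.lt_succ_self _
  · exact (h.2 v hv).trans (Nat.lt_succ_self _)

theorem Ctx.Bdd.of_ext {α : Type} {V : Ctx α} {i li : ℕ} {B : α → ℕ} (h : (V.ext i B).Bdd li) :
    V.Bdd li :=
  ⟨h.1, fun v hv => h.2 _ (Or.inr ⟨v, hv, rfl⟩)⟩

theorem Rep.of_ext {α : Type} {V : Ctx α} {i : ℕ} {B : α → ℕ} {p : (a : α) × Fin (B a)} {σ : State}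
    (h : Rep (V.ext i B) p σ) :
    Rep V p.1 σ :=
  ⟨h.m, h.r, h.k, h.t, h.s, h.Y, h.C, fun v hv => h.vars _ (Or.inr ⟨v, hv, rfl⟩)⟩

theorem Rep.ext {α : Type} {V : Ctx α} {i n : ℕ} {B : α → ℕ} {a : α} {σ : State} (h : Rep V a σ)
    (hn : σ.ints i 0 = n) (hB : n < B a) : Rep (V.ext i B) ⟨a, n, hB⟩ σ := by
  refine ⟨h.m, h.r, h.k, h.t, h.s, h.Y, h.C, ?_⟩
  rintro v (rfl | ⟨v, hv, rfl⟩)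
  · exact hn
  · exact h.vars v hv

/-- `f` is given by an index expression. -/
def NComp {α : Type} (V : Ctx α) (f : α → ℕ) : Prop :=
  ∃ e : IExp, ∀ a σ, Rep V a σ → e.eval σ = f a

/-- `f` is computed by one program in polynomial time; the program can be chosen such that it uses
only integer cells from `li` on and real scratch cells at depth `d`. The result is stored in the
real cell `[d, 0]`. -/
def Comp {α : Type} (V : Ctx α) (f : α → ℝ) : Prop :=
  ∀ li d, V.Bdd li → ∃ (P : Prog) (b e : ℕ), ∀ a σ, Rep V a σ →
    ∃ n τ, Exec (V.base a).O P σ n τ ∧ n ≤ b * ((V.base a).size + 1) ^ e ∧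
      τ.reals [d, 0] = f a ∧ Frame li d σ τ

namespace NComp
variable {α : Type} {V : Ctx α}

theorem const (n : ℕ) : NComp V (fun _ => n) := ⟨.const n, fun _ _ _ => rfl⟩

theorem m : NComp V (fun a => (V.base a).m) := ⟨.get (.const 0) (.const 0), fun _ _ h => h.m⟩
theorem r : NComp V (fun a => (V.base a).r) := ⟨.get (.const 1) (.const 0), fun _ _ h => h.r⟩
theorem k : NComp V (fun a => (V.base a).k) := ⟨.get (.const 2) (.const 0), fun _ _ h => h.k⟩
theorem t : NComp V (fun a => (V.base a).t) := ⟨.get (.const 3) (.const 0), fun _ _ h => h.t⟩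
theorem s : NComp V (fun a => (V.base a).s) := ⟨.get (.const 4) (.const 0), fun _ _ h => h.s⟩

theorem add {f g : α → ℕ} (hf : NComp V f) (hg : NComp V g) : NComp V (fun a => f a + g a) := by
  obtain ⟨e, he⟩ := hf
  obtain ⟨e', he'⟩ := hg
  exact ⟨.add e e', fun a σ h => by simp [IExp.eval, he a σ h, he' a σ h]⟩

theorem wk {f : α → ℕ} (hf : NComp V f) (i : ℕ) (B : α → ℕ) :
    NComp (V.ext i B) (fun p => f p.1) := by
  obtain ⟨e, he⟩ := hf
  exact ⟨e, fun p σ h => he p.1 σ h.of_ext⟩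

theorem var (i : ℕ) (B : α → ℕ) : NComp (V.ext i B) (fun p => (p.2 : ℕ)) :=
  ⟨.get (.const i) (.const 0), fun _ _ h => h.vars (i, fun p => (p.2 : ℕ)) (Or.inl rfl)⟩

theorem const_mul (n : ℕ) {f : α → ℕ} (hf : NComp V f) : NComp V (fun a => n * f a) := by
  induction n with
  | zero => simpa using const (V := V) 0
  | succ n ih => simpa [add_mul] using ih.add hf

end NComp

/-- A loop with an invariant `I` and at most `B` rounds, each of at most `T` steps. -/
theorem exec_while {O : Oracle} {b : Test} {Q : Prog} (I : ℕ → State → Prop) (B T : ℕ)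
    (hstep : ∀ n < B, ∀ σ, I n σ → b.Holds σ ∧ ∃ c τ, Exec O Q σ c τ ∧ c ≤ T ∧ I (n + 1) τ)
    (hend : ∀ σ, I B σ → ¬ b.Holds σ) (σ : State) (h0 : I 0 σ) :
    ∃ c τ, Exec O (.while b Q) σ c τ ∧ c ≤ B * (T + 1) + 1 ∧ I B τ := by
  have key : ∀ j n, n + j = B → ∀ σ, I n σ →
      ∃ c τ, Exec O (.while b Q) σ c τ ∧ c ≤ j * (T + 1) + 1 ∧ I B τ := by
    intro j
    induction j with
    | zero =>
      intro n hn σ h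
      obtain rfl : n = B := by omega
      exact ⟨1, σ, .while_false (hend σ h), by omega, h⟩
    | succ j ih =>
      intro n hn σ h
      obtain ⟨hb, c, τ, hQ, hc, hI⟩ := hstep n (by omega) σ h
      obtain ⟨c', υ, hW, hc', hI'⟩ := ih (n + 1) (by omega) τ hI
      exact ⟨c + c' + 1, υ, .while_true hb hQ hW, by nlinarith, hI'⟩
  exact key B 0 (by omega) σ h0

namespace Comp
variable {α : Type} {V : Ctx α}

theorem wk {f : α → ℝ} (hf : Comp V f) (i : ℕ) (B : α → ℕ) : Comp (V.ext i B) (fun p => f p.1) := by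
  intro li d hV
  obtain ⟨P, b, e, h⟩ := hf li d hV.of_ext
  exact ⟨P, b, e, fun p σ hσ => h p.1 σ hσ.of_ext⟩

/-- A real expression that reads protected cells only. -/
theorem of_exp {f : α → ℝ} (E : RExp) (h : ∀ a σ, Rep V a σ → E.eval σ = f a) : Comp V f := by
  intro li d hV
  refine ⟨.setReal [.const d, .const 0] E, 1, 0, fun a σ hσ => ⟨1, _, .setReal σ _ _, by simp, ?_,
    Frame.setReal σ (scratch_pair d 0) _⟩⟩
  simp [State.setReal, IExp.eval, h a σ hσ]

theorem const (n : ℕ) : Comp V (fun _ => (n : ℝ)) :=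
  of_exp (.ofNat (.const n)) fun _ _ _ => rfl

theorem cast {f : α → ℕ} (hf : NComp V f) : Comp V (fun a => (f a : ℝ)) := by
  obtain ⟨e, he⟩ := hf
  exact of_exp (.ofNat e) fun a σ h => by simp [RExp.eval, he a σ h]

theorem readY {f : α → ℕ} (hf : NComp V f) : Comp V (fun a => (V.base a).Y (f a)) := by
  obtain ⟨e, he⟩ := hf
  exact of_exp (.get [e]) fun a σ h => by simp [RExp.eval, he a σ h, h.Y]

theorem readC {s i j c : α → ℕ} (hs : NComp V s) (hi : NComp V i) (hj : NComp V j)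
    (hc : NComp V c) : Comp V (fun a => (V.base a).C (s a) (i a) (j a) (c a)) := by
  obtain ⟨es, hs⟩ := hs
  obtain ⟨ei, hi⟩ := hi
  obtain ⟨ej, hj⟩ := hj
  obtain ⟨ec, hc⟩ := hc
  exact of_exp (.get [es, ei, ej, ec]) fun a σ h => by
    simp [RExp.eval, hs a σ h, hi a σ h, hj a σ h, hc a σ h, h.C]

/-- The composition of computable functions with a function of two arguments that one program
computes from the cells `[d, 0]` and `[d + 1, 0]`. -/
theorem map₂ {f g : α → ℝ} (hf : Comp V f) (hg : Comp V g) (op : ℝ → ℝ → ℝ)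
    (Q : ℕ → Prog)
    (hQ : ∀ O d σ, ∃ n ≤ 2, Exec O (Q d) σ n
      (σ.setReal [d, 0] (op (σ.reals [d, 0]) (σ.reals [d + 1, 0])))) :
    Comp V (fun a => op (f a) (g a)) := by
  intro li d hV
  obtain ⟨P, b, e, hP⟩ := hf li d hV
  obtain ⟨P', b', e', hP'⟩ := hg li (d + 1) hV
  refine ⟨.seq P (.seq P' (Q d)), b + b' + 2, e + e', fun a σ hσ => ?_⟩
  obtain ⟨n, τ, h1, h2, h3, h4⟩ := hP a σ hσ
  obtain ⟨n', υ, h1', h2', h3', h4'⟩ := hP' a τ (hσ.frame hV h4)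
  obtain ⟨q, hq, hQ⟩ := hQ (V.base a).O d υ
  refine ⟨_, _, .seq h1 (.seq h1' hQ), ?_, ?_, ?_⟩
  · have hs : 1 ≤ (V.base a).size + 1 := by omega
    have a1 : ((V.base a).size + 1) ^ e ≤ ((V.base a).size + 1) ^ (e + e') :=
      Nat.pow_le_pow_right hs (by omega)
    have a2 : ((V.base a).size + 1) ^ e' ≤ ((V.base a).size + 1) ^ (e + e') :=
      Nat.pow_le_pow_right hs (by omega)
    have a3 : 1 ≤ ((V.base a).size + 1) ^ (e + e') := Nat.one_le_pow _ _ hs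
    have := Nat.mul_le_mul_left b a1
    have := Nat.mul_le_mul_left b' a2
    nlinarith
  · have : υ.reals [d, 0] = f a := by
      rw [h4'.reals _ (not_scratch_pair 0 (Nat.lt_succ_self d)), h3]
    simp [State.setReal, this, h3']
  · exact (h4.trans (h4'.mono le_rfl (Nat.le_succ d))).trans (Frame.setReal υ (scratch_pair d 0) _)

/-- The cell `[d, 0]` as an expression. -/
def cell (d : ℕ) : RExp := .get [.const d, .const 0]

theorem exec_cells {E : RExp} {op : ℝ → ℝ → ℝ} {d : ℕ}
    (hE : ∀ σ, E.eval σ = op (σ.reals [d, 0]) (σ.reals [d + 1, 0])) (O : Oracle) (σ : State) :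
    ∃ n ≤ 2, Exec O (.setReal [.const d, .const 0] E) σ n
      (σ.setReal [d, 0] (op (σ.reals [d, 0]) (σ.reals [d + 1, 0]))) := by
  refine ⟨1, by norm_num, ?_⟩
  rw [← hE σ]
  exact Exec.setReal σ [.const d, .const 0] E

theorem add {f g : α → ℝ} (hf : Comp V f) (hg : Comp V g) : Comp V (fun a => f a + g a) :=
  hf.map₂ hg (· + ·) (fun d => .setReal [.const d, .const 0] (.add (cell d) (cell (d + 1))))
    fun O _ σ => exec_cells (fun _ => rfl) O σ

theorem sub {f g : α → ℝ} (hf : Comp V f) (hg : Comp V g) : Comp V (fun a => f a - g a) :=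
  hf.map₂ hg (· - ·) (fun d => .setReal [.const d, .const 0] (.sub (cell d) (cell (d + 1))))
    fun O _ σ => exec_cells (fun _ => rfl) O σ

theorem mul {f g : α → ℝ} (hf : Comp V f) (hg : Comp V g) : Comp V (fun a => f a * g a) :=
  hf.map₂ hg (· * ·) (fun d => .setReal [.const d, .const 0] (.mul (cell d) (cell (d + 1))))
    fun O _ σ => exec_cells (fun _ => rfl) O σ

theorem div {f g : α → ℝ} (hf : Comp V f) (hg : Comp V g) : Comp V (fun a => f a / g a) :=
  hf.map₂ hg (· / ·) (fun d => .setReal [.const d, .const 0] (.div (cell d) (cell (d + 1))))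
    fun O _ σ => exec_cells (fun _ => rfl) O σ

theorem exp {f : α → ℝ} (hf : Comp V f) : Comp V (fun a => Real.exp (f a)) :=
  hf.map₂ (const 0) (fun x _ => Real.exp x)
    (fun d => .setReal [.const d, .const 0] (.exp (cell d)))
    fun O _ σ => exec_cells (op := fun x _ => Real.exp x) (fun _ => rfl) O σ

theorem log {f : α → ℝ} (hf : Comp V f) : Comp V (fun a => Real.log (f a)) :=
  hf.map₂ (const 0) (fun x _ => Real.log x)
    (fun d => .setReal [.const d, .const 0] (.log (cell d)))
    fun O _ σ => exec_cells (op := fun x _ => Real.log x) (fun _ => rfl) O σ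

/-- The indicator of an inequality. -/
theorem le {f g : α → ℝ} (hf : Comp V f) (hg : Comp V g) :
    Comp V (fun a => if f a ≤ g a then (1 : ℝ) else 0) := by
  refine hf.map₂ hg (fun x y => if x ≤ y then (1 : ℝ) else 0)
    (fun d => .ite (.realLe (cell d) (cell (d + 1)))
      (.setReal [.const d, .const 0] (.ofNat (.const 1)))
      (.setReal [.const d, .const 0] (.ofNat (.const 0)))) fun O d σ => ⟨2, le_rfl, ?_⟩
  by_cases h : σ.reals [d, 0] ≤ σ.reals [d + 1, 0]
  · simp only [h, if_true]
    refine .ite_true (n := 1) h ?_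
    simpa [RExp.eval, IExp.eval] using
      Exec.setReal (O := O) σ [.const d, .const 0] (.ofNat (.const 1))
  · simp only [h, if_false]
    refine .ite_false (n := 1) h ?_
    simpa [RExp.eval, IExp.eval] using
      Exec.setReal (O := O) σ [.const d, .const 0] (.ofNat (.const 0))

/-- A bounded sum. -/
theorem sum {B : α → ℕ} {f : (a : α) → Fin (B a) → ℝ} (q : ℕ)
    (hq : ∀ a, B a ≤ q * ((V.base a).size + 1)) (hB : NComp V B)
    (hf : ∀ i, Comp (V.ext i B) (fun p => f p.1 p.2)) : Comp V (fun a => ∑ n, f a n) := by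
  intro li d hV
  obtain ⟨eB, hB⟩ := hB
  obtain ⟨P, b, e, hP⟩ := hf li (li + 1) (d + 1) (hV.ext B)
  refine ⟨.seq (.setReal [.const d, .const 0] (.ofNat (.const 0)))
    (.seq (.setInt (.const li) (.const 0) (.const 0))
      (.while (.intLt (.get (.const li) (.const 0)) eB)
        (.seq P (.seq (.setReal [.const d, .const 0] (.add (cell d) (cell (d + 1))))
          (.setInt (.const li) (.const 0) (.add (.get (.const li) (.const 0)) (.const 1))))))),
    3 + q * (b + 3), e + 1, fun a σ hσ => ?_⟩
  set g : ℕ → ℝ := fun n => if h : n < B a then f a ⟨n, h⟩ else 0 with hg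
  have hsum : ∑ n, f a n = ∑ n ∈ Finset.range (B a), g n := by
    rw [Finset.sum_range]
    exact Finset.sum_congr rfl fun n _ => by simp [hg]
  set σ₁ := σ.setReal [d, 0] 0 with hσ₁
  set σ₂ := σ₁.setInt li 0 0 with hσ₂
  have e1 : Exec (V.base a).O (.setReal [.const d, .const 0] (.ofNat (.const 0))) σ 1 σ₁ := by
    simpa [RExp.eval, IExp.eval] using
      Exec.setReal (O := (V.base a).O) σ [.const d, .const 0] (.ofNat (.const 0))
  have e2 : Exec (V.base a).O (.setInt (.const li) (.const 0) (.const 0)) σ₁ 1 σ₂ :=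
    Exec.setInt σ₁ (.const li) (.const 0) (.const 0)
  have f1 : Frame li d σ σ₁ := Frame.setReal σ (scratch_pair d 0) _
  have f2 : Frame li d σ₁ σ₂ := Frame.setInt σ₁ le_rfl 0 0
  obtain ⟨c, τ, hW, hc, hI, hI', hI''⟩ := exec_while (O := (V.base a).O)
    (b := .intLt (.get (.const li) (.const 0)) eB)
    (Q := .seq P (.seq (.setReal [.const d, .const 0] (.add (cell d) (cell (d + 1))))
          (.setInt (.const li) (.const 0) (.add (.get (.const li) (.const 0)) (.const 1)))))
    (fun n τ => Frame li d σ τ ∧ τ.ints li 0 = n ∧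
      τ.reals [d, 0] = ∑ n ∈ Finset.range n, g n) (B a) (b * ((V.base a).size + 1) ^ e + 2)
    (by
      rintro n hn τ ⟨h1, h2, h3⟩
      have hR := hσ.frame hV h1
      refine ⟨by simpa [Test.Holds, IExp.eval, h2, hB a τ hR] using hn, ?_⟩
      obtain ⟨c, υ, g1, g2, g3, g4⟩ := hP ⟨a, n, hn⟩ τ (hR.ext h2 hn)
      refine ⟨_, _, .seq g1 (.seq (.setReal υ _ _) (.setInt _ _ _ _)), ?_, ?_, ?_, ?_⟩
      · simp only [Ctx.ext_base] at g2
        omega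
      · refine ((h1.trans (g4.mono (Nat.le_succ _) (Nat.le_succ _))).trans
          (Frame.setReal υ ?_ _)).trans (Frame.setInt _ ?_ _ _)
        · exact scratch_pair d 0
        · simp [IExp.eval]
      · simp [State.setInt, State.setReal, IExp.eval, g4.ints li (Nat.lt_succ_self _), h2]
      · have : υ.reals [d, 0] = τ.reals [d, 0] :=
          g4.reals _ (not_scratch_pair 0 (Nat.lt_succ_self d))
        simp [State.setInt, State.setReal, IExp.eval, RExp.eval, cell, this, h3, g3, hg, hn,
          Finset.sum_range_succ])
    (by
      rintro τ ⟨h1, h2, h3⟩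
      simp [Test.Holds, IExp.eval, h2, hB a τ (hσ.frame hV h1)])
    σ₂ ⟨f1.trans f2, by simp [hσ₂, State.setInt],
      by simp [hσ₂, hσ₁, State.setInt, State.setReal]⟩
  refine ⟨_, τ, .seq e1 (.seq e2 hW), ?_, hI''.trans hsum.symm, hI⟩
  have hs : 1 ≤ (V.base a).size + 1 := by omega
  have a3 : 1 ≤ ((V.base a).size + 1) ^ e := Nat.one_le_pow _ _ hs
  have hq := hq a
  rw [pow_succ]
  set S := (V.base a).size + 1
  set M := S ^ e
  have t1 : B a * (b * M + 2 + 1) ≤ q * S * (b * M + 3 * M) :=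
    Nat.mul_le_mul hq (by omega)
  have t2 : 1 ≤ M * S := Nat.one_le_iff_ne_zero.mpr (by positivity)
  calc 1 + (1 + c) ≤ 3 + q * S * (b * M + 3 * M) := by omega
    _ ≤ 3 * (M * S) + q * S * (b * M + 3 * M) := by omega
    _ = (3 + q * (b + 3)) * (M * S) := by ring

/-- An oracle call. -/
theorem oracle {i : α → ℕ} {f : α → ℕ → ℝ} (hi : NComp V i)
    (hf : ∀ i, Comp (V.ext i fun a => (V.base a).m) (fun p => f p.1 p.2)) :
    Comp V (fun a => (V.base a).O (i a) (f a)) := by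
  intro li d hV
  obtain ⟨ei, hi⟩ := hi
  obtain ⟨eB, hB⟩ := NComp.m (V := V)
  obtain ⟨P, b, e, hP⟩ := hf li (li + 1) (d + 1) (hV.ext _)
  refine ⟨.seq (.setInt (.const li) (.const 0) (.const 0))
      (.seq (.while (.intLt (.get (.const li) (.const 0)) eB)
        (.seq P (.seq (.setReal [.const d, .const 1, .get (.const li) (.const 0)] (cell (d + 1)))
          (.setInt (.const li) (.const 0) (.add (.get (.const li) (.const 0)) (.const 1))))))
        (.call [.const d, .const 0] ei [.const d, .const 1])),
    b + 6, e + 1, fun a σ hσ => ?_⟩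
  set σ₂ := σ.setInt li 0 0 with hσ₂
  have e2 : Exec (V.base a).O (.setInt (.const li) (.const 0) (.const 0)) σ 1 σ₂ :=
    Exec.setInt σ (.const li) (.const 0) (.const 0)
  have f2 : Frame li d σ σ₂ := Frame.setInt σ le_rfl 0 0
  obtain ⟨c, τ, hW, hc, hI, hI', hI''⟩ := exec_while (O := (V.base a).O)
    (b := .intLt (.get (.const li) (.const 0)) eB)
    (Q := .seq P (.seq (.setReal [.const d, .const 1, .get (.const li) (.const 0)] (cell (d + 1)))
          (.setInt (.const li) (.const 0) (.add (.get (.const li) (.const 0)) (.const 1)))))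
    (fun n τ => Frame li d σ τ ∧ τ.ints li 0 = n ∧
      ∀ j < n, τ.reals [d, 1, j] = f a j) (V.base a).m (b * ((V.base a).size + 1) ^ e + 2)
    (by
      rintro n hn τ ⟨h1, h2, h3⟩
      have hR := hσ.frame hV h1
      refine ⟨by simpa [Test.Holds, IExp.eval, h2, hB a τ hR] using hn, ?_⟩
      obtain ⟨c, υ, g1, g2, g3, g4⟩ := hP ⟨a, n, hn⟩ τ (hR.ext h2 hn)
      have hn' : υ.ints li 0 = n := by rw [g4.ints li (Nat.lt_succ_self _), h2]
      refine ⟨_, _, .seq g1 (.seq (.setReal υ _ _) (.setInt _ _ _ _)), ?_, ?_, ?_, ?_⟩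
      · simp only [Ctx.ext_base] at g2
        omega
      · refine ((h1.trans (g4.mono (Nat.le_succ _) (Nat.le_succ _))).trans
          (Frame.setReal υ ?_ _)).trans (Frame.setInt _ ?_ _ _)
        · exact scratch_triple d 1 _
        · simp [IExp.eval]
      · simp [State.setInt, State.setReal, IExp.eval, hn']
      · intro j hj
        rcases Nat.lt_succ_iff_lt_or_eq.mp hj with hj | rfl
        · have : υ.reals [d, 1, j] = τ.reals [d, 1, j] :=
            g4.reals _ (not_scratch_triple 1 j (Nat.lt_succ_self d))
          have hne : j ≠ n := by omega
          simp [State.setInt, State.setReal, IExp.eval, hn', this, h3 j hj, hne]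
        · simp [State.setInt, State.setReal, IExp.eval, RExp.eval, cell, hn', g3])
    (by
      rintro τ ⟨h1, h2, h3⟩
      simp [Test.Holds, IExp.eval, h2, hB a τ (hσ.frame hV h1)])
    σ₂ ⟨f2, by simp [hσ₂, State.setInt], by simp⟩
  refine ⟨_, _, .seq e2 (.seq hW (.call τ _ _ _)), ?_, ?_,
    hI.trans (Frame.setReal τ (scratch_pair d 0) _)⟩
  · have hs : 1 ≤ (V.base a).size + 1 := by omega
    have a3 : 1 ≤ ((V.base a).size + 1) ^ e := Nat.one_le_pow _ _ hs
    have hm : (V.base a).m ≤ (V.base a).size + 1 := by unfold Base.size; omega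
    rw [pow_succ]
    set S := (V.base a).size + 1
    set M := S ^ e
    have t1 : (V.base a).m * (b * M + 2 + 1) ≤ S * (b * M + 3 * M) :=
      Nat.mul_le_mul hm (by omega)
    have t2 : 1 ≤ M * S := Nat.one_le_iff_ne_zero.mpr (by positivity)
    calc 1 + (c + 1) ≤ 3 + S * (b * M + 3 * M) := by omega
      _ ≤ 3 * (M * S) + S * (b * M + 3 * M) := by omega
      _ = (b + 6) * (M * S) := by ring
  · simp only [State.setReal, List.map_cons, List.map_nil, IExp.eval, Function.update_self,
      hi a τ (hσ.frame hV hI)]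
    exact (V.base a).isLocal _ _ _ fun j hj => hI'' j hj

end Comp

end VectorScheduling
namespace VectorScheduling

/-! ### The loop over the jobs -/

/-- The context without loop variables. -/
def Ctx.nil : Ctx Base := ⟨id, ∅⟩

/-- The base data when the job with index `s` is processed and the array of results is `Y`. -/
def Base.at (b : Base) (s : ℕ) (Y : ℕ → ℝ) : Base := { b with s := s, Y := Y }

/-- The array of results after `s` jobs, if `E₁` and `E₂` are evaluated in turn for each job: for
the job with index `s`, the value of `E₁` is stored in entry `2 s + 3` and that of `E₂` in entry
`2 s`. -/
noncomputable def results (E₁ E₂ : Base → ℝ) (b : Base) : ℕ → ℕ → ℝ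
  | 0 => b.Y
  | s + 1 =>
    let Y := Function.update (results E₁ E₂ b s) (2 * s + 3) (E₁ (b.at s (results E₁ E₂ b s)))
    Function.update Y (2 * s) (E₂ (b.at s Y))

theorem Rep.setY {b : Base} {s : ℕ} {Y : ℕ → ℝ} {σ : State} (h : Rep Ctx.nil (b.at s Y) σ) (n : ℕ)
    (x : ℝ) : Rep Ctx.nil (b.at s (Function.update Y n x)) (σ.setReal [n] x) := by
  refine ⟨h.m, h.r, h.k, h.t, h.s, fun n' => ?_, fun s i j c => ?_, fun v hv => hv.elim⟩
  · by_cases hn : n' = n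
    · subst hn
      simp [State.setReal, Ctx.nil, Base.at]
    · have := h.Y n'
      simp only [Ctx.nil, Base.at, id] at this
      simp [State.setReal, Ctx.nil, Base.at, hn, this]
  · have := h.C s i j c
    simp only [Ctx.nil, Base.at, id] at this
    simpa [State.setReal, Ctx.nil, Base.at] using this

theorem Rep.setS {b : Base} {s : ℕ} {Y : ℕ → ℝ} {σ : State} (h : Rep Ctx.nil (b.at s Y) σ)
    (s' : ℕ) : Rep Ctx.nil (b.at s' Y) (σ.setInt 4 0 s') := by
  refine ⟨?_, ?_, ?_, ?_, ?_, h.Y, h.C, fun v hv => hv.elim⟩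
  · simpa [State.setInt, Ctx.nil, Base.at] using h.m
  · simpa [State.setInt, Ctx.nil, Base.at] using h.r
  · simpa [State.setInt, Ctx.nil, Base.at] using h.k
  · simpa [State.setInt, Ctx.nil, Base.at] using h.t
  · simp [State.setInt, Ctx.nil, Base.at]

theorem Ctx.nil_bdd : Ctx.nil.Bdd 5 := ⟨le_rfl, fun _ hv => hv.elim⟩

/-- One program evaluates `E₁` and `E₂` for all jobs in turn and returns the last value of `E₂`,
which is a natural number, in the integer cell `(0, 0)`. -/
theorem exists_prog {E₁ E₂ : Base → ℝ} (h₁ : Comp Ctx.nil E₁) (h₂ : Comp Ctx.nil E₂) :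
    ∃ (P : Prog) (q e : ℕ), ∀ (b : Base) (σ : State) (x : ℕ), b.s = 0 → 1 ≤ b.m → 1 ≤ b.t →
      Rep Ctx.nil b σ → results E₁ E₂ b b.t (2 * (b.t - 1)) = x → x ≤ b.k →
      ∃ n τ, Exec b.O P σ n τ ∧ n ≤ q * b.size ^ e ∧ τ.ints 0 0 = x := by
  obtain ⟨P₁, q₁, e₁, hP₁⟩ := h₁ 5 0 Ctx.nil_bdd
  obtain ⟨P₂, q₂, e₂, hP₂⟩ := h₂ 5 0 Ctx.nil_bdd
  let gs : IExp := .get (.const 4) (.const 0)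
  let gt : IExp := .get (.const 3) (.const 0)
  let gx : IExp := .get (.const 5) (.const 0)
  let last : IExp := .sub gt (.const 1)
  let body : Prog := .seq P₁ (.seq (.setReal [.add (.add gs gs) (.const 3)] (Comp.cell 0))
    (.seq P₂ (.seq (.setReal [.add gs gs] (Comp.cell 0))
      (.setInt (.const 4) (.const 0) (.add gs (.const 1))))))
  let out : Prog := .while (.realLe (.add (.ofNat gx) (.ofNat (.const 1))) (.get [.add last last]))
    (.setInt (.const 5) (.const 0) (.add gx (.const 1)))
  refine ⟨.seq (.while (.intLt gs gt) body) (.seq (.setInt (.const 5) (.const 0) (.const 0))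
    (.seq out (.setInt (.const 0) (.const 0) gx))), (q₁ + q₂ + 8) * 2 ^ (e₁ + e₂ + 1),
    e₁ + e₂ + 1, fun b σ x hs hm ht hσ hx hxk => ?_⟩
  set S := b.size + 1 with hS
  have hb0 : b.at 0 b.Y = b := by
    cases b
    simp only at hs
    subst hs
    rfl
  obtain ⟨c, τ, hW, hc, hI⟩ := exec_while (O := b.O) (b := .intLt gs gt) (Q := body)
    (fun s τ => Rep Ctx.nil (b.at s (results E₁ E₂ b s)) τ) b.t (q₁ * S ^ e₁ + q₂ * S ^ e₂ + 3)
    (by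
      intro s hst τ hR
      refine ⟨?_, ?_⟩
      · have h4 : τ.ints 4 0 = s := hR.s
        have h3 : τ.ints 3 0 = b.t := hR.t
        simpa [Test.Holds, IExp.eval, gs, gt, h4, h3] using hst
      · obtain ⟨n₁, τ₁, g1, g2, g3, g4⟩ := hP₁ _ τ hR
        have hR₁ := hR.frame Ctx.nil_bdd g4
        have hs₁ : τ₁.ints 4 0 = s := hR₁.s
        have hR₂ := hR₁.setY (2 * s + 3) (E₁ (b.at s (results E₁ E₂ b s)))
        obtain ⟨n₂, τ₂, k1, k2, k3, k4⟩ := hP₂ _ _ hR₂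
        have hR₃ := hR₂.frame Ctx.nil_bdd k4
        have hs₃ : τ₂.ints 4 0 = s := hR₃.s
        have hR₄ := (hR₃.setY (2 * s) (E₂ (b.at s (Function.update (results E₁ E₂ b s) (2 * s + 3)
          (E₁ (b.at s (results E₁ E₂ b s))))))).setS (s + 1)
        have x₁ : Exec b.O (.setReal [.add (.add gs gs) (.const 3)] (Comp.cell 0)) τ₁ 1
            (τ₁.setReal [2 * s + 3] (E₁ (b.at s (results E₁ E₂ b s)))) := by
          have := Exec.setReal (O := b.O) τ₁ [.add (.add gs gs) (.const 3)] (Comp.cell 0)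
          simp only [List.map_cons, List.map_nil, IExp.eval, gs, hs₁, Comp.cell, RExp.eval, g3]
            at this
          rw [← two_mul] at this
          exact this
        have x₂ : Exec b.O (.setReal [.add gs gs] (Comp.cell 0)) τ₂ 1
            (τ₂.setReal [2 * s] (E₂ (b.at s (Function.update (results E₁ E₂ b s) (2 * s + 3)
              (E₁ (b.at s (results E₁ E₂ b s))))))) := by
          have := Exec.setReal (O := b.O) τ₂ [.add gs gs] (Comp.cell 0)
          simp only [List.map_cons, List.map_nil, IExp.eval, gs, hs₃, Comp.cell, RExp.eval, k3]
            at this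
          rw [← two_mul] at this
          exact this
        have x₃ := Exec.setInt (O := b.O) (τ₂.setReal [2 * s] (E₂ (b.at s (Function.update
            (results E₁ E₂ b s) (2 * s + 3) (E₁ (b.at s (results E₁ E₂ b s)))))))
            (.const 4) (.const 0) (.add gs (.const 1))
        have hs' : (τ₂.setReal [2 * s] (E₂ (b.at s (Function.update
            (results E₁ E₂ b s) (2 * s + 3) (E₁ (b.at s (results E₁ E₂ b s))))))).ints 4 0 = s :=
          hs₃
        simp only [IExp.eval, gs, hs'] at x₃
        refine ⟨_, _, .seq g1 (.seq x₁ (.seq k1 (.seq x₂ x₃))), ?_, hR₄⟩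
        have g2' : n₁ ≤ q₁ * S ^ e₁ := g2
        have k2' : n₂ ≤ q₂ * S ^ e₂ := k2
        omega)
    (by
      intro τ hR
      have h4 : τ.ints 4 0 = b.t := hR.s
      have h3 : τ.ints 3 0 = b.t := hR.t
      simp [Test.Holds, IExp.eval, gs, gt, h4, h3])
    σ (by simpa only [results, hb0] using hσ)
  have hread : ∀ υ : State, υ.ints 3 = τ.ints 3 → υ.reals = τ.reals →
      RExp.eval υ (.get [.add last last]) = x := by
    intro υ h3 hr
    have h3' : υ.ints 3 0 = b.t := by rw [h3]; exact hI.t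
    have := hI.Y (2 * (b.t - 1))
    simp only [Ctx.nil, Base.at, id] at this
    rw [two_mul] at this hx
    simp [RExp.eval, IExp.eval, last, gt, h3', hr, this, hx]
  obtain ⟨c', υ, hW', hc', hυ, -, -⟩ := exec_while (O := b.O)
    (b := .realLe (.add (.ofNat gx) (.ofNat (.const 1))) (.get [.add last last]))
    (Q := .setInt (.const 5) (.const 0) (.add gx (.const 1)))
    (fun n υ => υ.ints 5 0 = n ∧ υ.ints 3 = τ.ints 3 ∧ υ.reals = τ.reals) x 1
    (by
      rintro n hn υ ⟨h5, h3, hr⟩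
      refine ⟨?_, 1, _, .setInt υ _ _ _, le_rfl, ?_, ?_, hr⟩
      · change RExp.eval υ _ ≤ _
        rw [hread υ h3 hr]
        simp only [RExp.eval, IExp.eval, gx, h5]
        exact_mod_cast hn
      · simp [State.setInt, IExp.eval, gx, h5]
      · simp [State.setInt, IExp.eval, h3])
    (by
      rintro υ ⟨h5, h3, hr⟩ h
      change RExp.eval υ _ ≤ _ at h
      rw [hread υ h3 hr] at h
      simp only [RExp.eval, IExp.eval, gx, h5] at h
      norm_num at h)
    (τ.setInt 5 0 0) ⟨by simp [State.setInt], by simp [State.setInt], rfl⟩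
  refine ⟨_, _, .seq hW (.seq (.setInt τ _ _ _) (.seq hW' (.setInt υ _ _ _))), ?_, ?_⟩
  · have hS1 : 1 ≤ S := by omega
    have htS : b.t ≤ S := by rw [hS]; unfold Base.size; omega
    have hxS : x ≤ S := by rw [hS]; unfold Base.size; omega
    have hSz : S ≤ 2 * b.size := by rw [hS]; unfold Base.size; omega
    set M := S ^ (e₁ + e₂) with hM
    have a1 : S ^ e₁ ≤ M := Nat.pow_le_pow_right hS1 (by omega)
    have a2 : S ^ e₂ ≤ M := Nat.pow_le_pow_right hS1 (by omega)
    have a3 : 1 ≤ M := Nat.one_le_pow _ _ hS1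
    have a4 : q₁ * S ^ e₁ + q₂ * S ^ e₂ + 3 + 1 ≤ q₁ * M + q₂ * M + 4 * M := by
      have := Nat.mul_le_mul_left q₁ a1
      have := Nat.mul_le_mul_left q₂ a2
      omega
    have a5 := Nat.mul_le_mul htS a4
    have a6 : S ≤ S * M := Nat.le_mul_of_pos_right _ a3
    calc c + (1 + (c' + 1)) ≤ S * (q₁ * M + q₂ * M + 4 * M) + 4 * (S * M) := by
          have a7 : 2 ≤ S := by rw [hS]; unfold Base.size; omega
          omega
      _ = (q₁ + q₂ + 8) * S ^ (e₁ + e₂ + 1) := by rw [pow_succ, ← hM]; ring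
      _ ≤ (q₁ + q₂ + 8) * (2 * b.size) ^ (e₁ + e₂ + 1) :=
          Nat.mul_le_mul_left _ (Nat.pow_le_pow_left hSz _)
      _ = _ := by rw [mul_pow]; ring
  · simp [State.setInt, IExp.eval, gx, hυ]

end VectorScheduling
namespace VectorScheduling

/-! ### Functions with monotone increments -/

/-- `f` is monotone on the nonnegative cone, and its increments `f (x + o) - f x` in nonnegative
directions `o` are monotone in `x`. -/
structure Ultra {E : Type*} [AddCommMonoid E] [PartialOrder E] (f : E → ℝ) : Prop where
  mono : ∀ x y, 0 ≤ x → x ≤ y → f x ≤ f y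
  incr : ∀ x y o, 0 ≤ x → x ≤ y → 0 ≤ o → f (x + o) - f x ≤ f (y + o) - f y

/-- The increments of a convex function of one real variable are monotone. -/
theorem increment_mono {s : Set ℝ} {g : ℝ → ℝ} (hg : ConvexOn ℝ s g) {a b d : ℝ} (ha : a ∈ s)
    (hbd : b + d ∈ s) (hab : a ≤ b) (hd : 0 ≤ d) : g (a + d) - g a ≤ g (b + d) - g b := by
  rcases hd.eq_or_lt with rfl | hd
  · simp
  have hpos : 0 < b + d - a := by linarith
  set l := d / (b + d - a) with hl
  have hl0 : 0 ≤ l := by positivity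
  have hl1 : l ≤ 1 := by rw [hl, div_le_one hpos]; linarith
  have hlm : l * (b + d - a) = d := div_mul_cancel₀ _ hpos.ne'
  have h1 := hg.2 ha hbd (sub_nonneg.mpr hl1) hl0 (by ring)
  have h2 := hg.2 ha hbd hl0 (sub_nonneg.mpr hl1) (by ring)
  simp only [smul_eq_mul] at h1 h2
  rw [show (1 - l) * a + l * (b + d) = a + d by linear_combination hlm] at h1
  rw [show l * a + (1 - l) * (b + d) = b by linear_combination -hlm] at h2
  linarith

namespace Ultra
variable {E : Type*} [AddCommMonoid E] [PartialOrder E]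

theorem const (c : ℝ) : Ultra (fun _ : E => c) :=
  ⟨fun _ _ _ _ => le_rfl, fun _ _ _ _ _ _ => by simp⟩

theorem add {f g : E → ℝ} (hf : Ultra f) (hg : Ultra g) : Ultra (fun x => f x + g x) :=
  ⟨fun x y h h' => add_le_add (hf.mono x y h h') (hg.mono x y h h'),
    fun x y o h h' h'' => by linarith [hf.incr x y o h h' h'', hg.incr x y o h h' h'']⟩

theorem sum {ι : Type*} (s : Finset ι) {f : ι → E → ℝ} (hf : ∀ i ∈ s, Ultra (f i)) :
    Ultra (fun x => ∑ i ∈ s, f i x) :=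
  ⟨fun x y h h' => Finset.sum_le_sum fun i hi => (hf i hi).mono x y h h',
    fun x y o h h' h'' => by
      rw [← Finset.sum_sub_distrib, ← Finset.sum_sub_distrib]
      exact Finset.sum_le_sum fun i hi => (hf i hi).incr x y o h h' h''⟩

/-- A convex monotone function of a function with monotone increments. -/
theorem comp {f : E → ℝ} (hf : Ultra f) {s : Set ℝ} {g : ℝ → ℝ} (hg : ConvexOn ℝ s g)
    (hgm : MonotoneOn g s) (hs : ∀ x, 0 ≤ x → f x ∈ s) [IsOrderedAddMonoid E] :
    Ultra (fun x => g (f x)) := by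
  refine ⟨fun x y h h' => hgm (hs x h) (hs y (h.trans h')) (hf.mono x y h h'),
    fun x y o h h' h'' => ?_⟩
  have hy := h.trans h'
  have hi := hf.incr x y o h h' h''
  have hx0 : f x ≤ f (x + o) := hf.mono _ _ h (le_add_of_nonneg_right h'')
  have h1 : f y + (f (x + o) - f x) ∈ s :=
    hg.1.ordConnected.out (hs y hy) (hs (y + o) (add_nonneg hy h'')) ⟨by linarith, by linarith⟩
  have h2 := increment_mono hg (hs x h) h1 (hf.mono x y h h') (sub_nonneg.mpr hx0)
  have h3 := hgm h1 (hs (y + o) (add_nonneg hy h'')) (by linarith)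
  rw [add_sub_cancel] at h2
  linarith

theorem posPart [IsOrderedAddMonoid E] {f : E → ℝ} (hf : Ultra f) : Ultra (fun x => max (f x) 0) :=
  hf.comp (s := Set.univ) (g := fun x => max x 0)
    ((convexOn_id convex_univ).sup (convexOn_const 0 convex_univ))
    (fun _ _ _ _ h => max_le_max_right _ h) (fun _ _ => Set.mem_univ _)

theorem const_mul {f : E → ℝ} (hf : Ultra f) {c : ℝ} (hc : 0 ≤ c) : Ultra (fun x => c * f x) :=
  ⟨fun x y h h' => mul_le_mul_of_nonneg_left (hf.mono x y h h') hc,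
    fun x y o h h' h'' => by
      rw [← mul_sub, ← mul_sub]
      exact mul_le_mul_of_nonneg_left (hf.incr x y o h h' h'') hc⟩

theorem mul [IsOrderedAddMonoid E] {f g : E → ℝ} (hf : Ultra f) (hg : Ultra g)
    (hf0 : ∀ x, 0 ≤ x → 0 ≤ f x) (hg0 : ∀ x, 0 ≤ x → 0 ≤ g x) : Ultra (fun x => f x * g x) := by
  refine ⟨fun x y h h' => mul_le_mul (hf.mono x y h h') (hg.mono x y h h') (hg0 x h)
    (hf0 y (h.trans h')), fun x y o h h' h'' => ?_⟩
  have hy := h.trans h'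
  have a1 : (g (x + o) - g x) * f (x + o) ≤ (g (y + o) - g y) * f (y + o) :=
    mul_le_mul (hg.incr x y o h h' h'') (hf.mono _ _ (add_nonneg h h'') (by gcongr))
      (hf0 _ (add_nonneg h h''))
      (sub_nonneg.mpr (hg.mono _ _ hy (le_add_of_nonneg_right h'')))
  have a2 : (f (x + o) - f x) * g x ≤ (f (y + o) - f y) * g y :=
    mul_le_mul (hf.incr x y o h h' h'') (hg.mono _ _ h h') (hg0 _ h)
      (sub_nonneg.mpr (hf.mono _ _ hy (le_add_of_nonneg_right h'')))
  linarith

theorem prod [IsOrderedAddMonoid E] {ι : Type*} (s : Finset ι) {f : ι → E → ℝ}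
    (hf : ∀ i ∈ s, Ultra (f i)) (hf0 : ∀ i ∈ s, ∀ x, 0 ≤ x → 0 ≤ f i x) :
    Ultra (fun x => ∏ i ∈ s, f i x) := by
  classical
  induction s using Finset.induction_on with
  | empty => simpa using const (E := E) 1
  | insert i s hi ih =>
    simp only [Finset.prod_insert hi]
    refine mul (hf i (Finset.mem_insert_self i s))
      (ih (fun j hj => hf j (Finset.mem_insert_of_mem hj))
        fun j hj => hf0 j (Finset.mem_insert_of_mem hj))
      (hf0 i (Finset.mem_insert_self i s))
      fun x hx => Finset.prod_nonneg fun j hj => hf0 j (Finset.mem_insert_of_mem hj) x hx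

/-- Composition with a positive additive map. -/
theorem precomp {F : Type*} [AddCommMonoid F] [PartialOrder F] {f : F → ℝ} (hf : Ultra f)
    (φ : E →+ F) (hφ : ∀ x y, x ≤ y → φ x ≤ φ y) : Ultra (fun x => f (φ x)) := by
  have h0 : ∀ x, 0 ≤ x → 0 ≤ φ x := fun x hx => by simpa using hφ 0 x hx
  refine ⟨fun x y h h' => hf.mono _ _ (h0 x h) (hφ x y h'), fun x y o h h' h'' => ?_⟩
  simpa only [map_add] using hf.incr _ _ _ (h0 x h) (hφ x y h') (h0 o h'')

end Ultra

/-! ### A smooth exponential of the sum of the largest coordinates -/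

/-- A function with monotone increments that grows exponentially in the average of the `κ` largest
coordinates of `z`. The quantity `∑ j, max (z j - τ) 0 + κ * τ` is at least the sum of the `κ`
largest coordinates; the summand for the threshold `τ` is active where it exceeds `2 * κ * τ`. The
thresholds stop at `G`, so the exponential growth does so, too. -/
noncomputable def smoothTop {m : ℕ} (κ : ℝ) (G : ℕ) (z : Fin m → ℝ) : ℝ :=
  m + ∑ τ ∈ Finset.range (G + 1), 2 ^ τ * max ((∑ j, max (z j - τ) 0) / κ - τ) 0

section
variable {m : ℕ} {κ : ℝ} {G : ℕ}

theorem smoothTop_zero : smoothTop κ G (0 : Fin m → ℝ) = m := by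
  unfold smoothTop
  rw [add_eq_left]
  refine Finset.sum_eq_zero fun τ _ => ?_
  simp

theorem le_smoothTop (z : Fin m → ℝ) : (m : ℝ) ≤ smoothTop κ G z := by
  unfold smoothTop
  have : 0 ≤ ∑ τ ∈ Finset.range (G + 1),
      (2 : ℝ) ^ τ * max ((∑ j, max (z j - τ) 0) / κ - τ) 0 := by positivity
  linarith

theorem smoothTop_comp_perm (σ : Equiv.Perm (Fin m)) (z : Fin m → ℝ) :
    smoothTop κ G (z ∘ σ) = smoothTop κ G z := by
  unfold smoothTop
  congr 1
  refine Finset.sum_congr rfl fun τ _ => ?_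
  congr 4
  exact Equiv.sum_comp σ fun j => max (z j - τ) 0

theorem ultra_smoothTop (hκ : 0 ≤ κ) : Ultra (smoothTop κ G : (Fin m → ℝ) → ℝ) := by
  unfold smoothTop
  refine (Ultra.const _).add (Ultra.sum _ fun τ _ => Ultra.const_mul ?_ (by positivity))
  have h : ∀ j : Fin m, Ultra fun z : Fin m → ℝ => max (z j - τ) 0 := fun j => by
    refine Ultra.posPart ⟨fun x y _ h => ?_, fun x y o _ _ _ => ?_⟩
    · linarith [h j]
    · simp
  have h2 := ((Ultra.sum Finset.univ fun j _ => h j).const_mul (inv_nonneg.mpr hκ)).add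
    (Ultra.const (-(τ : ℝ)))
  simp only [inv_mul_eq_div, ← sub_eq_add_neg] at h2
  exact h2.posPart

/-- If `T` bounds the average of the `κ` largest coordinates of `o`, then an increase by `o` changes
`smoothTop` by a factor of at most `1 / (1 - 2 T)`. The increase of the summand for `τ + 1` is
charged to the summand for `τ`. -/
theorem smoothTop_add_le (hm : 1 ≤ m) (hκ : 1 ≤ κ) {z o : Fin m → ℝ} (ho : 0 ≤ o) {T : ℝ}
    (hT0 : 0 ≤ T) (hT : ∀ J : Finset (Fin m), ∑ j ∈ J, o j ≤ (κ + J.card) * T) :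
    (1 - 2 * T) * smoothTop κ G (z + o) ≤ smoothTop κ G z := by
  have hκ0 : 0 < κ := by linarith
  set H : (Fin m → ℝ) → ℕ → ℝ := fun z τ => (∑ j, max (z j - τ) 0) / κ - τ with hH
  set y := z + o with hy
  set J : ℕ → Finset (Fin m) := fun τ => Finset.univ.filter fun j => (τ : ℝ) < y j with hJ
  -- the increase of one summand
  have h1 : ∀ τ : ℕ, H y τ - H z τ ≤ (1 + (J τ).card / κ) * T := by
    intro τ
    have : ∑ j, max (y j - τ) 0 - ∑ j, max (z j - τ) 0 ≤ ∑ j ∈ J τ, o j := by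
      rw [← Finset.sum_sub_distrib, hJ, Finset.sum_filter]
      refine Finset.sum_le_sum fun j _ => ?_
      have hoj : 0 ≤ o j := ho j
      have hyj : y j = z j + o j := rfl
      split_ifs with hlt
      · rw [max_eq_left (by linarith : 0 ≤ y j - τ)]
        have := le_max_left (z j - (τ : ℝ)) 0
        linarith
      · rw [max_eq_right (by linarith : y j - τ ≤ 0)]
        have := le_max_right (z j - (τ : ℝ)) 0
        linarith
    calc H y τ - H z τ = (∑ j, max (y j - τ) 0 - ∑ j, max (z j - τ) 0) / κ := by
          simp only [hH]; ring
      _ ≤ ((κ + (J τ).card) * T) / κ := by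
          gcongr
          exact this.trans (hT _)
      _ = _ := by field_simp
  have h2 : ∀ τ : ℕ, max (H y τ) 0 - max (H z τ) 0 ≤ (1 + (J τ).card / κ) * T := by
    intro τ
    have hp : 0 ≤ (1 + (J τ).card / κ) * T := by positivity
    rcases le_total (H y τ) 0 with h | h
    · rw [max_eq_right h]
      linarith [le_max_right (H z τ) 0]
    · rw [max_eq_left h]
      linarith [le_max_left (H z τ) 0, h1 τ]
  -- raising the threshold by one lowers `H` by at least `1 + card / κ`, which pays for the increase
  have h3 : ∀ τ : ℕ, H y (τ + 1) + (1 + (J (τ + 1)).card / κ) ≤ H y τ := by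
    intro τ
    have : ∑ j, max (y j - (τ + 1 : ℕ)) 0 + (J (τ + 1)).card ≤ ∑ j, max (y j - τ) 0 := by
      have hc : ((J (τ + 1)).card : ℝ) = ∑ j, if ((τ + 1 : ℕ) : ℝ) < y j then (1 : ℝ) else 0 := by
        simp [hJ]
      rw [hc, ← Finset.sum_add_distrib]
      refine Finset.sum_le_sum fun j _ => ?_
      push_cast
      split_ifs with hlt
      · rw [max_eq_left (by linarith : 0 ≤ y j - (τ + 1))]
        have := le_max_left (y j - (τ : ℝ)) 0
        linarith
      · rw [add_zero]
        exact max_le_max_right _ (by linarith)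
    have := div_le_div_of_nonneg_right this hκ0.le
    rw [add_div] at this
    simp only [hH]
    push_cast at this ⊢
    linarith
  have h4 : ∀ τ : ℕ, max (H y (τ + 1)) 0 - max (H z (τ + 1)) 0 ≤ T * max (H y τ) 0 := by
    intro τ
    rcases le_total (H y (τ + 1)) 0 with h | h
    · rw [max_eq_right h]
      have : 0 ≤ T * max (H y τ) 0 := by positivity
      linarith [le_max_right (H z (τ + 1)) 0]
    · have := h2 (τ + 1)
      have h5 : (1 + (J (τ + 1)).card / κ) * T ≤ max (H y τ) 0 * T := by
        gcongr
        linarith [le_max_left (H y τ) 0, h3 τ]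
      linarith
  have h0 : max (H y 0) 0 - max (H z 0) 0 ≤ 2 * T * m := by
    refine (h2 0).trans ?_
    have hc : ((J 0).card : ℝ) ≤ m := by
      exact_mod_cast (Finset.card_le_univ _).trans_eq (Fintype.card_fin m)
    have hd : ((J 0).card : ℝ) / κ ≤ m :=
      (div_le_self (by positivity) hκ).trans hc
    have hm' : (1 : ℝ) ≤ m := by exact_mod_cast hm
    nlinarith
  have key : smoothTop κ G y - smoothTop κ G z ≤ 2 * T * smoothTop κ G y := by
    have e : smoothTop κ G y - smoothTop κ G z =
        ∑ τ ∈ Finset.range (G + 1), 2 ^ τ * (max (H y τ) 0 - max (H z τ) 0) := by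
      simp only [smoothTop, hH, mul_sub, Finset.sum_sub_distrib]
      ring
    have e2 : ∑ τ ∈ Finset.range G, (2 : ℝ) ^ (τ + 1) * (max (H y (τ + 1)) 0 - max (H z (τ + 1)) 0)
        ≤ ∑ τ ∈ Finset.range G, 2 * T * (2 ^ τ * max (H y τ) 0) := by
      refine Finset.sum_le_sum fun τ _ => ?_
      have := mul_le_mul_of_nonneg_left (h4 τ) (by positivity : (0 : ℝ) ≤ 2 ^ (τ + 1))
      rw [pow_succ] at this ⊢
      linarith
    have e3 : ∑ τ ∈ Finset.range G, 2 ^ τ * max (H y τ) 0 ≤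
        ∑ τ ∈ Finset.range (G + 1), 2 ^ τ * max (H y τ) 0 :=
      Finset.sum_le_sum_of_subset_of_nonneg (Finset.range_mono (Nat.le_succ G))
        fun _ _ _ => by positivity
    have e4 : smoothTop κ G y = m + ∑ τ ∈ Finset.range (G + 1), 2 ^ τ * max (H y τ) 0 := rfl
    rw [e, Finset.sum_range_succ', e4]
    rw [← Finset.mul_sum] at e2
    simp only [pow_zero, one_mul]
    nlinarith
  linarith

/-- The hypothesis holds whenever the average of the `κ` largest coordinates is at least `2 * τ + 1`
(`sum_le_threshold`); then the summand for `τ` alone is at least `2 ^ τ`. -/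
theorem two_pow_le_smoothTop {z : Fin m → ℝ} {τ : ℕ} (hκ : 0 < κ) (hτ : τ ≤ G)
    (h : (2 * τ + 1) * κ ≤ κ * τ + ∑ j, max (z j - τ) 0) : 2 ^ τ ≤ smoothTop κ G z := by
  have h1 : 1 ≤ (∑ j, max (z j - τ) 0) / κ - τ := by
    rw [le_sub_iff_add_le, le_div_iff₀ hκ]
    linarith
  have h2 : (2 : ℝ) ^ τ * max ((∑ j, max (z j - τ) 0) / κ - τ) 0 ≤
      ∑ τ ∈ Finset.range (G + 1), (2 : ℝ) ^ τ * max ((∑ j, max (z j - τ) 0) / κ - τ) 0 :=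
    Finset.single_le_sum (f := fun τ : ℕ => (2 : ℝ) ^ τ * max ((∑ j, max (z j - τ) 0) / κ - τ) 0)
      (fun _ _ => by positivity) (Finset.mem_range.mpr (by omega))
  have h3 : (2 : ℝ) ^ τ * 1 ≤ 2 ^ τ * max ((∑ j, max (z j - τ) 0) / κ - τ) 0 := by
    gcongr
    exact h1.trans (le_max_left _ _)
  unfold smoothTop
  have : (0 : ℝ) ≤ m := by positivity
  linarith

end

end VectorScheduling
namespace VectorScheduling

/-! ### Monotone symmetric norms and their duals -/

/-- The value of the Ball-Optimization oracle of `N` at `w`. -/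
noncomputable def dualNorm {m : ℕ} (N : (Fin m → ℝ) → ℝ) (w : Fin m → ℝ) : ℝ :=
  sSup {z : ℝ | ∃ v : Fin m → ℝ, N |v| ≤ 1 ∧ z = ∑ j, w j * v j}

namespace IsMonotoneSymmetricNorm
variable {m : ℕ} {N : (Fin m → ℝ) → ℝ}

theorem zero (hN : IsMonotoneSymmetricNorm N) : N 0 = 0 := by
  simpa using hN.smul 0 0

theorem nonneg (hN : IsMonotoneSymmetricNorm N) (x : Fin m → ℝ) : 0 ≤ N x := by
  have h := hN.add_le x (-x)
  have h' := hN.smul (-1) x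
  simp only [abs_neg, abs_one, one_mul, neg_smul, one_smul] at h'
  rw [add_neg_cancel, hN.zero, h'] at h
  linarith

theorem apply_single (hN : IsMonotoneSymmetricNorm N) (j : Fin m) (c : ℝ) (hc : 0 ≤ c) :
    N (Pi.single j c) = c * N (Pi.single j 1) := by
  have := hN.smul c (Pi.single j 1)
  rwa [← Pi.single_smul', smul_eq_mul, mul_one, abs_of_nonneg hc] at this

theorem single_pos (hN : IsMonotoneSymmetricNorm N) (j : Fin m) : 0 < N (Pi.single j 1) := by
  refine lt_of_le_of_ne (hN.nonneg _) fun h => ?_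
  have := congrFun (hN.eq_zero _ h.symm) j
  simp at this

theorem single_eq (hN : IsMonotoneSymmetricNorm N) (i j : Fin m) :
    N (Pi.single i 1) = N (Pi.single j 1) := by
  rw [← hN.perm (Equiv.swap i j) (Pi.single j 1)]
  congr 1
  ext l
  simp only [Function.comp_apply, Pi.single_apply, Equiv.swap_apply_eq_iff, Equiv.swap_apply_right]

theorem mul_single_le (hN : IsMonotoneSymmetricNorm N) {x : Fin m → ℝ} (hx : 0 ≤ x) (j : Fin m) :
    x j * N (Pi.single j 1) ≤ N x := by
  rw [← hN.apply_single j _ (hx j)]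
  refine hN.mono _ _ ?_ fun l => ?_
  · exact Pi.single_nonneg.mpr (hx j)
  · by_cases h : l = j
    · subst h; simp
    · simpa [Pi.single_apply, h] using hx l

theorem le_sum (hN : IsMonotoneSymmetricNorm N) {x : Fin m → ℝ} (hx : 0 ≤ x) :
    N x ≤ ∑ j, x j * N (Pi.single j 1) := by
  have key : ∀ s : Finset (Fin m),
      N (∑ j ∈ s, Pi.single j (x j)) ≤ ∑ j ∈ s, x j * N (Pi.single j 1) := by
    intro s
    induction s using Finset.induction_on with
    | empty => simp [hN.zero]
    | insert j s hj ih =>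
      rw [Finset.sum_insert hj, Finset.sum_insert hj]
      exact (hN.add_le _ _).trans (add_le_add (hN.apply_single j _ (hx j)).le ih)
  simpa only [Finset.univ_sum_single] using key Finset.univ

theorem bddAbove (hN : IsMonotoneSymmetricNorm N) (w : Fin m → ℝ) :
    BddAbove {z : ℝ | ∃ v : Fin m → ℝ, N |v| ≤ 1 ∧ z = ∑ j, w j * v j} := by
  refine ⟨∑ j, |w j| / N (Pi.single j 1), ?_⟩
  rintro _ ⟨v, hv, rfl⟩
  refine Finset.sum_le_sum fun j _ => ?_
  have h := (hN.mul_single_le (abs_nonneg v) j).trans hv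
  rw [← le_div_iff₀ (hN.single_pos j), Pi.abs_apply] at h
  calc w j * v j ≤ |w j| * |v j| := by rw [← abs_mul]; exact le_abs_self _
    _ ≤ |w j| * (1 / N (Pi.single j 1)) := by gcongr
    _ = _ := by ring

theorem sum_mul_le (hN : IsMonotoneSymmetricNorm N) (w v : Fin m → ℝ) :
    ∑ j, w j * v j ≤ dualNorm N w * N |v| := by
  rcases (hN.nonneg |v|).eq_or_lt with h | h
  · have hv : |v| = 0 := hN.eq_zero _ h.symm
    have hv' : v = 0 := by
      ext j
      simpa using congrFun hv j
    simp [hv', hN.zero]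
  · rw [← div_le_iff₀ h]
    refine le_csSup (hN.bddAbove w) ⟨(N |v|)⁻¹ • v, ?_, ?_⟩
    · have : |(N |v|)⁻¹ • v| = (N |v|)⁻¹ • |v| := by
        ext j
        simp [abs_mul, abs_of_pos h]
      rw [this, hN.smul, abs_of_pos (inv_pos.mpr h), inv_mul_cancel₀ h.ne']
    · rw [div_eq_inv_mul, Finset.mul_sum]
      exact Finset.sum_congr rfl fun j _ => by simp; ring

theorem dualNorm_le {c : ℝ} {w : Fin m → ℝ} (hN : IsMonotoneSymmetricNorm N) (hc : 0 ≤ c)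
    (h : ∀ v : Fin m → ℝ, ∑ j, w j * v j ≤ c * N |v|) : dualNorm N w ≤ c := by
  refine csSup_le ⟨0, 0, by simp [hN.zero], by simp⟩ ?_
  rintro _ ⟨v, hv, rfl⟩
  exact (h v).trans (mul_le_of_le_one_right hc hv)

theorem dualNorm_pos (hN : IsMonotoneSymmetricNorm N) {w : Fin m → ℝ} {j : Fin m} (hj : 0 < w j) :
    0 < dualNorm N w := by
  have h := hN.sum_mul_le w (Pi.single j 1)
  have h1 : ∑ i, w i * (Pi.single j 1 : Fin m → ℝ) i = w j := by simp [Pi.single_apply]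
  rw [h1] at h
  by_contra hneg
  have := mul_nonpos_of_nonpos_of_nonneg (not_lt.mp hneg) (hN.nonneg |(Pi.single j 1 : Fin m → ℝ)|)
  linarith

theorem dualNorm_single (hN : IsMonotoneSymmetricNorm N) (j : Fin m) :
    dualNorm N (Pi.single j 1) = 1 / N (Pi.single j 1) := by
  have hp := hN.single_pos j
  apply le_antisymm
  · refine hN.dualNorm_le (by positivity) fun v => ?_
    have h := hN.mul_single_le (abs_nonneg v) j
    rw [Pi.abs_apply] at h
    have h1 : ∑ i, (Pi.single j 1 : Fin m → ℝ) i * v i = v j := by simp [Pi.single_apply]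
    rw [h1, div_mul_eq_mul_div, one_mul, le_div_iff₀ hp]
    exact (mul_le_mul_of_nonneg_right (le_abs_self _) hp.le).trans h
  · have h := hN.sum_mul_le (Pi.single j 1) (Pi.single j 1)
    have h1 : ∑ i, (Pi.single j 1 : Fin m → ℝ) i * (Pi.single j 1 : Fin m → ℝ) i = 1 := by
      simp [Pi.single_apply]
    have h2 : |(Pi.single j 1 : Fin m → ℝ)| = Pi.single j 1 :=
      abs_of_nonneg (Pi.single_nonneg.mpr zero_le_one)
    rw [h1, h2] at h
    rwa [div_le_iff₀ hp]

/-- A norming functional, by the Hahn–Banach theorem. -/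
theorem exists_functional (hN : IsMonotoneSymmetricNorm N) {x : Fin m → ℝ} (hx : 0 ≤ x) :
    ∃ v : Fin m → ℝ, N x ≤ ∑ j, v j * x j ∧ ∀ y : Fin m → ℝ, ∑ j, v j * y j ≤ N |y| := by
  by_cases hx0 : x = 0
  · exact ⟨0, by simp [hx0, hN.zero], fun y => by simpa using hN.nonneg |y|⟩
  obtain ⟨g, hg, hg'⟩ := exists_extension_of_le_sublinear
    (LinearPMap.mkSpanSingleton (σ := RingHom.id ℝ) x (N x) hx0) (fun y => N |y|)
    (fun c hc y => by
      have : |c • y| = c • |y| := by ext j; simp [abs_mul, abs_of_pos hc]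
      rw [this, hN.smul, abs_of_pos hc])
    (fun y z => (hN.mono _ _ (abs_nonneg _) (abs_add_le y z)).trans (hN.add_le _ _))
    (by
      rintro ⟨y, hy⟩
      obtain ⟨c, rfl⟩ := Submodule.mem_span_singleton.mp hy
      rw [LinearPMap.mkSpanSingleton'_apply]
      have : |c • x| = |c| • x := by ext j; simp [abs_mul, abs_of_nonneg (hx j)]
      simp only [RingHom.id_apply, smul_eq_mul, this, hN.smul, abs_abs]
      exact mul_le_mul_of_nonneg_right (le_abs_self c) (hN.nonneg x))
  have hsum : ∀ y : Fin m → ℝ, g y = ∑ j, g (Pi.single j 1) * y j := by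
    intro y
    conv_lhs => rw [← Finset.univ_sum_single y]
    rw [map_sum]
    refine Finset.sum_congr rfl fun j _ => ?_
    have : (Pi.single j (y j) : Fin m → ℝ) = y j • Pi.single j 1 := by
      rw [← Pi.single_smul', smul_eq_mul, mul_one]
    rw [this, map_smul, smul_eq_mul, mul_comm]
  refine ⟨fun j => g (Pi.single j 1), ?_, fun y => ?_⟩
  · rw [← hsum]
    exact ((hg ⟨x, Submodule.mem_span_singleton_self x⟩).trans
      (LinearPMap.mkSpanSingleton'_apply_self _ _ _ _)).ge
  · rw [← hsum]
    exact hg' y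

end IsMonotoneSymmetricNorm

theorem exists_perm_antitone {m : ℕ} (x : Fin m → ℝ) : ∃ σ : Equiv.Perm (Fin m), Antitone (x ∘ σ) :=
  ⟨Tuple.sort (-x), fun i j h => by
    have := Tuple.monotone_sort (-x) h
    simp only [Function.comp_apply, Pi.neg_apply] at this ⊢
    linarith⟩

/-- For a nonincreasing vector, the norming functional can be taken nonnegative and
nonincreasing. -/
theorem IsMonotoneSymmetricNorm.exists_antitone_functional {m : ℕ} {N : (Fin m → ℝ) → ℝ}
    (hN : IsMonotoneSymmetricNorm N) {x : Fin m → ℝ} (hx : 0 ≤ x) (hxa : Antitone x) :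
    ∃ v : Fin m → ℝ, 0 ≤ v ∧ Antitone v ∧ N x ≤ ∑ j, v j * x j ∧
      ∀ y : Fin m → ℝ, ∑ j, v j * y j ≤ N |y| := by
  obtain ⟨v, hv, hv'⟩ := hN.exists_functional hx
  obtain ⟨ρ, hρ⟩ := exists_perm_antitone |v|
  refine ⟨|v| ∘ ρ, fun j => abs_nonneg _, hρ, hv.trans ?_, fun y => ?_⟩
  · have h1 : ∑ j, v j * x j ≤ ∑ j, |v| j * x j := Finset.sum_le_sum fun j _ =>
      mul_le_mul_of_nonneg_right (le_abs_self _) (hx j)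
    have hm : Monovary (|v| ∘ ρ) x := by
      intro i j hij
      rcases le_total i j with h | h
      · exact absurd (hxa h) (not_le.mpr hij)
      · exact hρ h
    have h2 := hm.sum_comp_perm_mul_le_sum_mul (σ := ρ⁻¹)
    have h3 : ∀ j, ρ (ρ⁻¹ j) = j := fun j => ρ.apply_symm_apply j
    simp only [Function.comp_apply, h3] at h2
    exact h1.trans h2
  · have h1 : ∑ j, (|v| ∘ ρ) j * y j = ∑ j, |v| j * y (ρ⁻¹ j) := by
      rw [← Equiv.sum_comp ρ fun j => |v| j * y (ρ⁻¹ j)]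
      simp
    have h2 : ∑ j, |v| j * y (ρ⁻¹ j) ≤ ∑ j, v j * (SignType.sign (v j) * |y (ρ⁻¹ j)|) := by
      refine Finset.sum_le_sum fun j _ => ?_
      rw [← mul_assoc, self_mul_sign, Pi.abs_apply]
      exact mul_le_mul_of_nonneg_left (le_abs_self _) (abs_nonneg _)
    refine (h1.trans_le h2).trans ((hv' _).trans ?_)
    rw [← hN.perm ρ⁻¹ |y|]
    refine hN.mono _ _ (abs_nonneg _) fun j => ?_
    simp only [Pi.abs_apply, abs_mul, abs_abs, Function.comp_apply]
    refine mul_le_of_le_one_left (abs_nonneg _) ?_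
    rcases SignType.sign (v j) with _ | _ | _ <;> simp

/-! ### Sums over initial segments of nonincreasing vectors -/

/-- A lower set of indices is an initial segment. -/
theorem mem_iff_lt_card {m : ℕ} {A : Finset (Fin m)} (hA : ∀ i j, i ≤ j → j ∈ A → i ∈ A)
    (j : Fin m) : j ∈ A ↔ (j : ℕ) < A.card := by
  constructor
  · intro hj
    have : Finset.Iic j ⊆ A := fun i hi => hA i j (Finset.mem_Iic.mp hi) hj
    simpa using Finset.card_le_card this
  · intro hj
    by_contra hjA
    have : A ⊆ Finset.Iio j := fun i hi => by
      rw [Finset.mem_Iio]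
      by_contra h
      exact hjA (hA j i (not_lt.mp h) hi)
    have := Finset.card_le_card this
    simp at this
    omega

/-- Doubling the number of coordinates at most doubles the sum of the largest coordinates. -/
theorem sum_le_two_mul_sum {m : ℕ} {x : Fin m → ℝ} (hx : 0 ≤ x) (hxa : Antitone x) {n κ : ℕ}
    (h : n ≤ 2 * κ) : ∑ j : Fin m, (if (j : ℕ) < n then x j else 0) ≤
      2 * ∑ j : Fin m, (if (j : ℕ) < κ then x j else 0) := by
  set X : ℕ → ℝ := fun j => if hj : j < m then x ⟨j, hj⟩ else 0 with hX
  have hX0 : ∀ j, 0 ≤ X j := fun j => by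
    simp only [hX]; split_ifs; exacts [hx _, le_rfl]
  have hXa : Antitone X := fun i j hij => by
    simp only [hX]
    split_ifs with h1 h2
    · exact hxa hij
    · omega
    · exact hx _
    · exact le_rfl
  have key : ∀ a : ℕ,
      ∑ j : Fin m, (if (j : ℕ) < a then x j else 0) = ∑ j ∈ Finset.range a, X j := by
    intro a
    have h1 : ∀ j : Fin m, (if (j : ℕ) < a then x j else 0) = if (j : ℕ) < a then X j else 0 := by
      intro j; simp [hX]
    rw [Finset.sum_congr rfl fun j _ => h1 j, Fin.sum_univ_eq_sum_range
      (fun j => if j < a then X j else 0), ← Finset.sum_filter]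
    refine Finset.sum_subset_zero_on_sdiff (fun j hj => ?_) (fun j hj => ?_) fun _ _ => rfl
    · simp only [Finset.mem_filter, Finset.mem_range] at hj ⊢
      exact hj.2
    · simp only [Finset.mem_sdiff, Finset.mem_filter, Finset.mem_range, not_and'] at hj
      simp only [hX, dif_neg (hj.2 hj.1)]
  rw [key, key]
  calc ∑ j ∈ Finset.range n, X j ≤ ∑ j ∈ Finset.range (κ + κ), X j :=
        Finset.sum_le_sum_of_subset_of_nonneg (Finset.range_mono (by omega)) fun _ _ _ => hX0 _
    _ = ∑ j ∈ Finset.range κ, X j + ∑ j ∈ Finset.range κ, X (κ + j) := Finset.sum_range_add _ _ _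
    _ ≤ ∑ j ∈ Finset.range κ, X j + ∑ j ∈ Finset.range κ, X j := by
        gcongr with j _
        exact hXa (by omega)
    _ = _ := by ring

/-- The sum of the `κ` largest coordinates is attained at a threshold. -/
theorem exists_threshold {m : ℕ} {x : Fin m → ℝ} (hx : 0 ≤ x) (hxa : Antitone x) (κ : ℕ) :
    ∃ t : ℝ, 0 ≤ t ∧
      κ * t + ∑ j, max (x j - t) 0 ≤ ∑ j : Fin m, if (j : ℕ) < κ then x j else 0 := by
  rcases lt_or_ge κ m with h | h
  · refine ⟨x ⟨κ, h⟩, hx _, le_of_eq ?_⟩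
    have hc : (κ : ℝ) * x ⟨κ, h⟩ = ∑ j : Fin m, if (j : ℕ) < κ then x ⟨κ, h⟩ else 0 := by
      rw [← Finset.sum_filter, Finset.sum_const, nsmul_eq_mul]
      congr 2
      have : Finset.univ.filter (fun j : Fin m => (j : ℕ) < κ) = Finset.Iio ⟨κ, h⟩ := by
        ext j; simp [Fin.lt_def]
      rw [this, Fin.card_Iio]
    rw [hc, ← Finset.sum_add_distrib]
    refine Finset.sum_congr rfl fun j _ => ?_
    split_ifs with hj
    · have : x ⟨κ, h⟩ ≤ x j := hxa (by rw [Fin.le_def]; exact hj.le)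
      rw [max_eq_left (by linarith)]
      ring
    · have : x j ≤ x ⟨κ, h⟩ := hxa (by rw [Fin.le_def]; exact not_lt.mp hj)
      rw [max_eq_right (by linarith)]
      ring
  · refine ⟨0, le_rfl, le_of_eq ?_⟩
    rw [mul_zero, zero_add]
    refine Finset.sum_congr rfl fun j _ => ?_
    rw [if_pos (j.2.trans_le h), sub_zero]
    exact max_eq_left (hx j)

theorem sum_le_threshold {m : ℕ} (x : Fin m → ℝ) (κ : ℕ) {t : ℝ} (ht : 0 ≤ t) :
    ∑ j : Fin m, (if (j : ℕ) < κ then x j else 0) ≤ κ * t + ∑ j, max (x j - t) 0 := by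
  have h1 : ∑ j : Fin m, (if (j : ℕ) < κ then t else 0) ≤ κ * t := by
    rw [← Finset.sum_filter, Finset.sum_const, nsmul_eq_mul]
    gcongr
    have := Finset.card_le_card_of_injOn (s := Finset.univ.filter (fun j : Fin m => (j : ℕ) < κ))
      (t := Finset.range κ) (fun j => (j : ℕ)) (fun j hj => by simpa using hj)
      (fun i _ j _ h => Fin.ext h)
    simpa using this
  have h2 : ∑ j : Fin m, (if (j : ℕ) < κ then x j else 0) ≤
      ∑ j : Fin m, ((if (j : ℕ) < κ then t else 0) + max (x j - t) 0) := by
    refine Finset.sum_le_sum fun j _ => ?_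
    split_ifs
    · linarith [le_max_left (x j - t) 0]
    · linarith [le_max_right (x j - t) 0]
  rw [Finset.sum_add_distrib] at h2
  linarith

/-- A sum over any set of coordinates, in terms of the `κ` largest coordinates. -/
theorem sum_le_card_mul_top {m : ℕ} {x : Fin m → ℝ} (hx : 0 ≤ x) (hxa : Antitone x) {κ : ℕ}
    (hκ : 1 ≤ κ) (J : Finset (Fin m)) :
    ∑ j ∈ J, x j ≤ (κ + J.card) * ((∑ j : Fin m, if (j : ℕ) < κ then x j else 0) / κ) := by
  obtain ⟨t, ht, h⟩ := exists_threshold hx hxa κ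
  have hκ' : (0 : ℝ) < κ := by exact_mod_cast hκ
  have h1 : ∑ j ∈ J, x j ≤ J.card * t + ∑ j, max (x j - t) 0 := by
    calc ∑ j ∈ J, x j ≤ ∑ j ∈ J, (t + max (x j - t) 0) :=
          Finset.sum_le_sum fun j _ => by linarith [le_max_left (x j - t) 0]
      _ = J.card * t + ∑ j ∈ J, max (x j - t) 0 := by
          rw [Finset.sum_add_distrib, Finset.sum_const, nsmul_eq_mul]
      _ ≤ _ := by
          gcongr
          exact Finset.subset_univ J
  set R := ∑ j, max (x j - t) 0
  have hR : 0 ≤ R := Finset.sum_nonneg fun j _ => le_max_right (x j - t) 0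
  have h2 : J.card * t + R ≤ (κ + J.card) * ((κ * t + R) / κ) := by
    have : (κ + J.card : ℝ) * ((κ * t + R) / κ) = κ * t + J.card * t + R + J.card * R / κ := by
      field_simp
      ring
    rw [this]
    have : 0 ≤ J.card * R / κ := by positivity
    nlinarith
  refine h1.trans (h2.trans ?_)
  gcongr

end VectorScheduling
namespace VectorScheduling

/-! ### A small family of functionals that approximates every symmetric norm -/

/-- The number of ones among the `s` lowest binary digits of `c`. -/
def ones (c s : ℕ) : ℕ := ∑ s' ∈ Finset.range s, c / 2 ^ s' % 2

/-- The number of digits of the codes. -/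
def wordLen (m : ℕ) : ℕ := Nat.clog 2 (4 * m * m)

/-- The positions of the zeros of the word with the code `c`. -/
def zeroPos (m c : ℕ) : Finset ℕ := (Finset.range (wordLen m)).filter fun s => c / 2 ^ s % 2 = 0

/-- The functional with the code `c`. The binary digits of `c` describe a lattice path; a zero that
comes after `h` zeros and `l` ones contributes the weight `2 ^ (-h)` on the first `2 ^ l`
coordinates. -/
noncomputable def weight (m c j : ℕ) : ℝ :=
  ∑ s ∈ zeroPos m c, (1 / 2) ^ (s - ones c s) * if j < 2 ^ ones c s then 1 else 0

theorem mod_two_zero_or_one (a : ℕ) : a % 2 = 0 ∨ a % 2 = 1 := by omega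

/-- Every nondecreasing sequence `l` with few values is described by a code. -/
theorem exists_code {m : ℕ} {l : ℕ → ℕ} (hl : Monotone l) {H : ℕ}
    (hH : 2 ^ (H + l H) < 4 * m * m) :
    ∃ c < 8 * m * m, zeroPos m c = (Finset.range (H + 1)).image (fun h => h + l h) ∧
      ∀ h ≤ H, ones c (h + l h) = l h := by
  classical
  set g : ℕ → ℕ := fun h => h + l h with hg
  have hgm : StrictMono g := fun a b hab => by
    have := hl hab.le
    simp only [hg]
    omega
  set Z := (Finset.range (H + 1)).image g with hZ
  set n := wordLen m with hn
  set c := Nat.ofBits (n := n) (fun i => decide ((i : ℕ) ∉ Z)) with hc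
  have hbit : ∀ s < n, (c / 2 ^ s % 2 = 0 ↔ s ∈ Z) := by
    intro s hs
    have h1 := Nat.testBit_ofBits_lt (n := n) (fun i => decide ((i : ℕ) ∉ Z)) s hs
    rw [Nat.testBit_eq_decide_div_mod_eq, ← hc] at h1
    have h2 : (c / 2 ^ s % 2 = 1 ↔ s ∉ Z) := by rwa [decide_eq_decide] at h1
    rcases mod_two_zero_or_one (c / 2 ^ s) with h | h
    · simp only [h, true_iff]
      by_contra h3
      have := h2.mpr h3
      omega
    · have := h2.mp h
      simp [h, this]
  have hZn : ∀ h ≤ H, g h < n := by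
    intro h hh
    rw [hn, wordLen, Nat.lt_clog_iff_pow_lt one_lt_two]
    exact (Nat.pow_le_pow_right two_pos (hgm.monotone hh)).trans_lt hH
  refine ⟨c, ?_, ?_, ?_⟩
  · have h1 : c < 2 ^ n := Nat.ofBits_lt_two_pow _
    have h0 : 1 < 4 * m * m := lt_of_le_of_lt (Nat.one_le_two_pow) hH
    have h2 : 2 ^ n.pred < 4 * m * m := Nat.pow_pred_clog_lt_self one_lt_two h0
    have h3 : n = n.pred + 1 := by
      have := hZn 0 (Nat.zero_le H)
      simp only [Nat.pred_eq_sub_one]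
      omega
    rw [h3, pow_succ] at h1
    linarith
  · ext s
    simp only [zeroPos, Finset.mem_filter, Finset.mem_range]
    constructor
    · rintro ⟨hs, h⟩
      exact (hbit s hs).mp h
    · intro hs
      obtain ⟨h, hh, rfl⟩ := Finset.mem_image.mp hs
      have := hZn h (by simpa [Nat.lt_succ_iff] using hh)
      exact ⟨this, (hbit _ this).mpr hs⟩
  · intro h hh
    have hgh := hZn h hh
    -- before the zero with index `h` there are exactly `h` zeros
    have h1 : (Finset.range (g h)).filter (· ∈ Z) = (Finset.range h).image g := by
      ext s
      simp only [Finset.mem_filter, Finset.mem_range, hZ, Finset.mem_image]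
      constructor
      · rintro ⟨hs, a, ha, rfl⟩
        exact ⟨a, hgm.lt_iff_lt.mp hs, rfl⟩
      · rintro ⟨a, ha, rfl⟩
        exact ⟨hgm ha, a, by omega, rfl⟩
    have h2 : ones c (g h) + ((Finset.range (g h)).filter (· ∈ Z)).card = g h := by
      rw [ones, Finset.card_filter, ← Finset.sum_add_distrib]
      rw [Finset.sum_congr rfl (g := fun _ => 1), Finset.sum_const, Finset.card_range, smul_eq_mul,
        mul_one]
      intro s hs
      have hs' := hbit s ((Finset.mem_range.mp hs).trans hgh)
      rcases mod_two_zero_or_one (c / 2 ^ s) with h | h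
      · rw [h, if_pos (hs'.mp h)]
      · rw [h, if_neg fun hz => by have := hs'.mpr hz; omega]
    rw [h1, Finset.card_image_of_injective _ hgm.injective, Finset.card_range] at h2
    simp only [hg] at h2 ⊢
    omega

/-- With `le_sum_geometric`: the dyadic layers of a number `u ≤ 1` add up to `u`, up to a factor of
`2` and an error of `2 ^ (-n)`. -/
theorem sum_geometric_le (n : ℕ) {u : ℝ} (hu : 0 ≤ u) :
    ∑ h ∈ Finset.range n, (1 / 2 : ℝ) ^ h * (if (1 / 2 : ℝ) ^ h ≤ u then 1 else 0) ≤ 2 * u := by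
  induction n generalizing u with
  | zero => simpa using hu
  | succ n ih =>
    by_cases h1 : 1 ≤ u
    · have h2 : ∑ h ∈ Finset.range (n + 1), (1 / 2 : ℝ) ^ h * (if (1 / 2 : ℝ) ^ h ≤ u then 1 else 0)
          ≤ ∑ h ∈ Finset.range (n + 1), (1 / 2 : ℝ) ^ h := by
        refine Finset.sum_le_sum fun h _ => mul_le_of_le_one_right (by positivity) ?_
        split_ifs <;> norm_num
      have h3 := sum_geometric_two_le (n + 1)
      linarith
    · rw [Finset.sum_range_succ']
      have h2 : ∀ h : ℕ, (1 / 2 : ℝ) ^ (h + 1) * (if (1 / 2 : ℝ) ^ (h + 1) ≤ u then 1 else 0) =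
          1 / 2 * ((1 / 2 : ℝ) ^ h * (if (1 / 2 : ℝ) ^ h ≤ 2 * u then 1 else 0)) := by
        intro h
        have : (1 / 2 : ℝ) ^ (h + 1) ≤ u ↔ (1 / 2 : ℝ) ^ h ≤ 2 * u := by
          rw [pow_succ]; constructor <;> intro h <;> linarith
        simp only [this]
        rw [pow_succ]
        ring
      simp only [h2, ← Finset.mul_sum, pow_zero, h1, if_false, mul_zero, add_zero]
      have := ih (u := 2 * u) (by positivity)
      linarith

theorem le_sum_geometric (n : ℕ) {u : ℝ} (hu1 : u ≤ 1) :
    u ≤ 2 * ∑ h ∈ Finset.range (n + 1), (1 / 2 : ℝ) ^ h * (if (1 / 2 : ℝ) ^ h ≤ u then 1 else 0) +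
      (1 / 2) ^ n := by
  induction n generalizing u with
  | zero =>
    have : (0 : ℝ) ≤ if (1 : ℝ) ≤ u then 1 else 0 := by split_ifs <;> norm_num
    simp only [zero_add, Finset.sum_range_one, pow_zero, one_mul]
    linarith
  | succ n ih =>
    by_cases h1 : 1 ≤ u
    · have := Finset.single_le_sum (f := fun h : ℕ => (1 / 2 : ℝ) ^ h *
        (if (1 / 2 : ℝ) ^ h ≤ u then 1 else 0)) (s := Finset.range (n + 1 + 1))
        (fun _ _ => by positivity) (Finset.mem_range.mpr (Nat.succ_pos _))
      simp only [pow_zero, h1, if_true, mul_one] at this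
      have : (0 : ℝ) ≤ (1 / 2) ^ (n + 1) := by positivity
      linarith
    · rw [Finset.sum_range_succ']
      have h2 : ∀ h : ℕ, (1 / 2 : ℝ) ^ (h + 1) * (if (1 / 2 : ℝ) ^ (h + 1) ≤ u then 1 else 0) =
          1 / 2 * ((1 / 2 : ℝ) ^ h * (if (1 / 2 : ℝ) ^ h ≤ 2 * u then 1 else 0)) := by
        intro h
        have : (1 / 2 : ℝ) ^ (h + 1) ≤ u ↔ (1 / 2 : ℝ) ^ h ≤ 2 * u := by
          rw [pow_succ]; constructor <;> intro h <;> linarith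
        simp only [this]
        rw [pow_succ]
        ring
      simp only [h2, ← Finset.mul_sum, pow_zero, h1, if_false, mul_zero, add_zero]
      by_cases h3 : 2 * u ≤ 1
      · have := ih h3
        rw [pow_succ]
        linarith
      · have := Finset.single_le_sum (f := fun h : ℕ => (1 / 2 : ℝ) ^ h *
          (if (1 / 2 : ℝ) ^ h ≤ 2 * u then 1 else 0)) (s := Finset.range (n + 1))
          (fun _ _ => by positivity) (Finset.mem_range.mpr (Nat.succ_pos _))
        simp only [pow_zero, (not_le.mp h3).le, if_true, mul_one] at this
        have : (0 : ℝ) ≤ (1 / 2) ^ (n + 1) := by positivity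
        linarith

theorem weight_nonneg (m c j : ℕ) : 0 ≤ weight m c j :=
  Finset.sum_nonneg fun _ _ => by positivity

/-- The functionals with codes below `8 m ^ 2`, normalized by their dual norms, determine the norm
up to a factor of `12`: round the layers `{j | 2 ^ (-h) v 0 ≤ v j}` of a norming functional `v` to
powers of two. -/
theorem IsMonotoneSymmetricNorm.exists_weight {m : ℕ} (hm : 1 ≤ m) {N : (Fin m → ℝ) → ℝ}
    (hN : IsMonotoneSymmetricNorm N) {x : Fin m → ℝ} (hx : 0 ≤ x) (hxa : Antitone x) :
    ∃ c < 8 * m * m, (zeroPos m c).Nonempty ∧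
      N x * dualNorm N (fun j : Fin m => weight m c j) ≤ 12 * ∑ j : Fin m, weight m c j * x j := by
  obtain ⟨v, hv0, hva, hv, hv'⟩ := hN.exists_antitone_functional hx hxa
  set z : Fin m := ⟨0, hm⟩ with hz
  have hvz : ∀ j, v j ≤ v z := fun j => hva (Fin.mk_le_of_le_val (Nat.zero_le _))
  have hxz : ∀ j, x j ≤ x z := fun j => hxa (Fin.mk_le_of_le_val (Nat.zero_le _))
  rcases (hv0 z).eq_or_lt with h0 | h0
  -- the norming functional is `0`, hence so is `N x`
  · refine ⟨0, by positivity, ⟨0, ?_⟩, ?_⟩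
    · have : 0 < wordLen m := Nat.clog_pos one_lt_two (by nlinarith)
      simp [zeroPos, this]
    have h1 : ∑ j, v j * x j = 0 := Finset.sum_eq_zero fun j _ => by
      rw [le_antisymm ((hvz j).trans h0.symm.le) (hv0 j)]; simp
    have h2 : N x = 0 := le_antisymm (hv.trans h1.le) (hN.nonneg x)
    rw [h2, zero_mul]
    exact mul_nonneg (by norm_num)
      (Finset.sum_nonneg fun j _ => mul_nonneg (weight_nonneg _ _ _) (hx j))
  change 0 < v z at h0
  set H := Nat.clog 2 m with hH
  set u : Fin m → ℝ := fun j => v j / v z with hu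
  have hu0 : ∀ j, 0 ≤ u j := fun j => div_nonneg (hv0 j) h0.le
  have hu1 : ∀ j, u j ≤ 1 := fun j => (div_le_one h0).mpr (hvz j)
  have hua : Antitone u := fun i j hij => div_le_div_of_nonneg_right (hva hij) h0.le
  -- `A h` is the layer of height `2 ^ (-h)`, an initial segment; its size is rounded to `2 ^ l h`
  set A : ℕ → Finset (Fin m) := fun h => Finset.univ.filter fun j => (1 / 2 : ℝ) ^ h ≤ u j with hA
  have hAm : ∀ h j, j ∈ A h ↔ (1 / 2 : ℝ) ^ h ≤ u j := fun h j => by simp [hA]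
  have hAc : ∀ h j, j ∈ A h ↔ (j : ℕ) < (A h).card := fun h j =>
    mem_iff_lt_card (fun i j hij hj => by
      rw [hAm] at hj ⊢
      exact hj.trans (hua hij)) j
  have hcard : ∀ h, (A h).card ≠ 0 := fun h => by
    have : z ∈ A h := by
      rw [hAm, hu]
      simp only [div_self h0.ne']
      exact pow_le_one₀ (by norm_num) (by norm_num)
    exact Finset.card_ne_zero_of_mem this
  set l : ℕ → ℕ := fun h => Nat.log 2 (A h).card with hl
  have hlm : Monotone l := fun a b hab => by
    refine Nat.log_mono_right (Finset.card_le_card fun j hj => ?_)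
    rw [hAm] at hj ⊢
    exact (pow_le_pow_of_le_one (by norm_num) (by norm_num) hab).trans hj
  have hl1 : ∀ h, 2 ^ l h ≤ (A h).card := fun h => Nat.pow_log_le_self 2 (hcard h)
  have hl2 : ∀ h, (A h).card ≤ 2 * 2 ^ l h := fun h => by
    have := Nat.lt_pow_succ_log_self one_lt_two (A h).card
    rw [Nat.pow_succ] at this
    simp only [hl]
    omega
  have hHm : m ≤ 2 ^ H := Nat.le_pow_clog one_lt_two m
  have hHm' : 2 ^ H < 2 * m := by
    rcases hm.eq_or_lt with h | h
    · rw [hH, ← h]; norm_num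
    · have h1 := Nat.pow_pred_clog_lt_self one_lt_two h
      have h2 : 0 < Nat.clog 2 m := Nat.clog_pos one_lt_two h
      rw [← hH] at h1 h2
      have h3 : H = H.pred + 1 := by simp only [Nat.pred_eq_sub_one]; omega
      rw [h3, pow_succ]
      omega
  -- the zero of the last layer has the position `H + l H`, which lies within the word
  have hlH : 2 ^ (H + l H) < 4 * m * m := by
    have h1 : 2 ^ l H ≤ m := (hl1 H).trans ((Finset.card_le_univ _).trans_eq (Fintype.card_fin m))
    rw [pow_add]
    calc 2 ^ H * 2 ^ l H ≤ 2 ^ H * m := Nat.mul_le_mul_left _ h1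
      _ < 2 * m * m := Nat.mul_lt_mul_of_pos_right hHm' (by omega)
      _ ≤ 4 * m * m := by nlinarith
  obtain ⟨c, hc, hZ, hones⟩ := exists_code hlm hlH
  refine ⟨c, hc, by simp [hZ], ?_⟩
  have hw : ∀ j : Fin m, weight m c j = ∑ h ∈ Finset.range (H + 1),
      (1 / 2 : ℝ) ^ h * if (j : ℕ) < 2 ^ l h then 1 else 0 := by
    intro j
    rw [weight, hZ, Finset.sum_image]
    · refine Finset.sum_congr rfl fun h hh => ?_
      rw [hones h (by simpa [Nat.lt_succ_iff] using hh), Nat.add_sub_cancel]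
    · intro a _ b _ hab
      rcases lt_trichotomy a b with h | h | h
      · have := hlm h.le
        simp only at hab
        omega
      · exact h
      · have := hlm h.le
        simp only at hab
        omega
  -- the functional before the sizes of the layers are rounded
  set w' : Fin m → ℝ := fun j => ∑ h ∈ Finset.range (H + 1),
      (1 / 2 : ℝ) ^ h * if (1 / 2 : ℝ) ^ h ≤ u j then 1 else 0 with hw'
  -- the dual norm of the functional
  have hD : dualNorm N (fun j : Fin m => weight m c j) ≤ 2 / v z := by
    refine hN.dualNorm_le (by positivity) fun y => ?_
    have h1 : ∀ j : Fin m, weight m c j ≤ 2 * u j := fun j => by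
      refine le_trans ?_ (sum_geometric_le (H + 1) (hu0 j))
      rw [hw]
      refine Finset.sum_le_sum fun h _ => mul_le_mul_of_nonneg_left ?_ (by positivity)
      by_cases hj : (j : ℕ) < 2 ^ l h
      · rw [if_pos hj, if_pos ((hAm h j).mp ((hAc h j).mpr (hj.trans_le (hl1 h))))]
      · rw [if_neg hj]
        split_ifs <;> norm_num
    calc ∑ j : Fin m, weight m c j * y j ≤ ∑ j, 2 * u j * |y| j := by
          refine Finset.sum_le_sum fun j _ => ?_
          refine (mul_le_mul_of_nonneg_left (le_abs_self (y j)) (weight_nonneg _ _ _)).trans ?_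
          exact mul_le_mul_of_nonneg_right (h1 j) (abs_nonneg _)
      _ = 2 / v z * ∑ j, v j * |y| j := by
          rw [Finset.mul_sum]
          exact Finset.sum_congr rfl fun j _ => by simp only [hu]; ring
      _ ≤ 2 / v z * N |y| := by
          have := hv' |y|
          rw [abs_abs] at this
          gcongr
  -- the value of the functional
  have hW0 : 0 ≤ ∑ j : Fin m, weight m c j * x j :=
    Finset.sum_nonneg fun j _ => mul_nonneg (weight_nonneg _ _ _) (hx j)
  have h1 : ∑ j, w' j * x j ≤ 2 * ∑ j : Fin m, weight m c j * x j := by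
    have e1 : ∑ j, w' j * x j = ∑ h ∈ Finset.range (H + 1), (1 / 2 : ℝ) ^ h *
        ∑ j : Fin m, if (j : ℕ) < (A h).card then x j else 0 := by
      simp only [hw', Finset.sum_mul, Finset.mul_sum]
      rw [Finset.sum_comm]
      refine Finset.sum_congr rfl fun h _ => Finset.sum_congr rfl fun j _ => ?_
      by_cases hj : j ∈ A h
      · rw [if_pos ((hAm h j).mp hj), if_pos ((hAc h j).mp hj), mul_one]
      · rw [if_neg fun h' => hj ((hAm h j).mpr h'), if_neg fun h' => hj ((hAc h j).mpr h')]
        ring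
    have e2 : ∑ j : Fin m, weight m c j * x j = ∑ h ∈ Finset.range (H + 1), (1 / 2 : ℝ) ^ h *
        ∑ j : Fin m, if (j : ℕ) < 2 ^ l h then x j else 0 := by
      simp only [hw, Finset.sum_mul, Finset.mul_sum]
      rw [Finset.sum_comm]
      refine Finset.sum_congr rfl fun h _ => Finset.sum_congr rfl fun j _ => ?_
      split_ifs <;> ring
    rw [e1, e2, Finset.mul_sum]
    refine Finset.sum_le_sum fun h _ => ?_
    have := mul_le_mul_of_nonneg_left (sum_le_two_mul_sum hx hxa (hl2 h))
      (by positivity : (0 : ℝ) ≤ (1 / 2) ^ h)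
    linarith
  have h2 : x z ≤ ∑ j, w' j * x j := by
    have e1 : 1 ≤ w' z := by
      have := Finset.single_le_sum (f := fun h : ℕ => (1 / 2 : ℝ) ^ h *
        (if (1 / 2 : ℝ) ^ h ≤ u z then 1 else 0)) (s := Finset.range (H + 1))
        (fun _ _ => by positivity) (Finset.mem_range.mpr (Nat.succ_pos _))
      have hz1 : u z = 1 := div_self h0.ne'
      simp only [pow_zero, hz1, le_refl, if_true, mul_one] at this
      simpa only [hw', hz1] using this
    have e2 := Finset.single_le_sum (f := fun j => w' j * x j) (s := Finset.univ)
      (fun j _ => mul_nonneg (Finset.sum_nonneg fun _ _ => by positivity) (hx j))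
      (Finset.mem_univ z)
    have e3 : 0 ≤ x z := hx z
    nlinarith
  -- the layers below `2 ^ (-H)` contribute at most `m * 2 ^ (-H) * x z ≤ x z`
  have h3 : ∑ j, u j * x j ≤ 3 * ∑ j, w' j * x j := by
    have e1 : ∑ j, u j * x j ≤ ∑ j, (2 * (w' j * x j) + (1 / 2) ^ H * x z) := by
      refine Finset.sum_le_sum fun j _ => ?_
      have := mul_le_mul_of_nonneg_right (le_sum_geometric H (hu1 j)) (hx j)
      have h4 : (1 / 2 : ℝ) ^ H * x j ≤ (1 / 2) ^ H * x z :=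
        mul_le_mul_of_nonneg_left (hxz j) (by positivity)
      simp only [hw']
      linarith
    have e2 : (m : ℝ) * ((1 / 2) ^ H * x z) ≤ x z := by
      have : (m : ℝ) ≤ 2 ^ H := by exact_mod_cast hHm
      have h5 : (m : ℝ) * (1 / 2) ^ H ≤ 1 := by
        rw [one_div, inv_pow, ← div_eq_mul_inv, div_le_one (by positivity)]
        exact this
      have h6 : 0 ≤ x z := hx z
      nlinarith
    rw [Finset.sum_add_distrib, ← Finset.mul_sum, Finset.sum_const, Finset.card_univ,
      Fintype.card_fin, nsmul_eq_mul] at e1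
    linarith
  have h4 : N x ≤ v z * (6 * ∑ j : Fin m, weight m c j * x j) := by
    refine hv.trans ?_
    have : ∑ j, v j * x j = v z * ∑ j, u j * x j := by
      rw [Finset.mul_sum]
      refine Finset.sum_congr rfl fun j _ => ?_
      simp only [hu]
      field_simp
    rw [this]
    gcongr
    linarith
  calc N x * dualNorm N (fun j : Fin m => weight m c j) ≤ N x * (2 / v z) :=
        mul_le_mul_of_nonneg_left hD (hN.nonneg x)
    _ ≤ v z * (6 * ∑ j : Fin m, weight m c j * x j) * (2 / v z) := by gcongr
    _ = 12 * ∑ j : Fin m, weight m c j * x j := by field_simp; ring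

/-! ### The potential of one resource -/

/-- The factor of the potential that belongs to the functional with the code `c`, whose dual norm is
`D`. The scaling is such that the averages of the `κ = 2 ^ ones c s` largest coordinates of the
arguments of `smoothTop` add up to a sixth of the normalized functional. -/
noncomputable def codePot {m : ℕ} (G c : ℕ) (D : ℝ) (x : Fin m → ℝ) : ℝ :=
  ∏ s ∈ zeroPos m c, smoothTop (2 ^ ones c s) G
    ((1 / 6 * (1 / 2) ^ (s - ones c s) * 2 ^ ones c s / D) • x)

section
variable {m G c : ℕ} {D : ℝ}

theorem codePot_zero : codePot G c D (0 : Fin m → ℝ) = (m : ℝ) ^ (zeroPos m c).card := by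
  simp [codePot, smoothTop_zero]

theorem one_le_prod_of_one_le {ι : Type*} (s : Finset ι) {f : ι → ℝ} (h : ∀ i ∈ s, 1 ≤ f i) :
    1 ≤ ∏ i ∈ s, f i := by
  simpa using Finset.prod_le_prod (f := fun _ => (1 : ℝ)) (fun _ _ => zero_le_one) h

theorem le_prod_of_one_le {ι : Type*} {s : Finset ι} {f : ι → ℝ} (h : ∀ i ∈ s, 1 ≤ f i) {i : ι}
    (hi : i ∈ s) : f i ≤ ∏ i ∈ s, f i := by
  classical
  rw [← Finset.mul_prod_erase s f hi]
  exact le_mul_of_one_le_right (zero_le_one.trans (h i hi))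
    (one_le_prod_of_one_le _ fun j hj => h j (Finset.mem_of_mem_erase hj))

theorem one_le_codePot (hm : 1 ≤ m) (x : Fin m → ℝ) : 1 ≤ codePot G c D x :=
  one_le_prod_of_one_le _ fun s _ =>
    (by exact_mod_cast hm : (1 : ℝ) ≤ m).trans (le_smoothTop _)

theorem codePot_comp_perm (σ : Equiv.Perm (Fin m)) (x : Fin m → ℝ) :
    codePot G c D (x ∘ σ) = codePot G c D x :=
  Finset.prod_congr rfl fun s _ => smoothTop_comp_perm σ
    ((1 / 6 * (1 / 2) ^ (s - ones c s) * 2 ^ ones c s / D) • x)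

theorem ultra_codePot (hD : 0 ≤ D) : Ultra (codePot G c D : (Fin m → ℝ) → ℝ) := by
  refine Ultra.prod _ (fun s _ => ?_) fun s _ x _ => (Nat.cast_nonneg m).trans (le_smoothTop _)
  have ha : 0 ≤ 1 / 6 * (1 / 2) ^ (s - ones c s) * 2 ^ ones c s / D := by positivity
  exact (ultra_smoothTop (m := m) (G := G) (by positivity : (0 : ℝ) ≤ 2 ^ ones c s)).precomp
    (DistribSMul.toAddMonoidHom (Fin m → ℝ) (1 / 6 * (1 / 2) ^ (s - ones c s) * 2 ^ ones c s / D))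
    fun x y h => smul_le_smul_of_nonneg_left h ha

theorem one_sub_sum_le_prod {ι : Type*} (s : Finset ι) {f : ι → ℝ} (h0 : ∀ i ∈ s, 0 ≤ f i)
    (h1 : ∀ i ∈ s, f i ≤ 1) : 1 - ∑ i ∈ s, f i ≤ ∏ i ∈ s, (1 - f i) := by
  classical
  induction s using Finset.induction_on with
  | empty => simp
  | insert i s hi ih =>
    rw [Finset.sum_insert hi, Finset.prod_insert hi]
    have ih' := ih (fun j hj => h0 j (Finset.mem_insert_of_mem hj))
      fun j hj => h1 j (Finset.mem_insert_of_mem hj)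
    have a := h0 i (Finset.mem_insert_self i s)
    have b := h1 i (Finset.mem_insert_self i s)
    have d : 0 ≤ ∑ i ∈ s, f i := Finset.sum_nonneg fun j hj => h0 j (Finset.mem_insert_of_mem hj)
    nlinarith [mul_le_mul_of_nonneg_left ih' (sub_nonneg.mpr b)]

theorem sum_weight_mul (x : Fin m → ℝ) : ∑ j : Fin m, weight m c j * x j =
    ∑ s ∈ zeroPos m c, (1 / 2) ^ (s - ones c s) *
      ∑ j : Fin m, if (j : ℕ) < 2 ^ ones c s then x j else 0 := by
  simp only [weight, Finset.sum_mul, Finset.mul_sum]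
  rw [Finset.sum_comm]
  refine Finset.sum_congr rfl fun h _ => Finset.sum_congr rfl fun j _ => ?_
  split_ifs <;> ring

/-- Adding a vector of norm at most `1` changes `codePot` by a factor of at most `3 / 2`. -/
theorem codePot_add_le (hm : 1 ≤ m) {N : (Fin m → ℝ) → ℝ} (hN : IsMonotoneSymmetricNorm N)
    {x o : Fin m → ℝ} (ho : 0 ≤ o) (hNo : N o ≤ 1) :
    codePot G c (dualNorm N fun j => weight m c j) (x + o) ≤
      3 / 2 * codePot G c (dualNorm N fun j => weight m c j) x := by
  obtain ⟨σ, hσ⟩ := exists_perm_antitone o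
  rw [← codePot_comp_perm σ, ← codePot_comp_perm σ x]
  set o' := o ∘ σ with ho'
  set x' := x ∘ σ with hx'
  have hadd : (x + o) ∘ σ = x' + o' := rfl
  rw [hadd]
  have ho0 : 0 ≤ o' := fun j => ho (σ j)
  have hNo' : N o' ≤ 1 := by rw [ho', hN.perm]; exact hNo
  set D := dualNorm N fun j => weight m c j with hD
  rcases (zeroPos m c).eq_empty_or_nonempty with hZ | ⟨s₀, hs₀⟩
  · simp [codePot, hZ]
    norm_num
  have hD0 : 0 < D := by
    refine hN.dualNorm_pos (j := ⟨0, hm⟩) ?_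
    refine Finset.sum_pos (fun s _ => ?_) ⟨s₀, hs₀⟩
    rw [if_pos (by positivity)]
    positivity
  set top : ℕ → ℝ := fun s => ∑ j : Fin m, if (j : ℕ) < 2 ^ ones c s then o' j else 0 with htop
  have htop0 : ∀ s, 0 ≤ top s := fun s => Finset.sum_nonneg fun j _ => by
    split_ifs; exacts [ho0 j, le_rfl]
  set a : ℕ → ℝ := fun s => 1 / 6 * (1 / 2) ^ (s - ones c s) * 2 ^ ones c s / D with ha
  have ha0 : ∀ s, 0 ≤ a s := fun s => by positivity
  -- the averages of the largest coordinates that enter `smoothTop_add_le`; they add up to at most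
  -- `1 / 6`, so that the product of the `1 - 2 * T s` is at least `2 / 3`
  set T : ℕ → ℝ := fun s => a s * (top s / 2 ^ ones c s) with hT
  have hT0 : ∀ s, 0 ≤ T s := fun s => mul_nonneg (ha0 s) (div_nonneg (htop0 s) (by positivity))
  have hTsum : ∑ s ∈ zeroPos m c, T s ≤ 1 / 6 := by
    have e1 : ∑ s ∈ zeroPos m c, T s = 1 / 6 / D * ∑ j : Fin m, weight m c j * o' j := by
      rw [sum_weight_mul, Finset.mul_sum]
      refine Finset.sum_congr rfl fun s _ => ?_
      simp only [hT, ha, htop]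
      field_simp
    have e2 := hN.sum_mul_le (fun j => weight m c j) o'
    rw [abs_of_nonneg ho0] at e2
    rw [e1, div_mul_eq_mul_div, div_le_iff₀ hD0]
    have := mul_le_mul_of_nonneg_left hNo' hD0.le
    linarith
  have hstep : ∀ s ∈ zeroPos m c, (1 - 2 * T s) * smoothTop (2 ^ ones c s) G (a s • (x' + o')) ≤
      smoothTop (2 ^ ones c s) G (a s • x') := by
    intro s _
    rw [smul_add]
    refine smoothTop_add_le hm (one_le_pow₀ (by norm_num)) (smul_nonneg (ha0 s) ho0) (hT0 s)
      fun J => ?_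
    have := sum_le_card_mul_top ho0 hσ (κ := 2 ^ ones c s) Nat.one_le_two_pow J
    push_cast at this
    calc ∑ j ∈ J, (a s • o') j = a s * ∑ j ∈ J, o' j := by simp [Finset.mul_sum]
      _ ≤ a s * ((2 ^ ones c s + J.card) * (top s / 2 ^ ones c s)) :=
          mul_le_mul_of_nonneg_left this (ha0 s)
      _ = _ := by simp only [hT]; ring
  have hT1 : ∀ s ∈ zeroPos m c, 2 * T s ≤ 1 := fun s hs => by
    have := Finset.single_le_sum (fun s _ => hT0 s) hs
    linarith
  have hprod : (∏ s ∈ zeroPos m c, (1 - 2 * T s)) * codePot G c D (x' + o') ≤ codePot G c D x' := by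
    rw [codePot, codePot, ← Finset.prod_mul_distrib]
    exact Finset.prod_le_prod (fun s hs => mul_nonneg (by linarith [hT1 s hs])
      ((Nat.cast_nonneg m).trans (le_smoothTop _))) hstep
  have h1 := one_sub_sum_le_prod (zeroPos m c) (f := fun s => 2 * T s)
    (fun s _ => by linarith [hT0 s]) hT1
  rw [← Finset.mul_sum] at h1
  have h2 := one_le_codePot (G := G) (c := c) (D := D) hm (x' + o')
  nlinarith

/-- If all factors `codePot` are bounded by `2 ^ b`, then so is the norm, in terms of `b`. -/
theorem norm_le_of_codePot_le (hm : 1 ≤ m) {N : (Fin m → ℝ) → ℝ} (hN : IsMonotoneSymmetricNorm N)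
    {x : Fin m → ℝ} (hx : 0 ≤ x) {b : ℝ} (hbG : b < G)
    (h : ∀ c < 8 * m * m, codePot G c (dualNorm N fun j => weight m c j) x ≤ 2 ^ b) :
    N x ≤ 72 * (2 * b + 3 * wordLen m) := by
  obtain ⟨σ, hσ⟩ := exists_perm_antitone x
  set x' := x ∘ σ with hx'
  have hx0 : 0 ≤ x' := fun j => hx (σ j)
  obtain ⟨c, hc, ⟨s₀, hs₀⟩, hNc⟩ := hN.exists_weight hm hx0 hσ
  have hB := h c hc
  rw [← codePot_comp_perm σ] at hB
  rw [← hN.perm σ]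
  change codePot G c _ x' ≤ _ at hB
  change N x' ≤ _
  set D := dualNorm N fun j => weight m c j with hD
  have hb0 : 0 ≤ b := by
    by_contra hb
    have := Real.rpow_lt_one_of_one_lt_of_neg one_lt_two (not_le.mp hb)
    linarith [one_le_codePot (G := G) (c := c) (D := D) hm x']
  set top : ℕ → ℝ := fun s => ∑ j : Fin m, if (j : ℕ) < 2 ^ ones c s then x' j else 0 with htop
  set a : ℕ → ℝ := fun s => 1 / 6 * (1 / 2) ^ (s - ones c s) * 2 ^ ones c s / D with ha
  have hmr : (1 : ℝ) ≤ m := by exact_mod_cast hm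
  set S : ℕ → ℝ := fun s => smoothTop (2 ^ ones c s) G (a s • x') with hS
  have hS1 : ∀ s, 1 ≤ S s := fun s => hmr.trans (le_smoothTop _)
  -- the exponents of the factors: they add up to at most `b`, and they bound the averages of the
  -- largest coordinates, whose sum is a sixth of the normalized functional
  choose n hn hn' using fun s => exists_nat_pow_near (hS1 s) (one_lt_two (α := ℝ))
  have hSle : ∀ s ∈ zeroPos m c, S s ≤ 2 ^ b := fun s hs => by
    refine le_trans ?_ hB
    exact le_prod_of_one_le (fun i _ => hS1 i) hs
  have hnG : ∀ s ∈ zeroPos m c, n s + 1 ≤ G := fun s hs => by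
    have h1 : (2 : ℝ) ^ (n s) < 2 ^ G := by
      refine (hn s).trans_lt ((hSle s hs).trans_lt ?_)
      rw [← Real.rpow_natCast]
      exact Real.rpow_lt_rpow_of_exponent_lt one_lt_two hbG
    exact (pow_lt_pow_iff_right₀ one_lt_two).mp h1
  have hsum : (∑ s ∈ zeroPos m c, (n s : ℝ)) ≤ b := by
    have h1 : (2 : ℝ) ^ (∑ s ∈ zeroPos m c, n s) ≤ 2 ^ b := by
      rw [← Finset.prod_pow_eq_pow_sum]
      exact (Finset.prod_le_prod (fun _ _ => by positivity) fun s _ => hn s).trans hB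
    rw [← Real.rpow_natCast, Real.rpow_le_rpow_left_iff one_lt_two] at h1
    exact_mod_cast h1
  have hD0 : 0 < D := by
    refine hN.dualNorm_pos (j := ⟨0, hm⟩) ?_
    refine Finset.sum_pos (fun s _ => ?_) ⟨s₀, hs₀⟩
    rw [if_pos (by positivity)]
    positivity
  have ha0 : ∀ s, 0 < a s := fun s => by positivity
  -- otherwise the threshold `n s + 1` makes the factor too large
  have hT : ∀ s ∈ zeroPos m c, a s * top s / 2 ^ ones c s ≤ 2 * n s + 3 := by
    intro s hs
    by_contra hcon
    have hlt := not_le.mp hcon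
    rw [lt_div_iff₀ (by positivity)] at hlt
    have h2 : (0 : ℝ) ≤ ((n s + 1 : ℕ) : ℝ) / a s := div_nonneg (Nat.cast_nonneg _) (ha0 s).le
    have h3 := mul_le_mul_of_nonneg_left (sum_le_threshold x' (2 ^ ones c s) h2) (ha0 s).le
    have h4 : a s * (((2 ^ ones c s : ℕ) : ℝ) * (((n s + 1 : ℕ) : ℝ) / a s) +
        ∑ j, max (x' j - ((n s + 1 : ℕ) : ℝ) / a s) 0) =
        2 ^ ones c s * ((n s + 1 : ℕ) : ℝ) + ∑ j, max ((a s • x') j - ((n s + 1 : ℕ) : ℝ)) 0 := by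
      rw [mul_add, Finset.mul_sum]
      congr 1
      · push_cast
        field_simp [(ha0 s).ne']
      · refine Finset.sum_congr rfl fun j _ => ?_
        rw [mul_max_of_nonneg _ _ (ha0 s).le, mul_sub, mul_zero,
          mul_div_cancel₀ _ (ha0 s).ne', Pi.smul_apply, smul_eq_mul]
    rw [h4] at h3
    have h5 := two_pow_le_smoothTop (z := a s • x') (κ := 2 ^ ones c s) (by positivity) (hnG s hs)
      (by push_cast at h3 hlt ⊢; linarith)
    exact absurd h5 (not_le.mpr (hn' s))
  have e1 : ∑ s ∈ zeroPos m c, a s * top s / 2 ^ ones c s =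
      1 / 6 / D * ∑ j : Fin m, weight m c j * x' j := by
    rw [sum_weight_mul, Finset.mul_sum]
    refine Finset.sum_congr rfl fun s _ => ?_
    simp only [ha, htop]
    field_simp
  have e2 := Finset.sum_le_sum hT
  rw [e1, Finset.sum_add_distrib, ← Finset.mul_sum, Finset.sum_const, nsmul_eq_mul,
    div_mul_eq_mul_div, div_le_iff₀ hD0] at e2
  have hcard : ((zeroPos m c).card : ℝ) ≤ wordLen m := by
    exact_mod_cast (Finset.card_filter_le _ _).trans_eq (Finset.card_range _)
  have e3 : (2 * ∑ s ∈ zeroPos m c, (n s : ℝ) + (zeroPos m c).card * 3) * D ≤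
      (2 * b + 3 * wordLen m) * D := by
    refine mul_le_mul_of_nonneg_right ?_ hD0.le
    linarith
  have e4 : N x' * D ≤ 72 * (2 * b + 3 * wordLen m) * D := by linarith
  exact le_of_mul_le_mul_right e4 hD0

end

end VectorScheduling
namespace VectorScheduling

/-! ### The greedy algorithm with a doubling scale -/

/-- The first index below `B` that satisfies `p`, and `B` if there is none. -/
noncomputable def firstIdx (B : ℕ) (p : ℕ → Prop) : ℕ := by
  classical exact ((Finset.range B).filter fun n => ∀ n' ≤ n, ¬ p n').card

theorem firstIdx_eq {B n : ℕ} {p : ℕ → Prop} (hn : n < B) (hp : p n) (h : ∀ n' < n, ¬ p n') :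
    firstIdx B p = n := by
  classical
  rw [firstIdx, ← Finset.card_range n]
  congr 1
  ext a
  simp only [Finset.mem_filter, Finset.mem_range]
  exact ⟨fun ha => by_contra fun hna => ha.2 n (not_lt.mp hna) hp,
    fun ha => ⟨ha.trans hn, fun n' hn' => h n' (hn'.trans_lt ha)⟩⟩

theorem firstIdx_spec {B : ℕ} {p : ℕ → Prop} (h : ∃ n < B, p n) :
    firstIdx B p < B ∧ p (firstIdx B p) ∧ ∀ n < firstIdx B p, ¬ p n := by
  classical
  obtain ⟨n, hn, hp⟩ := h
  have hex : ∃ n, p n := ⟨n, hp⟩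
  rw [firstIdx_eq ((Nat.find_le hp).trans_lt hn) (Nat.find_spec hex)
    fun n' hn' => Nat.find_min hex hn']
  exact ⟨(Nat.find_le hp).trans_lt hn, Nat.find_spec hex, fun n' hn' => Nat.find_min hex hn'⟩

/-- The first minimizer of `f` below `k`. -/
noncomputable def argmin (k : ℕ) (f : ℕ → ℝ) : ℕ := firstIdx k fun c => ∀ c' < k, f c ≤ f c'

theorem argmin_spec {k : ℕ} (hk : 1 ≤ k) (f : ℕ → ℝ) :
    argmin k f < k ∧ ∀ c < k, f (argmin k f) ≤ f c := by
  obtain ⟨c, hc, h⟩ := (Finset.range k).exists_min_image f ⟨0, Finset.mem_range.mpr hk⟩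
  obtain ⟨h1, h2, -⟩ := firstIdx_spec (B := k) (p := fun c => ∀ c' < k, f c ≤ f c')
    ⟨c, by simpa using hc, fun c' hc' => h c' (by simpa using hc')⟩
  exact ⟨h1, h2⟩

section
variable {W : Type*} [AddCommGroup W]

/-- The load of those of the first `s` jobs that are processed at the scale `Λ`, if the job `s'` is
processed with option `x s'` at the scale `lam (s' + 1)`; `C s' c` is the load of the job `s'`
under option `c`. -/
noncomputable def load (C : ℕ → ℕ → W) (lam : ℕ → ℝ) (x : ℕ → ℕ) (s : ℕ) (Λ : ℝ) : W :=
  ∑ s' ∈ Finset.range s, if lam (s' + 1) = Λ then C s' (x s') else 0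

theorem load_succ (C : ℕ → ℕ → W) (lam : ℕ → ℝ) (x : ℕ → ℕ) (s : ℕ) (Λ : ℝ) :
    load C lam x (s + 1) Λ =
      load C lam x s Λ + if lam (s + 1) = Λ then C s (x s) else 0 :=
  Finset.sum_range_succ _ _

variable [PartialOrder W] [IsOrderedAddMonoid W]

theorem load_nonneg {C : ℕ → ℕ → W} (hC : ∀ s c, 0 ≤ C s c) (lam : ℕ → ℝ) (x : ℕ → ℕ) (s : ℕ)
    (Λ : ℝ) : 0 ≤ load C lam x s Λ :=
  Finset.sum_nonneg fun _ _ => by split_ifs <;> simp [hC]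

theorem load_le {C : ℕ → ℕ → W} (hC : ∀ s c, 0 ≤ C s c) (lam : ℕ → ℝ) (x : ℕ → ℕ) (s : ℕ)
    (Λ : ℝ) : load C lam x s Λ ≤ ∑ s' ∈ Finset.range s, C s' (x s') :=
  Finset.sum_le_sum fun _ _ => by split_ifs <;> simp [hC]

/-- The main property of greedy choices: with monotone increments of the objective `F`, the increase
of the objective is at most its increase if the loads of any other choices `y` are added on top. -/
theorem greedy_le {F : W → ℝ} (hF : Ultra F) {C : ℕ → ℕ → W} (hC : ∀ s c, 0 ≤ C s c)
    {lam : ℕ → ℝ} {x y : ℕ → ℕ} {Λ : ℝ} {s : ℕ}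
    (h : ∀ s' < s, lam (s' + 1) = Λ →
      F (load C lam x s' Λ + C s' (x s')) ≤ F (load C lam x s' Λ + C s' (y s'))) :
    F (load C lam x s Λ) - F 0 ≤
      F (load C lam x s Λ + load C lam y s Λ) - F (load C lam x s Λ) := by
  induction s with
  | zero => simp [load]
  | succ s ih =>
    have ih := ih fun s' hs' => h s' (hs'.trans (Nat.lt_succ_self s))
    rw [load_succ, load_succ]
    split_ifs with hl
    · have h1 := h s (Nat.lt_succ_self s) hl
      set L := load C lam x s Λ
      set O := load C lam y s Λ
      have hL : 0 ≤ L := load_nonneg hC lam x s Λ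
      have hO : 0 ≤ O := load_nonneg hC lam y s Λ
      have ha := hC s (x s)
      have h2 := hF.incr L (L + C s (x s)) O hL (le_add_of_nonneg_right ha) hO
      have h3 := hF.incr L (L + C s (x s) + O) (C s (y s)) hL
        (by rw [add_assoc]; exact le_add_of_nonneg_right (add_nonneg ha hO)) (hC s (y s))
      rw [← add_assoc]
      linarith
    · simpa using ih

end

section
variable {W : Type*} [AddCommGroup W] [Module ℝ W]

/-- The objective at the scale `Λ`. At the scale `0`, where `Λ⁻¹ • x` is `0`, the penalty makes
every load of positive cost unacceptable. -/
noncomputable def score (Φ crude : W → ℝ) (Λ : ℝ) (x : W) : ℝ :=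
  Φ (Λ⁻¹ • x) + if Λ ≤ 0 ∧ 0 < crude x then 2 * Φ 0 else 0

theorem score_eq {Φ crude : W → ℝ} {Λ : ℝ} (hΛ : 0 < Λ) (z : W) :
    score Φ crude Λ z = Φ (Λ⁻¹ • z) := by
  simp [score, not_le.mpr hΛ]

/-- The candidates for the scale of the next job, if the last scale was `Λ` and `β` is a lower bound
on the optimum. -/
noncomputable def scale (Λ β : ℝ) : ℕ → ℝ
  | 0 => Λ
  | n + 1 => max (2 * Λ) β * 2 ^ n

variable [PartialOrder W]

/-- A potential function `Φ` for the cost `V`, and a linear approximation `crude` of the cost up to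
the factor `q`. -/
structure IsPotential (V Φ crude : W → ℝ) (q R : ℝ) : Prop where
  V_zero : V 0 = 0
  V_add : ∀ x y, V (x + y) ≤ V x + V y
  V_smul : ∀ (a : ℝ) x, 0 < a → V (a • x) = a * V x
  V_mono : ∀ x y, 0 ≤ x → x ≤ y → V x ≤ V y
  ultra : Ultra Φ
  pos : 0 < Φ 0
  add_le : ∀ x o, 0 ≤ o → V o ≤ 1 → Φ (x + o) ≤ 3 / 2 * Φ x
  V_le : ∀ x, 0 ≤ x → Φ x ≤ 2 * Φ 0 → V x ≤ R
  crude_add : ∀ x y, crude (x + y) = crude x + crude y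
  crude_zero : crude 0 = 0
  crude_nonneg : ∀ x, 0 ≤ x → 0 ≤ crude x
  crude_le : ∀ x, 0 ≤ x → crude x ≤ V x
  q_nonneg : 0 ≤ q
  le_crude : ∀ x, 0 ≤ x → V x ≤ q * crude x

/-- The scales `lam` and the choices `x` of the greedy algorithm with a doubling scale, for the
first `T` jobs: each job gets the first scale at which one of the options has a small score, and the
option with the smallest score. -/
structure IsDoublingRun (k B : ℕ) (Φ crude : W → ℝ) (C : ℕ → ℕ → W) (lam : ℕ → ℝ) (x : ℕ → ℕ)
    (T : ℕ) : Prop where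
  lam_zero : lam 0 = 0
  lam_succ : ∀ s < T, lam (s + 1) =
    scale (lam s) (crude (C s (argmin k fun c => crude (C s c))))
      (firstIdx B fun n => ∃ c < k, score Φ crude
        (scale (lam s) (crude (C s (argmin k fun c => crude (C s c)))) n)
        (load C lam x s (scale (lam s) (crude (C s (argmin k fun c => crude (C s c)))) n) + C s c)
          ≤ 2 * Φ 0)
  choice : ∀ s < T, x s =
    argmin k fun c => score Φ crude (lam (s + 1)) (load C lam x s (lam (s + 1)) + C s c)

end

section
variable {W : Type*} [AddCommGroup W] [PartialOrder W] [IsOrderedAddMonoid W] [Module ℝ W]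
  [PosSMulMono ℝ W]
variable {V Φ crude : W → ℝ} {q R : ℝ} {k B : ℕ} {C : ℕ → ℕ → W} {lam : ℕ → ℝ} {x : ℕ → ℕ} {T : ℕ}

omit [IsOrderedAddMonoid W] in
theorem IsPotential.ultra_score (hP : IsPotential V Φ crude q R) {Λ : ℝ} (hΛ : 0 < Λ) :
    Ultra (score Φ crude Λ) := by
  have h : score Φ crude Λ = fun z => Φ (Λ⁻¹ • z) := funext fun z => score_eq hΛ z
  rw [h]
  exact hP.ultra.precomp (DistribSMul.toAddMonoidHom W Λ⁻¹)
    fun a b hab => smul_le_smul_of_nonneg_left hab (inv_nonneg.mpr hΛ.le)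

/-- At a scale that is at least the cost of some choices `y` of all jobs so far, the choice of `y`
for the current job has a small score. -/
theorem IsPotential.score_le (hP : IsPotential V Φ crude q R) (hC : ∀ s c, 0 ≤ C s c) (hk : 1 ≤ k)
    {y : ℕ → ℕ} (hy : ∀ s, y s < k) {s : ℕ} {Λ : ℝ} (hΛ : 0 < Λ)
    (hx : ∀ s' < s, x s' =
      argmin k fun c => score Φ crude (lam (s' + 1)) (load C lam x s' (lam (s' + 1)) + C s' c))
    (hV : V (∑ s' ∈ Finset.range (s + 1), C s' (y s')) ≤ Λ) :
    score Φ crude Λ (load C lam x s Λ + C s (y s)) ≤ 2 * Φ 0 := by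
  have hU := hP.ultra_score hΛ
  have hg := greedy_le hU hC (lam := lam) (x := x) (y := y) (Λ := Λ) (s := s) fun s' hs' hl => by
    have := (argmin_spec hk fun c =>
      score Φ crude (lam (s' + 1)) (load C lam x s' (lam (s' + 1)) + C s' c)).2 (y s') (hy s')
    rw [← hx s' hs'] at this
    simpa only [hl] using this
  set L := load C lam x s Λ
  set O := load C lam y s Λ with hO
  have hL : 0 ≤ L := load_nonneg hC lam x s Λ
  have hO0 : 0 ≤ O := load_nonneg hC lam y s Λ
  have ho := hC s (y s)
  have h1 := hU.incr L (L + C s (y s)) O hL (le_add_of_nonneg_right ho) hO0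
  have h2 : score Φ crude Λ (L + (O + C s (y s))) ≤ 3 / 2 * score Φ crude Λ L := by
    rw [score_eq hΛ, score_eq hΛ, smul_add]
    refine hP.add_le _ _ (smul_nonneg (inv_nonneg.mpr hΛ.le) (add_nonneg hO0 ho)) ?_
    rw [hP.V_smul _ _ (inv_pos.mpr hΛ), inv_mul_le_iff₀ hΛ, mul_one]
    refine (hP.V_mono _ _ (add_nonneg hO0 ho) ?_).trans hV
    rw [Finset.sum_range_succ]
    exact add_le_add_left (load_le hC lam y s Λ) _
  have h3 := hU.mono L (L + C s (y s)) hL (le_add_of_nonneg_right ho)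
  have h4 : score Φ crude Λ 0 = Φ 0 := by rw [score_eq hΛ, smul_zero]
  rw [show L + C s (y s) + O = L + (O + C s (y s)) by abel] at h1
  linarith

omit [IsOrderedAddMonoid W] in
/-- A load with a small score at the scale `Λ` has cost at most `R * Λ`, also for `Λ = 0`. -/
theorem IsPotential.V_load_le (hP : IsPotential V Φ crude q R) {Λ : ℝ} (hΛ : 0 ≤ Λ) {z : W}
    (hz : 0 ≤ z) (h : score Φ crude Λ z ≤ 2 * Φ 0) : V z ≤ R * Λ := by
  rcases hΛ.eq_or_lt with rfl | hΛ
  · have h0 : ¬ 0 < crude z := fun h0 => by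
      simp only [score, le_refl, h0, and_self, if_true, inv_zero, zero_smul] at h
      linarith [hP.pos]
    have h1 : crude z = 0 := le_antisymm (not_lt.mp h0) (hP.crude_nonneg z hz)
    simpa [h1] using hP.le_crude z hz
  · rw [score_eq hΛ] at h
    have := hP.V_le _ (smul_nonneg (inv_nonneg.mpr hΛ.le) hz) h
    rwa [hP.V_smul _ _ (inv_pos.mpr hΛ), inv_mul_le_iff₀ hΛ, mul_comm] at this

namespace IsDoublingRun

/-- What holds after `s` jobs: the jobs that were processed at smaller scales contribute little, the
score of the others is small, and the scale is at most twice the cost of any choices. -/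
theorem invariant (hP : IsPotential V Φ crude q R) (hC : ∀ s c, 0 ≤ C s c) (hk : 1 ≤ k)
    (hq : q ≤ 2 ^ (B - 2)) (hB : 2 ≤ B) (hR : 0 ≤ R)
    (h : IsDoublingRun k B Φ crude C lam x T) {y : ℕ → ℕ} (hy : ∀ s, y s < k) {s : ℕ} (hs : s ≤ T) :
    (0 ≤ lam s ∧ ∀ s' < s, lam (s' + 1) ≤ lam s) ∧
    V (∑ s' ∈ Finset.range s, C s' (x s') - load C lam x s (lam s)) ≤ R * lam s ∧
    score Φ crude (lam s) (load C lam x s (lam s)) ≤ 2 * Φ 0 ∧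
    lam s ≤ 2 * V (∑ s' ∈ Finset.range s, C s' (y s')) := by
  induction s with
  | zero =>
    have := hP.pos
    simp [load, h.lam_zero, hP.V_zero, score, hP.crude_zero]
    linarith
  | succ s ih =>
    obtain ⟨⟨h0, hmono⟩, hold, hnew, hopt⟩ := ih (Nat.le_of_succ_le hs)
    have hsT : s < T := hs
    obtain ⟨hc0, hcmin⟩ := argmin_spec hk fun c => crude (C s c)
    set c₀ := argmin k fun c => crude (C s c) with hc₀
    set β := crude (C s c₀) with hβ
    set test : ℕ → Prop := fun n => ∃ c < k,
      score Φ crude (scale (lam s) β n) (load C lam x s (scale (lam s) β n) + C s c) ≤ 2 * Φ 0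
      with htest
    have hβ0 : 0 ≤ β := hP.crude_nonneg _ (hC _ _)
    set v := V (∑ s' ∈ Finset.range (s + 1), C s' (y s')) with hv
    have hvs : V (∑ s' ∈ Finset.range s, C s' (y s')) ≤ v := by
      refine hP.V_mono _ _ (Finset.sum_nonneg fun _ _ => hC _ _) ?_
      rw [Finset.sum_range_succ]
      exact le_add_of_nonneg_right (hC _ _)
    have hβv : β ≤ v := by
      refine (hcmin _ (hy s)).trans ((hP.crude_le _ (hC _ _)).trans (hP.V_mono _ _ (hC _ _) ?_))
      rw [Finset.sum_range_succ]
      exact le_add_of_nonneg_left (Finset.sum_nonneg fun _ _ => hC _ _)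
    -- scales above the current one have not been used
    have hlarge : ∀ Λ, lam s < Λ → load C lam x s Λ = 0 := fun Λ hΛ =>
      Finset.sum_eq_zero fun s' hs' =>
        if_neg ((hmono s' (Finset.mem_range.mp hs')).trans_lt hΛ).ne
    -- a scale that fails is below the cost of `y`
    have hfail : ∀ n, ¬ test n → 0 < scale (lam s) β n → scale (lam s) β n < v := by
      intro n hn hpos
      by_contra hcon
      exact hn ⟨y s, hy s, hP.score_le hC hk hy hpos
        (fun s' hs' => h.choice s' (hs'.trans hsT)) (not_lt.mp hcon)⟩
    -- if the old scale fails, then the base of the new scales is positive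
    have hbase : ¬ test 0 → lam s < max (2 * lam s) β := by
      intro hn
      rcases h0.eq_or_lt with hz | hpos
      · rw [← hz, mul_zero, lt_max_iff]
        right
        by_contra hb
        have hb0 : crude (C s c₀) = 0 := le_antisymm (not_lt.mp hb) hβ0
        have hl := hP.V_load_le h0 (load_nonneg hC lam x s (lam s)) hnew
        have hl2 := hP.crude_le _ (load_nonneg hC lam x s (lam s))
        rw [← hz, mul_zero] at hl
        refine hn ⟨c₀, hc0, ?_⟩
        simp only [scale, ← hz] at hl2 ⊢
        rw [score, if_neg, inv_zero, zero_smul, add_zero]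
        · linarith [hP.pos]
        · rw [hP.crude_add, hb0]
          exact fun hh => by linarith [hh.2]
      · exact lt_max_of_lt_left (by linarith)
    have hgrow : ¬ test 0 → ∀ n, 2 * lam s ≤ scale (lam s) β (n + 1) ∧
        lam s < scale (lam s) β (n + 1) := by
      intro hn n
      have hb := hbase hn
      have h1 : max (2 * lam s) β ≤ scale (lam s) β (n + 1) :=
        le_mul_of_one_le_right (h0.trans hb.le) (one_le_pow₀ one_le_two)
      exact ⟨(le_max_left _ _).trans h1, hb.trans_le h1⟩
    -- the largest candidate is at least `q * β`, hence at least the cost of the job under `c₀`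
    have hex : ∃ n < B, test n := by
      by_cases hn : test 0
      · exact ⟨0, by omega, hn⟩
      · refine ⟨B - 2 + 1, by omega, c₀, hc0, ?_⟩
        have hg := hgrow hn (B - 2)
        rw [hlarge _ hg.2, zero_add, score_eq (h0.trans_lt hg.2)]
        have hpos := h0.trans_lt hg.2
        have h1 := hP.add_le 0 ((scale (lam s) β (B - 2 + 1))⁻¹ • C s c₀)
          (smul_nonneg (inv_nonneg.mpr hpos.le) (hC _ _)) (by
            rw [hP.V_smul _ _ (inv_pos.mpr hpos), inv_mul_le_iff₀ hpos, mul_one]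
            refine (hP.le_crude _ (hC _ _)).trans ?_
            rw [← hβ, mul_comm]
            exact mul_le_mul (le_max_right _ _) hq
              hP.q_nonneg (h0.trans (hbase hn).le))
        rw [zero_add] at h1
        linarith [hP.pos]
    obtain ⟨-, htn, hmin⟩ := firstIdx_spec hex
    have hlam := h.lam_succ s hsT
    rw [← hc₀, ← hβ] at hlam
    change lam (s + 1) = scale (lam s) β (firstIdx B test) at hlam
    have hx := h.choice s hsT
    have hscore : score Φ crude (lam (s + 1)) (load C lam x (s + 1) (lam (s + 1))) ≤ 2 * Φ 0 := by
      obtain ⟨c, hc, hsc⟩ := htn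
      rw [← hlam] at hsc
      rw [load_succ, if_pos rfl]
      have := (argmin_spec hk fun c =>
        score Φ crude (lam (s + 1)) (load C lam x s (lam (s + 1)) + C s c)).2 c hc
      rw [← hx] at this
      exact this.trans hsc
    rcases Nat.eq_zero_or_pos (firstIdx B test) with hz | hpos
    -- the scale is kept
    · rw [hz] at hlam
      change lam (s + 1) = lam s at hlam
      refine ⟨⟨hlam ▸ h0, fun s' hs' => ?_⟩, ?_, hscore, by rw [hlam]; linarith⟩
      · rcases Nat.lt_succ_iff_lt_or_eq.mp hs' with h1 | rfl
        · exact hlam ▸ hmono s' h1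
        · exact le_rfl
      · rw [load_succ, if_pos rfl, Finset.sum_range_succ, hlam, add_sub_add_right_eq_sub]
        exact hold
    -- the scale grows: the load of the old scale joins the loads at smaller scales
    · obtain ⟨n, hn⟩ := Nat.exists_eq_succ_of_ne_zero hpos.ne'
      have h00 : ¬ test 0 := hmin 0 hpos
      have hg := hgrow h00 n
      rw [hn] at hlam
      change lam (s + 1) = scale (lam s) β (n + 1) at hlam
      rw [← hlam] at hg
      refine ⟨⟨h0.trans hg.2.le, fun s' hs' => ?_⟩, ?_, hscore, ?_⟩
      · rcases Nat.lt_succ_iff_lt_or_eq.mp hs' with h1 | rfl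
        · exact (hmono s' h1).trans hg.2.le
        · exact le_rfl
      · rw [load_succ, if_pos rfl, hlarge _ hg.2, zero_add, Finset.sum_range_succ,
          add_sub_cancel_right]
        have h1 := hP.V_add (∑ s' ∈ Finset.range s, C s' (x s') - load C lam x s (lam s))
          (load C lam x s (lam s))
        rw [sub_add_cancel] at h1
        have h2 := hP.V_load_le h0 (load_nonneg hC lam x s (lam s)) hnew
        have h3 := mul_le_mul_of_nonneg_left hg.1 hR
        linarith
      · rw [hlam]
        cases n with
        | zero =>
          simp only [scale, pow_zero, mul_one]
          refine max_le ?_ (by linarith)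
          rcases h0.eq_or_lt with hz' | hpos'
          · rw [← hz']; linarith
          · have := hfail 0 h00 hpos'
            simp only [scale] at this
            linarith
        | succ n =>
          have := hfail (n + 1) (hmin (n + 1) (by omega)) (h0.trans_lt (hgrow h00 n).2)
          simp only [scale, pow_succ] at this ⊢
          linarith

/-- The greedy algorithm with a doubling scale is `4 * R`-competitive. The number `B` of candidates
for the scale has to be large enough to bridge the gap between `crude` and the cost. -/
theorem cost_le (hP : IsPotential V Φ crude q R) (hC : ∀ s c, 0 ≤ C s c) (hk : 1 ≤ k)
    (hq : q ≤ 2 ^ (B - 2)) (hB : 2 ≤ B) (hR : 0 ≤ R)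
    (h : IsDoublingRun k B Φ crude C lam x T) {y : ℕ → ℕ} (hy : ∀ s, y s < k) :
    V (∑ s ∈ Finset.range T, C s (x s)) ≤ 4 * R * V (∑ s ∈ Finset.range T, C s (y s)) := by
  obtain ⟨⟨h0, -⟩, h1, h2, h3⟩ := h.invariant hP hC hk hq hB hR hy le_rfl
  have h4 := hP.V_load_le h0 (load_nonneg hC lam x T (lam T)) h2
  have h5 := hP.V_add (∑ s' ∈ Finset.range T, C s' (x s') - load C lam x T (lam T))
    (load C lam x T (lam T))
  rw [sub_add_cancel] at h5
  have h6 := mul_le_mul_of_nonneg_left h3 hR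
  linarith

end IsDoublingRun

end

end VectorScheduling
namespace VectorScheduling

/-! ### The potential function for monotone symmetric norms -/

/-- The largest of the norms `N i (x i)`. -/
noncomputable def maxNorm {m r : ℕ} (N : Fin r → (Fin m → ℝ) → ℝ) (x : Fin r → Fin m → ℝ) : ℝ :=
  ⨆ i, N i (x i)

/-- The potential function, with codes `c = a * (8 * m) + b` for `a < m` and `b < 8 * m`. The last
threshold `13 * m + r + 5` exceeds `logb 2 (2 * potential O 0)` and is linear in the size of the
input. -/
noncomputable def potential {m r : ℕ} (O : Oracle) (x : Fin r → Fin m → ℝ) : ℝ :=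
  ∑ i : Fin r, ∑ a : Fin m, ∑ b : Fin (8 * m), codePot (13 * m + r + 5) (a * (8 * m) + b)
    (O i (weight m (a * (8 * m) + b))) (x i)

/-- The average over the resources and machines of the norm of the load of one machine: the dual
norm of a unit vector is the inverse of its norm. -/
noncomputable def crude {m r : ℕ} (O : Oracle) (x : Fin r → Fin m → ℝ) : ℝ :=
  (∑ i : Fin r, ∑ j, x i j / O i fun j' => if j' < 1 then 1 else 0) / (m * r)

/-- The bound on the cost of a load whose potential is at most twice that of `0`, obtained from
`norm_le_of_codePot_le` and `logb_potential_zero_le`. -/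
noncomputable def factor (m r : ℕ) : ℝ :=
  72 * (2 * (Real.logb 2 r + 2 * Real.logb 2 m ^ 2 + 5 * Real.logb 2 m + 4) +
    3 * (2 * Real.logb 2 m + 3))

theorem logb_two_lt {x : ℝ} (hx : 0 < x) : Real.logb 2 x < x := by
  rw [Real.logb_lt_iff_lt_rpow one_lt_two hx]
  rcases le_or_gt x 1 with h1 | h1
  · exact h1.trans_lt (Real.one_lt_rpow one_lt_two hx)
  · have hb := one_add_mul_self_le_rpow_one_add (s := 1) (by norm_num) h1.le
    norm_num at hb
    linarith

theorem logb_two_nonneg {m : ℕ} : 0 ≤ Real.logb 2 m := by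
  rcases Nat.eq_zero_or_pos m with rfl | hm
  · simp
  · exact Real.logb_nonneg one_lt_two (by exact_mod_cast hm)

theorem wordLen_le {m : ℕ} (hm : 1 ≤ m) : (wordLen m : ℝ) ≤ 2 * Real.logb 2 m + 3 := by
  have hmr : (0 : ℝ) < m := by exact_mod_cast hm
  have h1 : 2 ^ (wordLen m - 1) ≤ 4 * m * m :=
    (Nat.pow_pred_clog_lt_self one_lt_two (by nlinarith)).le
  have h2 : ((wordLen m - 1 : ℕ) : ℝ) ≤ Real.logb 2 (4 * m * m) := by
    rw [Real.le_logb_iff_rpow_le one_lt_two (by positivity), Real.rpow_natCast]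
    exact_mod_cast h1
  rw [Real.logb_mul (by positivity) hmr.ne', Real.logb_mul (by norm_num) hmr.ne',
    show (4 : ℝ) = 2 ^ (2 : ℝ) by norm_num, Real.logb_rpow two_pos (by norm_num)] at h2
  have h3 : (wordLen m : ℝ) ≤ ((wordLen m - 1 : ℕ) : ℝ) + 1 := by
    exact_mod_cast (show wordLen m ≤ wordLen m - 1 + 1 by omega)
  linarith

theorem factor_le {m r : ℕ} : 4 * factor m r ≤
    10000 * (1 + Real.log m ^ 2 + Real.log r) := by
  have h2 := Real.log_two_gt_d9
  have hr : 0 ≤ Real.log r := Real.log_natCast_nonneg r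
  have hm : 0 ≤ Real.log m := Real.log_natCast_nonneg m
  have e1 : Real.logb 2 r ≤ 3 / 2 * Real.log r := by
    rw [Real.logb, div_le_iff₀ (by linarith)]
    nlinarith
  have e2 : Real.logb 2 m ≤ 3 / 2 * Real.log m := by
    rw [Real.logb, div_le_iff₀ (by linarith)]
    nlinarith
  have e3 : Real.logb 2 m ^ 2 ≤ 9 / 4 * Real.log m ^ 2 := by
    have := pow_le_pow_left₀ logb_two_nonneg e2 2
    linarith
  unfold factor
  nlinarith [sq_nonneg (Real.log m - 1)]

section
variable {m r : ℕ} {N : Fin r → (Fin m → ℝ) → ℝ}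

theorem ballOracle_eq (i : Fin r) (w : ℕ → ℝ) :
    ballOracle N i w = dualNorm (N i) fun j => w j := by
  simp [ballOracle, dualNorm]

theorem le_maxNorm (N : Fin r → (Fin m → ℝ) → ℝ) (x : Fin r → Fin m → ℝ) (i : Fin r) :
    N i (x i) ≤ maxNorm N x :=
  le_ciSup (f := fun i => N i (x i)) (Set.finite_range _).bddAbove i

theorem maxNorm_le (hr : 1 ≤ r) {x : Fin r → Fin m → ℝ} {v : ℝ} (h : ∀ i, N i (x i) ≤ v) :
    maxNorm N x ≤ v :=
  haveI : Nonempty (Fin r) := ⟨⟨0, hr⟩⟩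
  ciSup_le h

theorem potential_zero_le : potential (ballOracle N) (0 : Fin r → Fin m → ℝ) ≤
    r * (m * (8 * m * (m : ℝ) ^ wordLen m)) := by
  simp only [potential, ballOracle_eq]
  rcases Nat.eq_zero_or_pos m with rfl | hm
  · simp
  have h : ∀ c, (m : ℝ) ^ (zeroPos m c).card ≤ (m : ℝ) ^ wordLen m := fun c =>
    pow_le_pow_right₀ (by exact_mod_cast hm)
      ((Finset.card_filter_le _ _).trans_eq (Finset.card_range _))
  calc _ ≤ ∑ i : Fin r, ∑ a : Fin m, ∑ b : Fin (8 * m), (m : ℝ) ^ wordLen m :=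
        Finset.sum_le_sum fun i _ => Finset.sum_le_sum fun a _ => Finset.sum_le_sum fun b _ => by
          rw [Pi.zero_apply, codePot_zero]
          exact h _
    _ = _ := by simp

theorem logb_potential_zero_le (hm : 1 ≤ m) (hr : 1 ≤ r)
    (h0 : 0 < potential (ballOracle N) (0 : Fin r → Fin m → ℝ)) :
    Real.logb 2 (2 * potential (ballOracle N) (0 : Fin r → Fin m → ℝ)) ≤
      Real.logb 2 r + 2 * Real.logb 2 m ^ 2 + 5 * Real.logb 2 m + 4 := by
  have hm0 : (0 : ℝ) < m := by exact_mod_cast hm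
  have hr0 : (0 : ℝ) < r := by exact_mod_cast hr
  have h1 : Real.logb 2 (2 * potential (ballOracle N) (0 : Fin r → Fin m → ℝ)) ≤
      Real.logb 2 (2 * (r * (m * (8 * m * (m : ℝ) ^ wordLen m)))) :=
    Real.logb_le_logb_of_le one_lt_two (by positivity)
      (mul_le_mul_of_nonneg_left potential_zero_le zero_le_two)
  have h8 : Real.logb 2 8 = 3 := by
    rw [show (8 : ℝ) = 2 ^ (3 : ℝ) by norm_num, Real.logb_rpow two_pos (by norm_num)]
  refine h1.trans ?_
  rw [Real.logb_mul two_ne_zero (by positivity), Real.logb_mul hr0.ne' (by positivity),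
    Real.logb_mul hm0.ne' (by positivity), Real.logb_mul (by positivity) (by positivity),
    Real.logb_mul (by norm_num) hm0.ne', Real.logb_pow, h8,
    Real.logb_self_eq_one one_lt_two]
  have h2 := mul_le_mul_of_nonneg_right (wordLen_le hm) (logb_two_nonneg (m := m))
  nlinarith

/-- The thresholds in the potential function reach far enough: the right hand side is the last
threshold, and the left hand side bounds `logb 2 (2 * potential O 0)`. -/
theorem logb_bound_lt (hm : 1 ≤ m) (hr : 1 ≤ r) :
    Real.logb 2 r + 2 * Real.logb 2 m ^ 2 + 5 * Real.logb 2 m + 4 <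
      ((13 * m + r + 5 : ℕ) : ℝ) := by
  have hm0 : (0 : ℝ) < m := by exact_mod_cast hm
  have hr0 : (0 : ℝ) < r := by exact_mod_cast hr
  have h1 := logb_two_lt hr0
  have h2 := logb_two_lt hm0
  have h3 := logb_two_lt (Real.sqrt_pos.mpr hm0)
  have h4 : Real.logb 2 m = 2 * Real.logb 2 (Real.sqrt m) := by
    conv_lhs => rw [← Real.sq_sqrt hm0.le, Real.logb_pow]
    norm_num
  have h5 : Real.logb 2 m ^ 2 ≤ 4 * m := by
    have := pow_le_pow_left₀ (logb_two_nonneg (m := m)) (h4.trans_le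
      (mul_le_mul_of_nonneg_left h3.le zero_le_two)) 2
    rw [mul_pow, Real.sq_sqrt hm0.le] at this
    linarith
  push_cast
  linarith

theorem dualNorm_first {N : (Fin m → ℝ) → ℝ} (hm : 1 ≤ m) (hN : IsMonotoneSymmetricNorm N)
    (j : Fin m) : (dualNorm N fun j' => if (j' : ℕ) < 1 then 1 else 0) =
      1 / N (Pi.single j 1) := by
  rw [← hN.single_eq ⟨0, hm⟩ j, ← hN.dualNorm_single]
  congr 1
  ext j'
  simp only [Pi.single_apply, Fin.ext_iff, Nat.lt_one_iff]

theorem isPotential (hm : 1 ≤ m) (hr : 1 ≤ r) (hN : ∀ i, IsMonotoneSymmetricNorm (N i)) :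
    IsPotential (maxNorm N) (potential (ballOracle N))
      (crude (ballOracle N)) (m * r) (factor m r) := by
  have hm0 : (0 : ℝ) < m := by exact_mod_cast hm
  have hr0 : (0 : ℝ) < r := by exact_mod_cast hr
  have hD : ∀ i (j : Fin m), (dualNorm (N i) fun j' => if (j' : ℕ) < 1 then 1 else 0) =
      1 / N i (Pi.single j 1) := fun i j => dualNorm_first hm (hN i) j
  have hcr : ∀ x, crude (ballOracle N) x =
      (∑ i, ∑ j, x i j * N i (Pi.single j 1)) / (m * r) := fun x => by
    simp only [crude, ballOracle_eq]
    simp only [fun i j => (hD i j ▸ div_div_eq_mul_div (x i j) 1 (N i (Pi.single j 1)) :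
      x i j / _ = _), div_one]
  have hdn : ∀ i c, 0 ≤ dualNorm (N i) fun j => weight m c j := fun i c =>
    le_csSup ((hN i).bddAbove _) ⟨0, by simp [(hN i).zero], by simp⟩
  have hpos : 0 < potential (ballOracle N) (0 : Fin r → Fin m → ℝ) := by
    refine Finset.sum_pos (fun i _ => Finset.sum_pos (fun a _ => Finset.sum_pos (fun b _ => ?_)
      ⟨⟨0, by omega⟩, Finset.mem_univ _⟩) ⟨⟨0, hm⟩, Finset.mem_univ _⟩) ⟨⟨0, hr⟩, Finset.mem_univ _⟩
    exact zero_lt_one.trans_le (one_le_codePot hm _)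
  refine ⟨?_, ?_, ?_, ?_, ?_, hpos, ?_, ?_, ?_, ?_, ?_, ?_, by positivity, ?_⟩
  · exact le_antisymm (maxNorm_le hr fun i => (hN i).zero.le)
      ((hN ⟨0, hr⟩).zero.ge.trans (le_maxNorm N 0 ⟨0, hr⟩))
  · exact fun x y => maxNorm_le hr fun i => ((hN i).add_le _ _).trans
      (add_le_add (le_maxNorm N x i) (le_maxNorm N y i))
  · intro a x ha
    unfold maxNorm
    rw [Real.mul_iSup_of_nonneg ha.le]
    exact iSup_congr fun i => by rw [Pi.smul_apply, (hN i).smul, abs_of_pos ha]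
  · exact fun x y hx hxy => maxNorm_le hr fun i =>
      ((hN i).mono _ _ (hx i) (hxy i)).trans (le_maxNorm N y i)
  · unfold potential
    simp only [ballOracle_eq]
    exact Ultra.sum _ fun i _ => Ultra.sum _ fun a _ => Ultra.sum _ fun b _ =>
      (ultra_codePot (hdn i _)).precomp (Pi.evalAddMonoidHom (fun _ => Fin m → ℝ) i)
        fun x y hxy => hxy i
  · intro x o ho hVo
    simp only [potential, ballOracle_eq, Finset.mul_sum]
    exact Finset.sum_le_sum fun i _ => Finset.sum_le_sum fun a _ => Finset.sum_le_sum fun b _ =>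
      codePot_add_le hm (hN i) (ho i) ((le_maxNorm N o i).trans hVo)
  · intro x hx hle
    refine maxNorm_le hr fun i => ?_
    have hb := logb_potential_zero_le hm hr hpos
    refine (norm_le_of_codePot_le hm (hN i) (hx i)
      (hb.trans_lt (logb_bound_lt hm hr)) fun c hc => ?_).trans ?_
    · rw [Real.rpow_logb two_pos (by norm_num) (by positivity)]
      refine le_trans ?_ hle
      have h1 : ∀ i c,
          0 ≤ codePot (13 * m + r + 5) c (dualNorm (N i) fun j => weight m c j) (x i) :=
        fun i c => zero_le_one.trans (one_le_codePot hm _)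
      have h2 : c / (8 * m) * (8 * m) + c % (8 * m) = c := Nat.div_add_mod' c (8 * m)
      let a : Fin m := ⟨c / (8 * m), Nat.div_lt_of_lt_mul (by linarith)⟩
      let b : Fin (8 * m) := ⟨c % (8 * m), Nat.mod_lt _ (by omega)⟩
      simp only [potential, ballOracle_eq]
      have h3 := Finset.single_le_sum (f := fun b : Fin (8 * m) =>
        codePot (13 * m + r + 5) (a * (8 * m) + b)
          (dualNorm (N i) fun j => weight m (a * (8 * m) + b) j) (x i))
        (fun b _ => h1 i _) (Finset.mem_univ b)
      have h4 := Finset.single_le_sum (f := fun a : Fin m => ∑ b : Fin (8 * m),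
        codePot (13 * m + r + 5) (a * (8 * m) + b)
          (dualNorm (N i) fun j => weight m (a * (8 * m) + b) j) (x i))
        (fun a _ => Finset.sum_nonneg fun b _ => h1 i _) (Finset.mem_univ a)
      have h5 := Finset.single_le_sum (f := fun i : Fin r => ∑ a : Fin m, ∑ b : Fin (8 * m),
        codePot (13 * m + r + 5) (a * (8 * m) + b)
          (dualNorm (N i) fun j => weight m (a * (8 * m) + b) j) (x i))
        (fun i _ => Finset.sum_nonneg fun a _ => Finset.sum_nonneg fun b _ => h1 i _)
        (Finset.mem_univ i)
      simp only [a, b, h2] at h3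
      exact h3.trans (h4.trans h5)
    · unfold factor
      have := wordLen_le hm
      nlinarith
  · intro x y
    simp only [hcr, Pi.add_apply, add_mul, Finset.sum_add_distrib, add_div]
  · simp [hcr]
  · intro x hx
    rw [hcr]
    exact div_nonneg (Finset.sum_nonneg fun i _ => Finset.sum_nonneg fun j _ =>
      mul_nonneg (hx i j) ((hN i).nonneg _)) (by positivity)
  · intro x hx
    rw [hcr, div_le_iff₀ (by positivity)]
    calc _ ≤ ∑ i : Fin r, ∑ j : Fin m, maxNorm N x := Finset.sum_le_sum fun i _ =>
          Finset.sum_le_sum fun j _ => ((hN i).mul_single_le (hx i) j).trans (le_maxNorm N x i)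
      _ = _ := by simp; ring
  · intro x hx
    rw [hcr, mul_div_cancel₀ _ (by positivity)]
    refine maxNorm_le hr fun i => ((hN i).le_sum (hx i)).trans ?_
    exact Finset.single_le_sum (f := fun i => ∑ j, x i j * N i (Pi.single j 1))
      (fun i _ => Finset.sum_nonneg fun j _ => mul_nonneg (hx i j) ((hN i).nonneg _))
      (Finset.mem_univ i)

end

end VectorScheduling
namespace VectorScheduling

/-! ### Computable predicates, minimizers and finite products -/

theorem Comp.congr {α : Type} {V : Ctx α} {f g : α → ℝ} (hf : Comp V f) (h : ∀ a, f a = g a) :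
    Comp V g := funext h ▸ hf

open Classical in
/-- `p` is decided by one program in polynomial time. -/
def PComp {α : Type} (V : Ctx α) (p : α → Prop) : Prop :=
  Comp V fun a => if p a then 1 else 0

/-- A computable function stays computable if a loop is put outside the innermost loop. -/
theorem Comp.wk₂ {α : Type} {V : Ctx α} {i' : ℕ} {B' : α → ℕ} {f : (a : α) × Fin (B' a) → ℝ}
    (hf : Comp (V.ext i' B') f) (i : ℕ) (B : α → ℕ) :
    Comp ((V.ext i B).ext i' fun p => B' p.1) fun p => f ⟨p.1.1, p.2⟩ := by
  intro li d hV
  have hV' : (V.ext i' B').Bdd li := by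
    refine ⟨hV.1, ?_⟩
    rintro v (rfl | ⟨v, hv, rfl⟩)
    · exact hV.2 (i', fun p => (p.2 : ℕ)) (Or.inl rfl)
    · exact hV.2 (v.1, fun p => v.2 p.1.1)
        (Or.inr ⟨(v.1, fun p => v.2 p.1), Or.inr ⟨v, hv, rfl⟩, rfl⟩)
  obtain ⟨P, b, e, h⟩ := hf li d hV'
  exact ⟨P, b, e, fun p σ hσ => h ⟨p.1.1, p.2⟩ σ
    (hσ.of_ext.of_ext.ext (B := B') (hσ.vars _ (Or.inl rfl)) p.2.2)⟩

theorem PComp.wk₂ {α : Type} {V : Ctx α} {i' : ℕ} {B' : α → ℕ} {p : (a : α) × Fin (B' a) → Prop}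
    (hp : PComp (V.ext i' B') p) (i : ℕ) (B : α → ℕ) :
    PComp ((V.ext i B).ext i' fun q => B' q.1) fun q => p ⟨q.1.1, q.2⟩ :=
  Comp.wk₂ hp i B

namespace PComp
variable {α : Type} {V : Ctx α} {p q : α → Prop} {f g : α → ℝ}

theorem of_iff (hp : PComp V p) (h : ∀ a, p a ↔ q a) : PComp V q := by
  have : p = q := funext fun a => propext (h a)
  exact this ▸ hp

theorem le (hf : Comp V f) (hg : Comp V g) : PComp V fun a => f a ≤ g a :=
  (hf.le hg).congr fun a => by congr

theorem not (hp : PComp V p) : PComp V fun a => ¬ p a :=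
  ((Comp.const 1).sub hp).congr fun a => by by_cases h : p a <;> simp [h]

theorem and (hp : PComp V p) (hq : PComp V q) : PComp V fun a => p a ∧ q a :=
  (Comp.mul hp hq).congr fun a => by by_cases h : p a <;> by_cases h' : q a <;> simp [h, h']

theorem imp (hp : PComp V p) (hq : PComp V q) : PComp V fun a => p a → q a :=
  (hp.and hq.not).not.of_iff fun a => by tauto

theorem lt (hf : Comp V f) (hg : Comp V g) : PComp V fun a => f a < g a :=
  (PComp.le hg hf).not.of_iff fun _ => not_le

theorem eq (hf : Comp V f) (hg : Comp V g) : PComp V fun a => f a = g a :=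
  ((PComp.le hf hg).and (PComp.le hg hf)).of_iff fun _ => le_antisymm_iff.symm

theorem forall_fin {B : α → ℕ} {p : (a : α) → Fin (B a) → Prop} (q : ℕ)
    (hq : ∀ a, B a ≤ q * ((V.base a).size + 1)) (hB : NComp V B)
    (hp : ∀ i, PComp (V.ext i B) fun x => p x.1 x.2) : PComp V fun a => ∀ n, p a n := by
  classical
  refine (PComp.le (Comp.sum (f := fun a n => if ¬ p a n then (1 : ℝ) else 0) q hq hB
    fun i => (hp i).not.congr fun x => by congr) (Comp.const 0)).of_iff fun a => ?_
  rw [Nat.cast_zero]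
  constructor
  · intro h n
    have h0 := (Finset.sum_eq_zero_iff_of_nonneg (fun n _ => by split_ifs <;> simp)).mp
      (le_antisymm h (Finset.sum_nonneg fun n _ => by split_ifs <;> simp)) n (Finset.mem_univ n)
    by_contra hn
    simp [hn] at h0
  · exact fun h => (Finset.sum_eq_zero fun n _ => by simp [h n]).le

theorem exists_fin {B : α → ℕ} {p : (a : α) → Fin (B a) → Prop} (q : ℕ)
    (hq : ∀ a, B a ≤ q * ((V.base a).size + 1)) (hB : NComp V B)
    (hp : ∀ i, PComp (V.ext i B) fun x => p x.1 x.2) : PComp V fun a => ∃ n, p a n :=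
  (forall_fin (p := fun a n => ¬ p a n) q hq hB fun i => (hp i).not).not.of_iff fun a => by simp

end PComp

namespace Comp
variable {α : Type} {V : Ctx α} {f g : α → ℝ}

theorem ite {p : α → Prop} [DecidablePred p] (hp : PComp V p) (hf : Comp V f) (hg : Comp V g) :
    Comp V fun a => if p a then f a else g a :=
  ((Comp.mul hp hf).add (Comp.mul hp.not hg)).congr fun a => by by_cases h : p a <;> simp [h]

theorem max (hf : Comp V f) (hg : Comp V g) : Comp V fun a => max (f a) (g a) :=
  (ite (PComp.le hf hg) hg hf).congr fun _ => (max_def _ _).symm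

theorem prod {B : α → ℕ} {f : (a : α) → Fin (B a) → ℝ} (q : ℕ)
    (hq : ∀ a, B a ≤ q * ((V.base a).size + 1)) (hB : NComp V B) (hpos : ∀ a n, 0 < f a n)
    (hf : ∀ i, Comp (V.ext i B) fun x => f x.1 x.2) : Comp V fun a => ∏ n, f a n :=
  (sum (f := fun a n => Real.log (f a n)) q hq hB fun i => (hf i).log).exp.congr fun a => by
    rw [Real.exp_sum]
    exact Finset.prod_congr rfl fun n _ => Real.exp_log (hpos a n)

theorem firstIdx {B : α → ℕ} {p : α → ℕ → Prop} (q : ℕ)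
    (hq : ∀ a, B a ≤ q * ((V.base a).size + 1)) (hB : NComp V B)
    (hp : ∀ i, PComp (V.ext i B) fun x => p x.1 x.2) :
    Comp V fun a => (VectorScheduling.firstIdx (B a) (p a) : ℝ) := by
  classical
  refine (sum
    (f := fun a n => if ∀ n' : Fin (B a), (n' : ℝ) ≤ (n : ℕ) → ¬ p a n' then (1 : ℝ) else 0)
    q hq hB fun i => ?_).congr fun a => ?_
  · refine Comp.congr (PComp.forall_fin (V := V.ext i B) (B := fun x => B x.1)
      (p := fun x n' => (n' : ℝ) ≤ (x.2 : ℕ) → ¬ p x.1 n') q (fun x => hq x.1) (hB.wk i B)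
      fun i' => ?_) fun x => by congr
    exact (PComp.le (cast (NComp.var i' _)) (cast ((NComp.var i B).wk i' _))).imp
      ((hp i').wk₂ i B).not
  · rw [VectorScheduling.firstIdx, Finset.card_filter, Finset.sum_range, Nat.cast_sum]
    refine Finset.sum_congr rfl fun n _ => ?_
    push_cast
    refine if_congr ⟨fun h n' hn' => h ⟨n', hn'.trans_lt n.2⟩ (by exact_mod_cast hn'),
      fun h n' hn' => h n' (by exact_mod_cast hn')⟩ rfl rfl

theorem argmin {k : α → ℕ} {f : α → ℕ → ℝ} (q : ℕ)
    (hq : ∀ a, k a ≤ q * ((V.base a).size + 1)) (hk : NComp V k)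
    (hf : ∀ i, Comp (V.ext i k) fun x => f x.1 x.2) :
    Comp V fun a => (VectorScheduling.argmin (k a) (f a) : ℝ) := by
  refine firstIdx q hq hk fun i => ?_
  refine (PComp.forall_fin (V := V.ext i k) (B := fun x => k x.1)
    (p := fun x c' => f x.1 x.2 ≤ f x.1 c') q (fun x => hq x.1) (hk.wk i k) fun i' =>
    PComp.le ((hf i).wk i' _) ((hf i').wk₂ i k)).of_iff fun x => ?_
  exact ⟨fun h c' hc' => h ⟨c', hc'⟩, fun h c' => h c' c'.2⟩

/-- A power of two whose exponent is a computable natural number. -/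
theorem two_pow {e : α → ℕ} (he : Comp V fun a => (e a : ℝ)) : Comp V fun a => (2 : ℝ) ^ e a :=
  (he.mul (Comp.const 2).log).exp.congr fun a => by
    rw [Real.exp_nat_mul, Nat.cast_ofNat, Real.exp_log two_pos]

theorem half_pow {e : α → ℕ} (he : Comp V fun a => (e a : ℝ)) :
    Comp V fun a => (1 / 2 : ℝ) ^ e a :=
  ((Comp.const 1).div he.two_pow).congr fun a => by simp

end Comp

/-! ### Computing the potential function -/

theorem Base.m_le (b : Base) (n : ℕ) : n * b.m ≤ n * (b.size + 1) :=
  Nat.mul_le_mul_left n (by unfold Base.size; omega)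

theorem filter_range_lt {n k : ℕ} (h : k ≤ n) :
    (Finset.range n).filter (fun x => x < k) = Finset.range k := by
  ext x
  simp only [Finset.mem_filter, Finset.mem_range]
  omega

theorem ones_le (c s : ℕ) : ones c s ≤ s := by
  calc ones c s ≤ ∑ _s' ∈ Finset.range s, 1 :=
        Finset.sum_le_sum fun s' _ => by have := mod_two_zero_or_one (c / 2 ^ s'); omega
    _ = s := by simp

theorem mem_zeroPos {m c s : ℕ} : s ∈ zeroPos m c ↔ 2 ^ s < 4 * m * m ∧ c / 2 ^ s % 2 = 0 := by
  rw [zeroPos, Finset.mem_filter, Finset.mem_range, wordLen,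
    Nat.lt_clog_iff_pow_lt one_lt_two]

/-- The length of the words is at most `8 * m`, which serves as the bound of the loops over the
digits: it is available as an index expression, unlike the logarithm. -/
theorem zeroPos_subset (m c : ℕ) : zeroPos m c ⊆ Finset.range (8 * m) := by
  intro s hs
  rw [mem_zeroPos] at hs
  rw [Finset.mem_range]
  by_contra hcon
  have h1 : 2 ^ (8 * m) ≤ 2 ^ s := Nat.pow_le_pow_right two_pos (not_lt.mp hcon)
  have h2 : m < 2 ^ m := Nat.lt_two_pow_self
  have h3 : (2 ^ m) ^ 8 = 2 ^ (8 * m) := by rw [← pow_mul, mul_comm]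
  have h4 : 4 * m * m ≤ (2 ^ m) ^ 8 := by
    rcases Nat.eq_zero_or_pos m with rfl | hm
    · simp
    · have h5 : 2 ≤ 2 ^ m := Nat.le_self_pow hm.ne' 2
      calc 4 * m * m ≤ 2 ^ 6 * 2 ^ m * 2 ^ m := by gcongr; norm_num
        _ ≤ (2 ^ m) ^ 6 * 2 ^ m * 2 ^ m := by gcongr
        _ = (2 ^ m) ^ 8 := by ring
  omega

namespace Comp
variable {α : Type} {V : Ctx α}

section codes
variable {c : α → ℕ} (hc : Comp V fun a => (c a : ℝ))
  (hlt : ∀ a, c a < 8 * (V.base a).m * (V.base a).m)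
include hc hlt

/-- There is no integer division for real cells, so the quotient is found by counting the numbers
below it. The count runs over pairs, because one loop is at most linear in the size of the input. -/
theorem div_two_pow {s : α → ℕ} (hs : NComp V s) :
    Comp V fun a => ((c a / 2 ^ s a : ℕ) : ℝ) := by
  refine (sum (B := fun a => (V.base a).m) (f := fun a x => ∑ y : Fin (8 * (V.base a).m),
    if (((x : ℕ) : ℝ) * (8 * (V.base a).m) + (y : ℕ) + 1) * 2 ^ s a ≤ c a then (1 : ℝ) else 0) 1
    (fun a => by simpa using (V.base a).m_le 1) NComp.m fun i => ?_).congr fun a => ?_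
  · refine sum (V := V.ext i _) (B := fun p => 8 * (V.base p.1).m) (f := fun p y =>
      if (((p.2 : ℕ) : ℝ) * (8 * (V.base p.1).m) + (y : ℕ) + 1) * 2 ^ s p.1 ≤ c p.1
        then (1 : ℝ) else 0) 8 (fun p => (V.base p.1).m_le 8)
      (NComp.const_mul 8 (NComp.m (V := V.ext i _)))
      fun i' => ?_
    have hx := (cast (NComp.var (V := V) i fun a => (V.base a).m)).wk i' fun p => 8 * (V.base p.1).m
    have hm := cast (NComp.m
      (V := (V.ext i fun a => (V.base a).m).ext i' fun p => 8 * (V.base p.1).m))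
    have hy := cast (NComp.var (V := V.ext i fun a => (V.base a).m) i' fun p => 8 * (V.base p.1).m)
    have hp := two_pow (cast ((hs.wk i fun a => (V.base a).m).wk i' fun p => 8 * (V.base p.1).m))
    have hcw := (hc.wk i fun a => (V.base a).m).wk i' fun p => 8 * (V.base p.1).m
    exact ((((hx.mul ((const 8).mul hm)).add hy).add (const 1)).mul hp).le hcw |>.congr fun p => by
      simp
  · have key : ∀ v : ℕ, ((v : ℝ) + 1) * 2 ^ s a ≤ c a ↔ v < c a / 2 ^ s a := fun v => by
      rw [← Nat.succ_le_iff, Nat.le_div_iff_mul_le (by positivity)]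
      exact_mod_cast Iff.rfl
    rw [← Fintype.sum_prod_type']
    calc _ = ∑ x : Fin (V.base a).m × Fin (8 * (V.base a).m),
          if (finProdFinEquiv x : ℕ) < c a / 2 ^ s a then (1 : ℝ) else 0 :=
        Finset.sum_congr rfl fun x _ => if_congr (by
          rw [← key, finProdFinEquiv_apply_val]
          push_cast
          rw [show ((x.2 : ℕ) : ℝ) + 8 * (V.base a).m * (x.1 : ℕ) =
            (x.1 : ℕ) * (8 * (V.base a).m) + (x.2 : ℕ) by ring]) rfl rfl
      _ = ∑ v : Fin ((V.base a).m * (8 * (V.base a).m)),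
          if (v : ℕ) < c a / 2 ^ s a then (1 : ℝ) else 0 :=
        finProdFinEquiv.sum_comp
          fun v : Fin ((V.base a).m * (8 * (V.base a).m)) =>
            if (v : ℕ) < c a / 2 ^ s a then (1 : ℝ) else 0
      _ = _ := by
        rw [Fin.sum_univ_eq_sum_range (fun v => if v < c a / 2 ^ s a then (1 : ℝ) else 0),
          Finset.sum_boole, filter_range_lt ?_, Finset.card_range]
        have h1 := Nat.div_le_self (c a) (2 ^ s a)
        have h2 := hlt a
        rw [show (V.base a).m * (8 * (V.base a).m) = 8 * (V.base a).m * (V.base a).m by ring]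
        omega

theorem digit {s : α → ℕ} (hs : NComp V s) :
    Comp V fun a => ((c a / 2 ^ s a % 2 : ℕ) : ℝ) :=
  ((div_two_pow hc hlt hs).sub ((const 2).mul (div_two_pow hc hlt (hs.add (NComp.const 1))))).congr
    fun a => by
      rw [pow_succ, ← Nat.div_div_eq_div_mul, sub_eq_iff_eq_add]
      exact_mod_cast (Nat.mod_add_div (c a / 2 ^ s a) 2).symm

theorem ones {s : α → ℕ} (hs : NComp V s) (hsm : ∀ a, s a ≤ 8 * (V.base a).m) :
    Comp V fun a => (VectorScheduling.ones (c a) (s a) : ℝ) := by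
  refine (sum (B := fun a => 8 * (V.base a).m) (f := fun a s' =>
    if ((s' : ℕ) : ℝ) < s a then ((c a / 2 ^ (s' : ℕ) % 2 : ℕ) : ℝ) else 0) 8
    (fun a => (V.base a).m_le 8) (NComp.const_mul 8 NComp.m) fun i => ?_).congr fun a => ?_
  · exact ite (PComp.lt (cast (NComp.var i _)) (cast (hs.wk i _)))
      (digit (V := V.ext i _) (hc.wk i _) (fun p => hlt p.1) (NComp.var i _))
      ((const 0).congr fun _ => Nat.cast_zero)
  · rw [VectorScheduling.ones, Nat.cast_sum, ← filter_range_lt (hsm a), Finset.sum_filter,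
      Fin.sum_univ_eq_sum_range (fun s' =>
        if (s' : ℝ) < s a then ((c a / 2 ^ s' % 2 : ℕ) : ℝ) else 0)]
    exact Finset.sum_congr rfl fun s' _ => if_congr Nat.cast_lt rfl rfl

theorem _root_.VectorScheduling.PComp.mem_zeroPos {s : α → ℕ} (hs : NComp V s) :
    PComp V fun a => s a ∈ zeroPos (V.base a).m (c a) := by
  refine ((PComp.lt (two_pow (cast hs)) (((const 4).mul (cast NComp.m)).mul (cast NComp.m))).and
    (PComp.le (digit hc hlt hs) (const 0))).of_iff fun a => ?_
  rw [VectorScheduling.mem_zeroPos]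
  refine and_congr (by exact_mod_cast Iff.rfl) ?_
  rw [Nat.cast_le, Nat.le_zero]

theorem weight {j : α → ℕ} (hj : NComp V j) :
    Comp V fun a => VectorScheduling.weight (V.base a).m (c a) (j a) := by
  classical
  refine (sum (B := fun a => 8 * (V.base a).m) (f := fun a s =>
    if (s : ℕ) ∈ zeroPos (V.base a).m (c a) then
      (1 / 2) ^ (s - VectorScheduling.ones (c a) s) *
        if (j a : ℝ) < 2 ^ VectorScheduling.ones (c a) s then (1 : ℝ) else 0 else 0) 8
    (fun a => (V.base a).m_le 8) (NComp.const_mul 8 NComp.m) fun i => ?_).congr fun a => ?_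
  · have ho := ones (V := V.ext i fun a => 8 * (V.base a).m) (hc.wk i _) (fun p => hlt p.1)
      (NComp.var i _) fun p => p.2.2.le
    have h0 : Comp (V.ext i fun a => 8 * (V.base a).m) fun _ => (0 : ℝ) :=
      (const 0).congr fun _ => Nat.cast_zero
    refine ite (PComp.mem_zeroPos (V := V.ext i _) (hc.wk i _) (fun p => hlt p.1) (NComp.var i _))
      ((half_pow (((cast (NComp.var i _)).sub ho).congr fun p => ?_)).mul
        (ite (PComp.lt (cast (hj.wk i _)) (two_pow ho))
          ((const 1).congr fun _ => Nat.cast_one) h0)) h0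
    rw [Nat.cast_sub (ones_le _ _)]
  · rw [VectorScheduling.weight, Fin.sum_univ_eq_sum_range (fun s =>
      if s ∈ zeroPos (V.base a).m (c a) then (1 / 2 : ℝ) ^ (s - VectorScheduling.ones (c a) s) *
        if (j a : ℝ) < 2 ^ VectorScheduling.ones (c a) s then (1 : ℝ) else 0 else 0),
      ← Finset.sum_filter, Finset.filter_mem_eq_inter,
      Finset.inter_eq_right.mpr (zeroPos_subset _ _)]
    refine Finset.sum_congr rfl fun s _ => ?_
    congr 1
    exact if_congr (by exact_mod_cast Iff.rfl) rfl rfl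

end codes

theorem smoothTop {κ : α → ℝ} (hκ : Comp V κ) {G : α → ℕ} (hG : NComp V G) (q : ℕ)
    (hq : ∀ a, G a + 1 ≤ q * ((V.base a).size + 1)) {z : (a : α) → Fin (V.base a).m → ℝ}
    (hz : ∀ i, Comp (V.ext i fun a => (V.base a).m) fun x => z x.1 x.2) :
    Comp V fun a => VectorScheduling.smoothTop (κ a) (G a) (z a) := by
  have h0 : ∀ {β : Type} (U : Ctx β), Comp U fun _ => (0 : ℝ) :=
    fun U => (const 0).congr fun _ => Nat.cast_zero
  refine ((cast NComp.m).add (sum (B := fun a => G a + 1) (f := fun a τ => (2 : ℝ) ^ (τ : ℕ) *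
    Max.max ((∑ j, Max.max (z a j - (τ : ℕ)) 0) / κ a - (τ : ℕ)) 0) q hq (hG.add (NComp.const 1))
      fun i => ?_)).congr fun a => ?_
  · have hτ := cast (NComp.var (V := V) i fun a => G a + 1)
    refine (two_pow hτ).mul ((((sum (V := V.ext i _) (B := fun x => (V.base x.1).m)
      (f := fun x j => Max.max (z x.1 j - (x.2 : ℕ)) 0) 1 (fun x => by
        simpa using (V.base x.1).m_le 1) NComp.m fun i' => ?_).div (hκ.wk i _)).sub hτ).max (h0 _))
    exact (((hz i').wk₂ i _).sub (hτ.wk i' _)).max (h0 _)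
  · rw [VectorScheduling.smoothTop, Finset.sum_range]

theorem codePot {c : α → ℕ} (hc : Comp V fun a => (c a : ℝ))
    (hlt : ∀ a, c a < 8 * (V.base a).m * (V.base a).m) {G : α → ℕ} (hG : NComp V G) (q : ℕ)
    (hq : ∀ a, G a + 1 ≤ q * ((V.base a).size + 1)) {D : α → ℝ} (hD : Comp V D)
    {z : (a : α) → Fin (V.base a).m → ℝ}
    (hz : ∀ i, Comp (V.ext i fun a => (V.base a).m) fun x => z x.1 x.2) :
    Comp V fun a => VectorScheduling.codePot (G a) (c a) (D a) (z a) := by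
  classical
  refine (prod (B := fun a => 8 * (V.base a).m) (f := fun a s =>
    if (s : ℕ) ∈ zeroPos (V.base a).m (c a) then
      VectorScheduling.smoothTop (2 ^ VectorScheduling.ones (c a) s) (G a)
        ((1 / 6 * (1 / 2) ^ (s - VectorScheduling.ones (c a) s) *
          2 ^ VectorScheduling.ones (c a) s / D a) • z a) else 1) 8
    (fun a => (V.base a).m_le 8) (NComp.const_mul 8 NComp.m) (fun a s => ?_) fun i => ?_).congr
    fun a => ?_
  · split_ifs
    · have hm : 0 < (V.base a).m := by have := s.2; omega
      exact (Nat.cast_pos.mpr hm).trans_le (le_smoothTop _)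
    · exact one_pos
  · have hs := NComp.var (V := V) i fun a => 8 * (V.base a).m
    have ho := ones (V := V.ext i fun a => 8 * (V.base a).m) (hc.wk i _) (fun p => hlt p.1)
      hs fun p => p.2.2.le
    have hh := half_pow (e := fun x : (a : α) × Fin (8 * (V.base a).m) =>
      (x.2 : ℕ) - VectorScheduling.ones (c x.1) x.2) (((cast hs).sub ho).congr fun p => by
        rw [Nat.cast_sub (ones_le _ _)])
    have h6 : Comp (V.ext i fun a => 8 * (V.base a).m) fun _ => (1 / 6 : ℝ) :=
      ((const 1).div (const 6)).congr fun _ => by norm_num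
    refine ite (PComp.mem_zeroPos (V := V.ext i _) (hc.wk i _) (fun p => hlt p.1) hs)
      (smoothTop (V := V.ext i _) (two_pow ho) (hG.wk i _) q (fun x => hq x.1) fun i' => ?_)
      ((const 1).congr fun _ => Nat.cast_one)
    exact ((((h6.mul hh).mul (two_pow ho)).div (hD.wk i _)).wk i' _).mul ((hz i').wk₂ i _)
  · rw [VectorScheduling.codePot, Fin.prod_univ_eq_prod_range (fun s =>
      if s ∈ zeroPos (V.base a).m (c a) then
      VectorScheduling.smoothTop (2 ^ VectorScheduling.ones (c a) s) (G a)
        ((1 / 6 * (1 / 2) ^ (s - VectorScheduling.ones (c a) s) *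
          2 ^ VectorScheduling.ones (c a) s / D a) • z a) else 1),
      ← Finset.prod_filter, Finset.filter_mem_eq_inter,
      Finset.inter_eq_right.mpr (zeroPos_subset _ _)]

/-- One summand of the potential function. -/
theorem codePot_digits {i x y : α → ℕ} (hi : NComp V i) (hx : NComp V x) (hy : NComp V y)
    (hxm : ∀ a, x a < (V.base a).m) (hym : ∀ a, y a < 8 * (V.base a).m)
    {z : (a : α) → Fin (V.base a).m → ℝ}
    (hz : ∀ i, Comp (V.ext i fun a => (V.base a).m) fun x => z x.1 x.2) :
    Comp V fun a => VectorScheduling.codePot (13 * (V.base a).m + (V.base a).r + 5)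
      (x a * (8 * (V.base a).m) + y a)
      ((V.base a).O (i a)
        (VectorScheduling.weight (V.base a).m (x a * (8 * (V.base a).m) + y a))) (z a) := by
  have hc : Comp V fun a => ((x a * (8 * (V.base a).m) + y a : ℕ) : ℝ) :=
    (((cast hx).mul ((const 8).mul (cast NComp.m))).add (cast hy)).congr fun a => by simp
  have hlt : ∀ a, x a * (8 * (V.base a).m) + y a < 8 * (V.base a).m * (V.base a).m := fun a => by
    have h1 := hxm a
    have h2 := hym a
    nlinarith
  refine codePot hc hlt (((NComp.const_mul 13 NComp.m).add NComp.r).add (NComp.const 5)) 13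
    (fun a => ?_) (oracle hi fun i₃ => ?_) hz
  · unfold Base.size
    omega
  · exact weight (V := V.ext i₃ fun a => (V.base a).m) (hc.wk i₃ _) (fun p => hlt p.1)
      (NComp.var i₃ _)

variable {X : (a : α) → Fin (V.base a).r → Fin (V.base a).m → ℝ}

theorem potential (hX : ∀ i i', Comp ((V.ext i fun a => (V.base a).r).ext i'
      fun x => (V.base x.1).m) fun x => X x.1.1 x.1.2 x.2) :
    Comp V fun a => VectorScheduling.potential (V.base a).O (X a) := by
  unfold VectorScheduling.potential
  refine sum 1 (fun a => by unfold Base.size; omega) NComp.r fun i => ?_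
  refine sum (V := V.ext i fun a => (V.base a).r) (B := fun p => (V.base p.1).m) 1
    (fun p => by simpa using (V.base p.1).m_le 1) NComp.m fun i₁ => ?_
  refine sum (V := (V.ext i fun a => (V.base a).r).ext i₁ fun p => (V.base p.1).m)
    (B := fun p => 8 * (V.base p.1.1).m) 8
    (fun p => (V.base p.1.1).m_le 8) (NComp.const_mul 8 NComp.m) fun i₂ => ?_
  exact codePot_digits (V := ((V.ext i fun a => (V.base a).r).ext i₁ fun p => (V.base p.1).m).ext i₂
    fun p => 8 * (V.base p.1.1).m) (((NComp.var i _).wk i₁ _).wk i₂ _) ((NComp.var i₁ _).wk i₂ _)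
    (NComp.var i₂ _) (fun p => p.1.2.2) (fun p => p.2.2) fun i₃ => ((hX i i₃).wk₂ i₁ _).wk₂ i₂ _

theorem crude (hX : ∀ i i', Comp ((V.ext i fun a => (V.base a).r).ext i'
      fun x => (V.base x.1).m) fun x => X x.1.1 x.1.2 x.2) :
    Comp V fun a => VectorScheduling.crude (V.base a).O (X a) := by
  unfold VectorScheduling.crude
  refine (sum 1 (fun a => by unfold Base.size; omega) NComp.r fun i => ?_).div
    ((cast NComp.m).mul (cast NComp.r))
  refine sum (V := V.ext i fun a => (V.base a).r) (B := fun p => (V.base p.1).m) 1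
    (fun p => by simpa using (V.base p.1).m_le 1) NComp.m fun i₁ => ?_
  refine (hX i i₁).div (oracle (V := (V.ext i fun a => (V.base a).r).ext i₁ fun p => (V.base p.1).m)
    ((NComp.var i _).wk i₁ _) fun i₂ => ?_)
  exact ite (PComp.of_iff (PComp.lt (cast (NComp.var i₂ _)) (const 1)) fun p => Nat.cast_lt)
    ((const 1).congr fun _ => Nat.cast_one) ((const 0).congr fun _ => Nat.cast_zero)

/-- A load that is multiplied by a number. -/
theorem smul_load {Λ : α → ℝ} (hΛ : Comp V Λ)
    (hX : ∀ i i', Comp ((V.ext i fun a => (V.base a).r).ext i'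
      fun x => (V.base x.1).m) fun x => X x.1.1 x.1.2 x.2) (i i' : ℕ) :
    Comp ((V.ext i fun a => (V.base a).r).ext i' fun x => (V.base x.1).m)
      fun x => (Λ x.1.1 • X x.1.1) x.1.2 x.2 :=
  ((hΛ.wk i _).wk i' _).mul (hX i i')

theorem score {Λ : α → ℝ} (hΛ : Comp V Λ)
    (hX : ∀ i i', Comp ((V.ext i fun a => (V.base a).r).ext i'
      fun x => (V.base x.1).m) fun x => X x.1.1 x.1.2 x.2) :
    Comp V fun a => VectorScheduling.score (VectorScheduling.potential (V.base a).O)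
      (VectorScheduling.crude (V.base a).O) (Λ a) (X a) := by
  classical
  have h0 : ∀ {β : Type} (U : Ctx β), Comp U fun _ => (0 : ℝ) :=
    fun U => (const 0).congr fun _ => Nat.cast_zero
  have hinv : Comp V fun a => (Λ a)⁻¹ := ((const 1).div hΛ).congr fun a => by simp
  refine (potential (X := fun a => (Λ a)⁻¹ • X a) (smul_load hinv hX)).add
    (ite ((PComp.le hΛ (h0 _)).and (PComp.lt (h0 _) (crude hX)))
      ((const 2).mul (potential (X := fun _ => 0) fun i i' => h0 _)) (h0 _)) |>.congr fun a => ?_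
  unfold VectorScheduling.score
  norm_num

theorem scale {Λ β : α → ℝ} (hΛ : Comp V Λ) (hβ : Comp V β) {n : α → ℕ}
    (hn : Comp V fun a => (n a : ℝ)) :
    Comp V fun a => VectorScheduling.scale (Λ a) (β a) (n a) := by
  refine (ite (PComp.le hn (const 0)) hΛ ((((const 2).mul hΛ).max hβ).mul
    ((two_pow hn).div (const 2)))).congr fun a => ?_
  cases n a with
  | zero => simp [VectorScheduling.scale]
  | succ n =>
    rw [if_neg (by rw [Nat.cast_le]; omega), VectorScheduling.scale, pow_succ]
    simp

end Comp

end VectorScheduling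
namespace VectorScheduling

/-! ### Online algorithms from computable rules -/

/-- The loads of the jobs `js`, continued by `0`. -/
noncomputable def loads {m r k : ℕ} (js : List (Job m r k)) (s i j c : ℕ) : ℝ :=
  (inputState js).reals [s, i, j, c]

/-- The input of the program on the jobs `js`, with all results `0`. -/
noncomputable def Base.ofJobs {m r k : ℕ} (N : Fin r → (Fin m → ℝ) → ℝ) (js : List (Job m r k)) :
    Base where
  m := m
  r := r
  k := k
  t := js.length
  s := 0
  O := ballOracle N
  Y _ := 0
  C := loads js
  isLocal i x y h := by
    have hxy : (fun j : Fin m => x j) = fun j : Fin m => y j := funext fun j => h j j.2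
    by_cases hi : i < r
    · simp only [ballOracle, dif_pos hi, fun j : Fin m => congrFun hxy j]
    · simp only [ballOracle, dif_neg hi]

/-- The value of `E` depends on the job that is processed and on those before it only, neither on
later jobs nor on the number of jobs. -/
def IsOnline (E : Base → ℝ) : Prop :=
  ∀ (b : Base) (t : ℕ) (C : ℕ → ℕ → ℕ → ℕ → ℝ), b.s < b.t → b.s < t → (∀ s ≤ b.s, C s = b.C s) →
    E { b with t := t, C := C } = E b

/-- The results of online rules for the first `s` jobs do not depend on the later jobs. -/
theorem results_congr {E₁ E₂ : Base → ℝ} (h₁ : IsOnline E₁) (h₂ : IsOnline E₂) (b : Base) (t : ℕ)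
    (C : ℕ → ℕ → ℕ → ℕ → ℝ) {s : ℕ} (hs : s ≤ b.t) (hst : s ≤ t) (hC : ∀ s' < s, C s' = b.C s') :
    results E₁ E₂ { b with t := t, C := C } s = results E₁ E₂ b s := by
  induction s with
  | zero => rfl
  | succ s ih =>
    have ih := ih (by omega) (by omega) fun s' hs' => hC s' (by omega)
    have e₁ : ∀ Y, E₁ (Base.at { b with t := t, C := C } s Y) = E₁ (b.at s Y) := fun Y =>
      h₁ (b.at s Y) t C hs hst fun s' hs' => hC s' (Nat.lt_succ_of_le hs')
    have e₂ : ∀ Y, E₂ (Base.at { b with t := t, C := C } s Y) = E₂ (b.at s Y) := fun Y =>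
      h₂ (b.at s Y) t C hs hst fun s' hs' => hC s' (Nat.lt_succ_of_le hs')
    simp only [results, ih, e₁, e₂]

/-- Entries that belong to earlier jobs are not changed any more. -/
theorem results_stable {E₁ E₂ : Base → ℝ} {b : Base} {s T n : ℕ} (hsT : s ≤ T)
    (hn : ∀ s', s ≤ s' → n ≠ 2 * s' ∧ n ≠ 2 * s' + 3) :
    results E₁ E₂ b T n = results E₁ E₂ b s n := by
  induction T, hsT using Nat.le_induction with
  | base => rfl
  | succ T hT ih =>
    rw [results, Function.update_of_ne (hn T hT).1, Function.update_of_ne (hn T hT).2, ih]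

theorem results_fst {E₁ E₂ : Base → ℝ} {b : Base} {s T : ℕ} (hsT : s < T) :
    results E₁ E₂ b T (2 * s + 3) = E₁ (b.at s (results E₁ E₂ b s)) := by
  rw [results_stable (Nat.succ_le_of_lt hsT) fun s' hs' => by omega, results,
    Function.update_of_ne (by omega), Function.update_self]

theorem results_snd {E₁ E₂ : Base → ℝ} {b : Base} {s T : ℕ} (hsT : s < T) :
    results E₁ E₂ b T (2 * s) = E₂ (b.at s (Function.update (results E₁ E₂ b s) (2 * s + 3)
      (E₁ (b.at s (results E₁ E₂ b s))))) := by
  rw [results_stable (Nat.succ_le_of_lt hsT) fun s' hs' => by omega, results, Function.update_self]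

theorem loads_take {m r k : ℕ} (js : List (Job m r k)) {t : ℕ} (s : ℕ) (hs : s < t)
    (hst : s < js.length) : loads (js.take t) s = loads js s := by
  funext i j c
  simp only [loads, inputState]
  by_cases h : i < r ∧ j < m ∧ c < k
  · rw [dif_pos ⟨by simp; omega, h⟩, dif_pos ⟨hst, h⟩]
    simp
  · rw [dif_neg fun h' => h h'.2, dif_neg fun h' => h h'.2]

/-- Two computable rules, for an auxiliary number and for the choice, define an online algorithm
that one program implements. -/
theorem exists_algorithm {E₁ E₂ : Base → ℝ} (h₁ : Comp Ctx.nil E₁) (h₂ : Comp Ctx.nil E₂)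
    (o₁ : IsOnline E₁) (o₂ : IsOnline E₂) (hE : ∀ b : Base, 1 ≤ b.k → ∃ c < b.k, E₂ b = (c : ℕ)) :
    ∃ (P : Prog) (q e : ℕ), ∀ m r k : ℕ, 1 ≤ m → 1 ≤ k → ∀ N : Fin r → (Fin m → ℝ) → ℝ,
      ∃ A : OnlineAlgorithm m r k, Implements N P q e A ∧
        ∀ (js : List (Job m r k)) (s : Fin js.length),
          results E₁ E₂ (Base.ofJobs N js) js.length (2 * s) = (A.choices js s : ℕ) := by
  obtain ⟨P, q, e, hP⟩ := exists_prog h₁ h₂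
  refine ⟨P, q, e, fun m r k hm hk N => ?_⟩
  have hex : ∀ js : List (Job m r k), ∃ c : Fin k, js ≠ [] →
      results E₁ E₂ (Base.ofJobs N js) js.length (2 * (js.length - 1)) = (c : ℕ) := by
    intro js
    by_cases hjs : js = []
    · exact ⟨⟨0, hk⟩, fun h => (h hjs).elim⟩
    · have hlen := List.length_pos_iff.mpr hjs
      have h := results_snd (E₁ := E₁) (E₂ := E₂) (b := Base.ofJobs N js)
        (Nat.sub_lt hlen one_pos : js.length - 1 < js.length)
      obtain ⟨c, hc, hEc⟩ := hE _ (show 1 ≤ (Base.at (Base.ofJobs N js) (js.length - 1)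
        (Function.update (results E₁ E₂ (Base.ofJobs N js) (js.length - 1))
          (2 * (js.length - 1) + 3) (E₁ ((Base.ofJobs N js).at (js.length - 1)
            (results E₁ E₂ (Base.ofJobs N js) (js.length - 1)))))).k from hk)
      exact ⟨⟨c, hc⟩, fun _ => h.trans hEc⟩
  choose A hA using hex
  refine ⟨A, fun js hjs _ => ?_, fun js s => ?_⟩
  · have hlen := List.length_pos_iff.mpr hjs
    exact hP (Base.ofJobs N js) (inputState js) (A js) rfl hm hlen
      ⟨rfl, rfl, rfl, rfl, rfl, fun _ => rfl, fun _ _ _ _ => rfl, fun _ hv => hv.elim⟩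
      (hA js hjs) (A js).2.le
  · have hs := s.2
    have hlen : (js.take (s + 1)).length = s + 1 := by simp
    have h := hA (js.take (s + 1)) (by
      intro h
      rw [h] at hlen
      simp at hlen)
    rw [hlen, Nat.add_sub_cancel] at h
    have hc := results_congr o₁ o₂ (Base.ofJobs N js) (js.take (s + 1)).length
      (loads (js.take (s + 1))) (s := s + 1) hs hlen.ge fun s' hs' =>
        loads_take js s' hs' (by omega)
    rw [results_stable (Nat.succ_le_of_lt hs) fun s' hs' => by omega]
    change results E₁ E₂ (Base.ofJobs N (js.take (s + 1))) (s + 1) = _ at hc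
    rw [← hc]
    exact h

/-! ### The two rules of the greedy algorithm with a doubling scale -/

section
variable {m r : ℕ} (C : ℕ → ℕ → ℕ → ℕ → ℝ) (Y : ℕ → ℝ) (k t s : ℕ)

/-- The load of the job `s` under option `c`. -/
def jobLoad (s c : ℕ) : Fin r → Fin m → ℝ := fun i j => C s i j c

theorem jobLoad_congr {C' : ℕ → ℕ → ℕ → ℕ → ℝ} {C : ℕ → ℕ → ℕ → ℕ → ℝ} {s : ℕ} (h : C' s = C s) :
    (jobLoad C' s : ℕ → Fin r → Fin m → ℝ) = jobLoad C s := by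
  funext c i j
  rw [jobLoad, jobLoad, h]

/-- The load of those jobs before `s` that were processed at the scale `Λ`, according to the
results `Y`. -/
noncomputable def earlierLoad (Λ : ℝ) : Fin r → Fin m → ℝ := fun i j =>
  ∑ s' : Fin t, if (s' : ℝ) < s ∧ Y (2 * s' + 3) = Λ then
    ∑ c : Fin k, if Y (2 * s') = (c : ℕ) then C s' i j c else 0 else 0

theorem earlierLoad_eq {t s : ℕ} (h : s ≤ t) (Λ : ℝ) (i : Fin r) (j : Fin m) :
    earlierLoad C Y k t s Λ i j = ∑ s' ∈ Finset.range s, if Y (2 * s' + 3) = Λ then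
      ∑ c : Fin k, if Y (2 * s') = (c : ℕ) then C s' i j c else 0 else 0 := by
  rw [earlierLoad, Fin.sum_univ_eq_sum_range (fun s' => if (s' : ℝ) < s ∧ Y (2 * s' + 3) = Λ then
    ∑ c : Fin k, if Y (2 * s') = (c : ℕ) then C s' i j c else 0 else 0),
    ← filter_range_lt h, Finset.sum_filter]
  refine Finset.sum_congr rfl fun s' _ => ?_
  rw [← ite_and]
  simp only [Nat.cast_lt]

theorem earlierLoad_congr {t s : ℕ} (h : s < t) {t' : ℕ} (h' : s < t')
    {C' : ℕ → ℕ → ℕ → ℕ → ℝ} (hC : ∀ s' ≤ s, C' s' = C s') :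
    (earlierLoad C' Y k t' s : ℝ → Fin r → Fin m → ℝ) = earlierLoad C Y k t s := by
  funext Λ i j
  rw [earlierLoad_eq C' Y k h'.le, earlierLoad_eq C Y k h.le]
  exact Finset.sum_congr rfl fun s' hs' => by rw [hC s' (Finset.mem_range.mp hs').le]

end

section
variable {W : Type*} [AddCommGroup W] [Module ℝ W] (Φ crude : W → ℝ)

/-- The smallest value of `crude` on the loads `J c`, written as a sum over the options. -/
noncomputable def lowerBound (k : ℕ) (J : ℕ → W) : ℝ :=
  ∑ c : Fin k, if ((c : ℕ) : ℝ) = argmin k fun c => crude (J c) then crude (J c) else 0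

/-- The next scale, after the scale `Λ`, if the load at any scale is given by `L` and the loads of
the next job by `J`. -/
noncomputable def nextScale (k B : ℕ) (Λ : ℝ) (L : ℝ → W) (J : ℕ → W) : ℝ :=
  scale Λ (lowerBound crude k J) (firstIdx B fun n => ∃ c : Fin k,
    score Φ crude (scale Λ (lowerBound crude k J) n)
      (L (scale Λ (lowerBound crude k J) n) + J c) ≤ 2 * Φ 0)

/-- The choice for the next job at the scale `Λ`. -/
noncomputable def nextChoice (k : ℕ) (Λ : ℝ) (L : ℝ → W) (J : ℕ → W) : ℕ :=
  argmin k fun c => score Φ crude Λ (L Λ + J c)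

omit [AddCommGroup W] [Module ℝ W] in
theorem lowerBound_eq {k : ℕ} (hk : 1 ≤ k) (J : ℕ → W) :
    lowerBound crude k J = crude (J (argmin k fun c => crude (J c))) := by
  have hlt := (argmin_spec hk fun c => crude (J c)).1
  rw [lowerBound, Finset.sum_eq_single ⟨_, hlt⟩]
  · simp
  · intro c _ hc
    rw [if_neg]
    intro hc'
    exact hc (Fin.ext (by exact_mod_cast hc'))
  · simp

end

/-- The rule for the scale. The last scale is the entry `2 * s + 1 = 2 * (s - 1) + 3` of the
results; for the first job this is `0`. -/
noncomputable def scaleRule (b : Base) : ℝ :=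
  nextScale (W := Fin b.r → Fin b.m → ℝ) (potential b.O) (crude b.O) b.k (b.m + b.r + 2)
    (b.Y (2 * b.s + 1)) (earlierLoad b.C b.Y b.k b.t b.s) (jobLoad b.C b.s)

/-- The rule for the choice. -/
noncomputable def choiceRule (b : Base) : ℝ :=
  (nextChoice (W := Fin b.r → Fin b.m → ℝ) (potential b.O) (crude b.O) b.k
    (b.Y (2 * b.s + 3)) (earlierLoad b.C b.Y b.k b.t b.s) (jobLoad b.C b.s) : ℕ)

theorem isOnline_scaleRule : IsOnline scaleRule := by
  intro b t C h ht hC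
  simp only [scaleRule, earlierLoad_congr b.C b.Y b.k h ht hC]
  rw [jobLoad_congr (hC b.s le_rfl)]

theorem isOnline_choiceRule : IsOnline choiceRule := by
  intro b t C h ht hC
  simp only [choiceRule, earlierLoad_congr b.C b.Y b.k h ht hC]
  rw [jobLoad_congr (hC b.s le_rfl)]

namespace Comp
variable {α : Type} {V : Ctx α}

theorem job {s c : α → ℕ} (hs : NComp V s) (hc : NComp V c) (i i' : ℕ) :
    Comp ((V.ext i fun a => (V.base a).r).ext i' fun x => (V.base x.1).m)
      fun x => (jobLoad (V.base x.1.1).C (s x.1.1) (c x.1.1) :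
        Fin (V.base x.1.1).r → Fin (V.base x.1.1).m → ℝ) x.1.2 x.2 :=
  readC ((hs.wk i _).wk i' _) ((NComp.var i _).wk i' _) (NComp.var i' _) ((hc.wk i _).wk i' _)

theorem load {Λ : α → ℝ} (hΛ : Comp V Λ) (i i' : ℕ) :
    Comp ((V.ext i fun a => (V.base a).r).ext i' fun x => (V.base x.1).m)
      fun x => (earlierLoad (V.base x.1.1).C (V.base x.1.1).Y (V.base x.1.1).k (V.base x.1.1).t
        (V.base x.1.1).s (Λ x.1.1) :
          Fin (V.base x.1.1).r → Fin (V.base x.1.1).m → ℝ) x.1.2 x.2 := by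
  classical
  have h0 : ∀ {β : Type} (U : Ctx β), Comp U fun _ => (0 : ℝ) :=
    fun U => (const 0).congr fun _ => Nat.cast_zero
  unfold earlierLoad
  refine sum (V := (V.ext i fun a => (V.base a).r).ext i' fun x => (V.base x.1).m)
    (B := fun x => (V.base x.1.1).t) 1 (fun x => by
      change _ ≤ 1 * ((V.base x.1.1).size + 1); unfold Base.size; omega) NComp.t fun i₁ => ?_
  set U := ((V.ext i fun a => (V.base a).r).ext i' fun x => (V.base x.1).m).ext i₁
    fun x => (V.base x.1.1).t with hU
  have hv : NComp U fun x => (x.2 : ℕ) := NComp.var i₁ _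
  refine ite ((PComp.lt (cast hv) (cast (NComp.s (V := U)))).and
    (PComp.eq (readY ((NComp.const_mul 2 hv).add (NComp.const 3)))
      (((hΛ.wk i _).wk i' _).wk i₁ _))) ?_ (h0 _)
  refine sum (V := U) (B := fun x => (V.base x.1.1.1).k) 1 (fun x => by
      change _ ≤ 1 * ((V.base x.1.1.1).size + 1); unfold Base.size; omega) NComp.k fun i₂ => ?_
  refine ite (PComp.eq (readY ((NComp.const_mul 2 hv).wk i₂ _)) (cast (NComp.var i₂ _))) ?_ (h0 _)
  exact readC (hv.wk i₂ _) ((((NComp.var i _).wk i' _).wk i₁ _).wk i₂ _)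
    (((NComp.var i' _).wk i₁ _).wk i₂ _) (NComp.var i₂ _)

theorem lowerBound {s : α → ℕ} (hs : NComp V s) :
    Comp V fun a => VectorScheduling.lowerBound
      (VectorScheduling.crude (V.base a).O : (Fin (V.base a).r → Fin (V.base a).m → ℝ) → ℝ)
      (V.base a).k (jobLoad (V.base a).C (s a)) := by
  classical
  have hk : ∀ a, (V.base a).k ≤ 1 * ((V.base a).size + 1) := fun a => by unfold Base.size; omega
  have hc : ∀ i, Comp (V.ext i fun a => (V.base a).k) fun x => VectorScheduling.crude (V.base x.1).O
      (jobLoad (V.base x.1).C (s x.1) x.2 : Fin (V.base x.1).r → Fin (V.base x.1).m → ℝ) := fun i =>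
    crude (V := V.ext i fun a => (V.base a).k)
      (X := fun x => jobLoad (V.base x.1).C (s x.1) x.2)
      (job (V := V.ext i fun a => (V.base a).k) (hs.wk i _) (NComp.var i _))
  refine sum 1 hk NComp.k fun i => ite (PComp.eq (cast (NComp.var i _)) ?_) (hc i)
    ((const 0).congr fun _ => Nat.cast_zero)
  exact (argmin (f := fun a c => VectorScheduling.crude (V.base a).O
    (jobLoad (V.base a).C (s a) c : Fin (V.base a).r → Fin (V.base a).m → ℝ)) 1 hk NComp.k hc).wk
      i _

/-- The score of the current job under option `c` at the scale `Λ`. -/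
theorem score_job {Λ : α → ℝ} (hΛ : Comp V Λ) {c : α → ℕ} (hc : NComp V c) :
    Comp V fun a => VectorScheduling.score (VectorScheduling.potential (V.base a).O)
      (VectorScheduling.crude (V.base a).O) (Λ a)
      (earlierLoad (V.base a).C (V.base a).Y (V.base a).k (V.base a).t (V.base a).s (Λ a) +
        jobLoad (V.base a).C (V.base a).s (c a) : Fin (V.base a).r → Fin (V.base a).m → ℝ) :=
  score hΛ (X := fun a => earlierLoad (V.base a).C (V.base a).Y (V.base a).k (V.base a).t
      (V.base a).s (Λ a) + jobLoad (V.base a).C (V.base a).s (c a))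
    fun i i' => (load hΛ i i').add (job NComp.s hc i i')

theorem scaleRule : Comp Ctx.nil VectorScheduling.scaleRule := by
  have hY : Comp Ctx.nil fun b => b.Y (2 * b.s + 1) :=
    readY ((NComp.const_mul 2 NComp.s).add (NComp.const 1))
  have hl : Comp Ctx.nil fun b => VectorScheduling.lowerBound
      (VectorScheduling.crude b.O : (Fin b.r → Fin b.m → ℝ) → ℝ) b.k (jobLoad b.C b.s) :=
    lowerBound NComp.s
  refine scale hY hl (firstIdx 3 (fun b => by
    change _ ≤ 3 * (b.size + 1); unfold Base.size; omega)
    ((NComp.m.add NComp.r).add (NComp.const 2)) fun i => ?_)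
  have hn := scale (V := Ctx.nil.ext i fun b => b.m + b.r + 2) (hY.wk i _) (hl.wk i _)
    (cast (NComp.var i _))
  refine PComp.exists_fin (V := Ctx.nil.ext i fun b => b.m + b.r + 2) (B := fun x => x.1.k) 1
    (fun x => by change _ ≤ 1 * (x.1.size + 1); unfold Base.size; omega) NComp.k fun i₁ => ?_
  refine PComp.le (score_job (V := (Ctx.nil.ext i fun b => b.m + b.r + 2).ext i₁ fun x => x.1.k)
    (hn.wk i₁ _) (NComp.var i₁ _)) ((const 2).mul (potential
      (V := (Ctx.nil.ext i fun b => b.m + b.r + 2).ext i₁ fun x => x.1.k) (X := fun _ => 0)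
      fun i i' => (const 0).congr fun _ => Nat.cast_zero))

theorem choiceRule : Comp Ctx.nil VectorScheduling.choiceRule := by
  have hY : Comp Ctx.nil fun b => b.Y (2 * b.s + 3) :=
    readY ((NComp.const_mul 2 NComp.s).add (NComp.const 3))
  exact argmin 1 (fun b => by change _ ≤ 1 * (b.size + 1); unfold Base.size; omega) NComp.k
    fun i => score_job (V := Ctx.nil.ext i fun b => b.k) (hY.wk i _) (NComp.var i _)

end Comp

end VectorScheduling
namespace VectorScheduling

/-! ### Competitiveness for monotone symmetric norms -/

section
variable {m r k : ℕ} {N : Fin r → (Fin m → ℝ) → ℝ}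

theorem job_nonneg {js : List (Job m r k)} (hjs : Nonneg js) (s c : ℕ) :
    (0 : Fin r → Fin m → ℝ) ≤ jobLoad (loads js) s c := by
  intro i j
  simp only [jobLoad, loads, inputState]
  split_ifs with h
  · exact hjs _ (List.get_mem _ _) _ _ _
  · exact le_rfl

theorem cost_eq (js : List (Job m r k)) (y : Fin js.length → Fin k) {y' : ℕ → ℕ}
    (hy : ∀ s : Fin js.length, y' s = y s) :
    cost N js y = maxNorm N
      (∑ s ∈ Finset.range js.length, jobLoad (loads js) s (y' s) : Fin r → Fin m → ℝ) := by
  unfold cost maxNorm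
  congr 1
  funext i
  congr 1
  funext j
  rw [totalLoad, Finset.sum_apply, Finset.sum_apply, Finset.sum_range]
  refine Finset.sum_congr rfl fun s _ => ?_
  have h : (s : ℕ) < js.length ∧ (i : ℕ) < r ∧ (j : ℕ) < m ∧ y' s < k :=
    ⟨s.2, i.2, j.2, by rw [hy]; exact (y s).2⟩
  simp only [jobLoad, loads, inputState]
  rw [dif_pos h]
  exact congrArg (js.get s i j) (Fin.ext (hy s).symm)

/-- It suffices to compare the algorithm with all other choices. -/
theorem isCompetitive_of_forall (hk : 1 ≤ k) {A : OnlineAlgorithm m r k} {β : ℝ} (hβ : 0 ≤ β)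
    (h : ∀ js : List (Job m r k), Nonneg js → ∀ x y : ℕ → ℕ, (∀ s, y s < k) →
      (∀ s : Fin js.length, x s = A.choices js s) →
      maxNorm N (∑ s ∈ Finset.range js.length, jobLoad (loads js) s (x s) : Fin r → Fin m → ℝ) ≤
        β * maxNorm N
          (∑ s ∈ Finset.range js.length, jobLoad (loads js) s (y s) : Fin r → Fin m → ℝ)) :
    IsCompetitive N A β := by
  intro js hjs
  have hne : Nonempty (Fin js.length → Fin k) := ⟨fun _ => ⟨0, hk⟩⟩
  rw [opt, Real.mul_iInf_of_nonneg hβ]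
  refine le_ciInf fun y => ?_
  have hext : ∀ z : Fin js.length → Fin k, ∃ z' : ℕ → ℕ, (∀ s, z' s < k) ∧
      ∀ s : Fin js.length, z' s = z s := fun z =>
    ⟨fun s => if h : s < js.length then z ⟨s, h⟩ else 0, fun s => by
      dsimp only
      split_ifs
      · exact (z _).2
      · exact hk, fun s => by simp⟩
  obtain ⟨x', -, hx'⟩ := hext (A.choices js)
  obtain ⟨y', hy', hyy⟩ := hext y
  rw [cost_eq js _ hx', cost_eq js y hyy]
  exact h js hjs x' y' hy' hx'

/-- The load that the rules use is the load of the earlier choices. -/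
theorem earlierLoad_eq_load {C : ℕ → ℕ → ℕ → ℕ → ℝ} {Y : ℕ → ℝ} {t s : ℕ} (hs : s ≤ t)
    {lam : ℕ → ℝ} {x : ℕ → ℕ}
    (hlam : ∀ s' < s, Y (2 * s' + 3) = lam (s' + 1)) (hx : ∀ s' < s, Y (2 * s') = (x s' : ℕ))
    (hxk : ∀ s' < s, x s' < k) :
    (earlierLoad C Y k t s : ℝ → Fin r → Fin m → ℝ) = load (jobLoad C) lam x s := by
  funext Λ i j
  rw [earlierLoad_eq C Y k hs, load, Finset.sum_apply, Finset.sum_apply]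
  refine Finset.sum_congr rfl fun s' hs' => ?_
  have h := Finset.mem_range.mp hs'
  rw [hlam s' h]
  split_ifs
  · rw [Finset.sum_eq_single ⟨x s', hxk s' h⟩]
    · simp [hx s' h, jobLoad]
    · intro c _ hc
      rw [hx s' h, if_neg]
      intro hc'
      exact hc (Fin.ext (by exact_mod_cast hc'.symm))
    · simp
  · rfl

/-- The results of the two rules form a run of the greedy algorithm with a doubling scale. -/
theorem isDoublingRun (hk : 1 ≤ k) (js : List (Job m r k)) {x : ℕ → ℕ}
    (hxk : ∀ s < js.length, x s < k) (hx : ∀ s < js.length,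
      results scaleRule choiceRule (Base.ofJobs N js) js.length (2 * s) = (x s : ℕ)) :
    IsDoublingRun (W := Fin r → Fin m → ℝ) k (m + r + 2) (potential (ballOracle N))
      (crude (ballOracle N)) (jobLoad (loads js))
      (fun s => results scaleRule choiceRule (Base.ofJobs N js) js.length (2 * s + 1)) x
      js.length := by
  set R := results scaleRule choiceRule (Base.ofJobs N js) with hR
  set lam : ℕ → ℝ := fun s => R js.length (2 * s + 1) with hlam
  have hl3 : ∀ s, s < js.length → ∀ s' < s, R s (2 * s' + 3) = lam (s' + 1) :=
    fun s hs s' hs' => (results_stable hs.le fun _ _ => by omega).symm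
  have hl0 : ∀ s, s < js.length → ∀ s' < s, R s (2 * s') = (x s' : ℕ) := fun s hs s' hs' => by
    rw [← hx s' (hs'.trans hs)]
    exact (results_stable hs.le fun _ _ => by omega).symm
  have hl1 : ∀ s, s < js.length → R s (2 * s + 1) = lam s := fun s hs =>
    (results_stable hs.le fun _ _ => by omega).symm
  have hxk' : ∀ s, s < js.length → ∀ s' < s, x s' < k := fun s hs s' hs' => hxk s' (hs'.trans hs)
  refine ⟨results_stable (Nat.zero_le _) fun _ _ => by omega, fun s hs => ?_, fun s hs => ?_⟩
  · have h1 : lam (s + 1) = nextScale (W := Fin r → Fin m → ℝ) (potential (ballOracle N))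
        (crude (ballOracle N)) k (m + r + 2) (R s (2 * s + 1))
        (earlierLoad (loads js) (R s) k js.length s) (jobLoad (loads js) s) := results_fst hs
    rw [h1, nextScale, lowerBound_eq _ hk, hl1 s hs,
      earlierLoad_eq_load hs.le (hl3 s hs) (hl0 s hs) (hxk' s hs)]
    congr 2
    funext n
    exact propext ⟨fun ⟨c, h⟩ => ⟨c, c.2, h⟩, fun ⟨c, hc, h⟩ => ⟨⟨c, hc⟩, h⟩⟩
  · have h1 := hx s hs
    rw [hR, results_snd hs, ← hR] at h1
    set Y := Function.update (R s) (2 * s + 3) (scaleRule ((Base.ofJobs N js).at s (R s))) with hY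
    have hY3 : Y (2 * s + 3) = lam (s + 1) := by
      rw [hY, Function.update_self]
      exact (results_fst hs).symm
    have h2 : choiceRule ((Base.ofJobs N js).at s Y) =
        (nextChoice (W := Fin r → Fin m → ℝ) (potential (ballOracle N)) (crude (ballOracle N)) k
          (Y (2 * s + 3)) (earlierLoad (loads js) Y k js.length s)
          (jobLoad (loads js) s) : ℕ) := rfl
    rw [h2, hY3, earlierLoad_eq_load (Y := Y) hs.le
      (fun s' hs' => by rw [hY, Function.update_of_ne (by omega), hl3 s hs s' hs'])
      (fun s' hs' => by rw [hY, Function.update_of_ne (by omega), hl0 s hs s' hs'])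
      (hxk' s hs)] at h1
    exact_mod_cast h1.symm

end

theorem exists_competitive_of_isMonotoneSymmetricNorm :
    ∃ (K : ℝ) (P : Prog) (b d : ℕ), ∀ m r k : ℕ, 1 ≤ m → 1 ≤ r → 1 ≤ k →
      ∀ N : Fin r → (Fin m → ℝ) → ℝ, (∀ i, IsMonotoneSymmetricNorm (N i)) →
        ∃ A : OnlineAlgorithm m r k, Implements N P b d A ∧
          IsCompetitive N A (K * (1 + Real.log m ^ 2 + Real.log r)) := by
  obtain ⟨P, q, e, hP⟩ := exists_algorithm Comp.scaleRule Comp.choiceRule isOnline_scaleRule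
    isOnline_choiceRule fun b hk => ⟨_, (argmin_spec hk _).1, rfl⟩
  refine ⟨10000, P, q, e, fun m r k hm hr hk N hN => ?_⟩
  obtain ⟨A, hA, hAx⟩ := hP m r k hm hk N
  have hr0 : 0 ≤ Real.log r := Real.log_natCast_nonneg r
  refine ⟨A, hA, isCompetitive_of_forall hk (by positivity) fun js hjs x y hy hx => ?_⟩
  have hrun := isDoublingRun (N := N) hk js (x := x)
    (fun s hs => by rw [hx ⟨s, hs⟩]; exact (A.choices js ⟨s, hs⟩).2)
    (fun s hs => by rw [hx ⟨s, hs⟩]; exact hAx js ⟨s, hs⟩)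
  have hpot := isPotential hm hr hN
  have hR : 0 ≤ factor m r := by
    have h1 := logb_two_nonneg (m := m)
    have h2 := logb_two_nonneg (m := r)
    unfold factor
    positivity
  have hq : ((m : ℝ) * r) ≤ 2 ^ (m + r + 2 - 2) := by
    rw [Nat.add_sub_cancel, pow_add]
    have h1 : m < 2 ^ m := Nat.lt_two_pow_self
    have h2 : r < 2 ^ r := Nat.lt_two_pow_self
    exact_mod_cast Nat.mul_le_mul h1.le h2.le
  refine (hrun.cost_le hpot (job_nonneg hjs) hk hq (by omega) hR hy).trans
    (mul_le_mul_of_nonneg_right factor_le ?_)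
  rw [← hpot.V_zero]
  exact hpot.V_mono _ _ le_rfl (Finset.sum_nonneg fun s _ => job_nonneg hjs s _)

end VectorScheduling
namespace VectorScheduling

/-! ### The `ℓ_p` norms -/

section
variable {m : ℕ} {p : ENNReal}

theorem lpNorm_top (x : Fin m → ℝ) : lpNorm ⊤ x = ⨆ j, |x j| := by
  rw [lpNorm, PiLp.norm_eq_ciSup]
  rfl

theorem lpNorm_eq (hp : 1 ≤ p) (hp' : p ≠ ⊤) (x : Fin m → ℝ) :
    lpNorm p x = (∑ j, |x j| ^ p.toReal) ^ (1 / p.toReal) := by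
  rw [lpNorm, PiLp.norm_eq_sum (ENNReal.toReal_pos (one_pos.trans_le hp).ne' hp')]
  rfl

theorem one_le_toReal (hp : 1 ≤ p) (hp' : p ≠ ⊤) : 1 ≤ p.toReal := by
  rw [← ENNReal.toReal_one]
  exact ENNReal.toReal_mono hp' hp

theorem apply_le_lpNorm (hp : 1 ≤ p) (x : Fin m → ℝ) (j : Fin m) : |x j| ≤ lpNorm p x := by
  by_cases hp' : p = ⊤
  · rw [hp', lpNorm_top]
    exact le_ciSup (f := fun j => |x j|) (Set.finite_range _).bddAbove j
  · have h1 := one_le_toReal hp hp'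
    rw [lpNorm_eq hp hp']
    calc |x j| = (|x j| ^ p.toReal) ^ (1 / p.toReal) := by
          rw [← Real.rpow_mul (abs_nonneg _), mul_one_div_cancel (by linarith), Real.rpow_one]
      _ ≤ _ := Real.rpow_le_rpow (by positivity) (Finset.single_le_sum
          (f := fun j => |x j| ^ p.toReal) (fun _ _ => by positivity) (Finset.mem_univ j))
          (by positivity)

theorem lpNorm_nonneg (x : Fin m → ℝ) : 0 ≤ lpNorm p x := by
  by_cases hp : p = ⊤
  · rw [hp, lpNorm_top]
    exact Real.iSup_nonneg fun j => abs_nonneg _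
  · rcases eq_or_ne p 0 with rfl | h0
    · rw [lpNorm, PiLp.norm_eq_card]
      positivity
    · rw [lpNorm, PiLp.norm_eq_sum (ENNReal.toReal_pos h0 hp)]
      positivity

/-- The `ℓ_p` norm is decreasing in `p`; here `θ` is the inverse of the smaller exponent. -/
theorem lpNorm_le_rpow (hp : 1 ≤ p) {x : Fin m → ℝ} (hx : 0 ≤ x) {θ : ℝ} (hθ : 0 < θ)
    (h : p⁻¹.toReal ≤ θ) : lpNorm p x ≤ (∑ j, x j ^ (1 / θ)) ^ θ := by
  set a := (∑ j, x j ^ (1 / θ)) ^ θ with ha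
  have hS : 0 ≤ ∑ j, x j ^ (1 / θ) := Finset.sum_nonneg fun j _ => Real.rpow_nonneg (hx j) _
  have ha0 : 0 ≤ a := Real.rpow_nonneg hS _
  have hxa : ∀ j, x j ≤ a := fun j => by
    calc x j = (x j ^ (1 / θ)) ^ θ := by
          rw [← Real.rpow_mul (hx j), one_div_mul_cancel hθ.ne', Real.rpow_one]
      _ ≤ a := Real.rpow_le_rpow (Real.rpow_nonneg (hx j) _) (Finset.single_le_sum
          (f := fun j => x j ^ (1 / θ)) (fun j _ => Real.rpow_nonneg (hx j) _)
          (Finset.mem_univ j)) hθ.le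
  by_cases hp' : p = ⊤
  · rw [hp', lpNorm_top]
    exact Real.iSup_le (fun j => by rw [abs_of_nonneg (hx j)]; exact hxa j) ha0
  · have h1 := one_le_toReal hp hp'
    rw [ENNReal.toReal_inv] at h
    have hpθ : 1 / θ ≤ p.toReal := by
      rw [one_div]
      exact inv_le_of_inv_le₀ (by linarith) h
    have hpθ' : 0 ≤ p.toReal - 1 / θ := sub_nonneg.mpr hpθ
    rw [lpNorm_eq hp hp', one_div]
    refine (Real.rpow_inv_le_iff_of_pos (Finset.sum_nonneg fun j _ => by positivity) ha0
      (by linarith)).mpr ?_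
    have haS : ∑ j, x j ^ (1 / θ) = a ^ (1 / θ) := by
      rw [ha, ← Real.rpow_mul hS, mul_one_div_cancel hθ.ne', Real.rpow_one]
    have hsplit : ∀ y : ℝ, 0 ≤ y → y ^ p.toReal = y ^ (p.toReal - 1 / θ) * y ^ (1 / θ) :=
      fun y hy => by rw [← Real.rpow_add_of_nonneg hy hpθ' (by positivity), sub_add_cancel]
    calc ∑ j, |x j| ^ p.toReal ≤ ∑ j, a ^ (p.toReal - 1 / θ) * x j ^ (1 / θ) :=
          Finset.sum_le_sum fun j _ => by
            rw [abs_of_nonneg (hx j), hsplit _ (hx j)]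
            exact mul_le_mul_of_nonneg_right (Real.rpow_le_rpow (hx j) (hxa j) hpθ')
              (Real.rpow_nonneg (hx j) _)
      _ = a ^ p.toReal := by rw [← Finset.mul_sum, haS, hsplit a ha0]

theorem rpow_le_lpNorm (hp : 1 ≤ p) {x : Fin m → ℝ} (hx : 0 ≤ x) {θ : ℝ} (hθ : 0 < θ) :
    (∑ j, x j ^ (1 / θ)) ^ θ ≤ (m : ℝ) ^ θ * lpNorm p x := by
  have h0 := lpNorm_nonneg (p := p) x
  calc (∑ j, x j ^ (1 / θ)) ^ θ ≤ (∑ j : Fin m, lpNorm p x ^ (1 / θ)) ^ θ :=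
        Real.rpow_le_rpow (Finset.sum_nonneg fun j _ => Real.rpow_nonneg (hx j) _)
          (Finset.sum_le_sum fun j _ => Real.rpow_le_rpow (hx j)
            ((le_abs_self _).trans (apply_le_lpNorm hp x j)) (by positivity)) hθ.le
    _ = _ := by
        rw [Finset.sum_const, Finset.card_univ, Fintype.card_fin, nsmul_eq_mul,
          Real.mul_rpow (by positivity) (by positivity), ← Real.rpow_mul h0,
          one_div_mul_cancel hθ.ne', Real.rpow_one]

/-- The dual norm of the vector of ones reveals `p`. -/
theorem dualNorm_one (hp : 1 ≤ p) (hm : 1 ≤ m) :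
    dualNorm (lpNorm p : (Fin m → ℝ) → ℝ) (fun _ => 1) = (m : ℝ) ^ (1 - p⁻¹.toReal) := by
  have hm0 : (0 : ℝ) < m := by exact_mod_cast hm
  have hne : Nonempty (Fin m) := ⟨⟨0, hm⟩⟩
  have hub : ∀ v : Fin m → ℝ, lpNorm p |v| ≤ 1 → ∑ j, 1 * v j ≤ (m : ℝ) ^ (1 - p⁻¹.toReal) := by
    intro v hv
    by_cases hp' : p = ⊤
    · calc ∑ j, 1 * v j ≤ ∑ _j : Fin m, (1 : ℝ) := Finset.sum_le_sum fun j _ => by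
            have h1 := (apply_le_lpNorm hp |v| j).trans hv
            rw [Pi.abs_apply, abs_abs] at h1
            linarith [le_abs_self (v j)]
        _ = _ := by simp [hp']
    · have h1 := one_le_toReal hp hp'
      have hp0 : 0 < p.toReal := by linarith
      rw [lpNorm_eq hp hp', one_div, Real.rpow_inv_le_iff_of_pos
        (Finset.sum_nonneg fun j _ => by positivity) zero_le_one hp0, Real.one_rpow] at hv
      simp only [Pi.abs_apply, abs_abs] at hv
      have h2 := Real.rpow_sum_le_const_mul_sum_rpow Finset.univ v h1
      rw [Finset.card_univ, Fintype.card_fin] at h2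
      have h3 := h2.trans (mul_le_of_le_one_right (by positivity) hv)
      have h4 : ∑ j, |v j| ≤ ((m : ℝ) ^ (p.toReal - 1)) ^ p.toReal⁻¹ :=
        (Real.le_rpow_inv_iff_of_pos (Finset.sum_nonneg fun j _ => abs_nonneg _)
          (by positivity) hp0).mpr h3
      rw [← Real.rpow_mul hm0.le, sub_mul, mul_inv_cancel₀ hp0.ne', one_mul,
        ← ENNReal.toReal_inv] at h4
      exact (Finset.sum_le_sum fun j _ => by rw [one_mul]; exact le_abs_self _).trans h4
  refine le_antisymm (csSup_le ⟨0, 0, ?_, by simp⟩ ?_) (le_csSup ⟨(m : ℝ) ^ (1 - p⁻¹.toReal), ?_⟩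
    ⟨fun _ => (m : ℝ) ^ (-p⁻¹.toReal), ?_, ?_⟩)
  · have : Fact (1 ≤ p) := ⟨hp⟩
    simp [lpNorm]
  · rintro _ ⟨v, hv, rfl⟩
    exact hub v hv
  · rintro _ ⟨v, hv, rfl⟩
    exact hub v hv
  · have ha : ∀ a : ℝ, 0 ≤ a → |fun _ : Fin m => a| = fun _ => a := fun a ha =>
      funext fun _ => abs_of_nonneg ha
    rw [ha _ (by positivity)]
    by_cases hp' : p = ⊤
    · rw [hp', lpNorm_top]
      simp
    · have hp0 : 0 < p.toReal := zero_lt_one.trans_le (one_le_toReal hp hp')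
      rw [lpNorm_eq hp hp']
      simp only [Finset.sum_const, Finset.card_univ, Fintype.card_fin, nsmul_eq_mul]
      rw [abs_of_nonneg (by positivity), ← Real.rpow_mul hm0.le, ENNReal.toReal_inv, neg_mul,
        inv_mul_cancel₀ hp0.ne', Real.rpow_neg_one, mul_inv_cancel₀ hm0.ne', Real.one_rpow]
  · simp only [one_mul, Finset.sum_const, Finset.card_univ, Fintype.card_fin, nsmul_eq_mul]
    rw [sub_eq_add_neg, Real.rpow_add hm0, Real.rpow_one]

end

/-! ### The potential function for `ℓ_p` norms -/

/-- The power `x ^ y` of a positive number in terms of `exp` and `log`; the value is `0` at all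
other numbers. -/
noncomputable def posPow (x y : ℝ) : ℝ := if x ≤ 0 then 0 else Real.exp (Real.log x * y)

theorem posPow_eq {x y : ℝ} (hx : 0 ≤ x) (hy : 0 < y) : posPow x y = x ^ y := by
  rcases hx.eq_or_lt with rfl | hx
  · simp [posPow, Real.zero_rpow hy.ne']
  · rw [posPow, if_neg (not_le.mpr hx), Real.rpow_def_of_pos hx]

/-- The inverse of the exponent that replaces `p`, the minimum of `p` and `1 + log m`; the inverse
of `p` is computed from the dual norm of the vector of ones (`dualNorm_one`). For `m = 1` the
quotient of the logarithms is `0 / 0 = 0`, and the exponent is `1`. -/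
noncomputable def invExponent (m : ℕ) (O : Oracle) (i : ℕ) : ℝ :=
  max (1 - Real.log (O i fun _ => 1) / Real.log m) (1 / (1 + Real.log m))

/-- The exponent in which the norms of the resources are combined. -/
noncomputable def outerExponent (m r : ℕ) : ℝ := 1 + Real.log m + Real.log r

/-- The sum over the resources of the powers of the norms of the loads. -/
noncomputable def lpPotential {m r : ℕ} (O : Oracle) (x : Fin r → Fin m → ℝ) : ℝ :=
  ∑ i : Fin r, posPow (∑ j, posPow (x i j) (1 / invExponent m O i))
    (outerExponent m r * invExponent m O i)

theorem invExponent_pos {m : ℕ} (O : Oracle) (i : ℕ) : 0 < invExponent m O i := by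
  have := Real.log_natCast_nonneg m
  exact lt_max_of_lt_right (by positivity)

theorem one_le_mul_invExponent {m r : ℕ} (O : Oracle) (i : ℕ) :
    1 ≤ outerExponent m r * invExponent m O i := by
  have h1 := Real.log_natCast_nonneg m
  have h2 := Real.log_natCast_nonneg r
  calc (1 : ℝ) = (1 + Real.log m) * (1 / (1 + Real.log m)) := by field_simp
    _ ≤ _ := mul_le_mul (by unfold outerExponent; linarith) (le_max_right _ _) (by positivity)
      (by unfold outerExponent; positivity)

theorem Ultra.rpow {E : Type*} [AddCommMonoid E] [PartialOrder E] [IsOrderedAddMonoid E] {f : E → ℝ}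
    (hf : Ultra f) (h0 : ∀ x, 0 ≤ x → 0 ≤ f x) {y : ℝ} (hy : 1 ≤ y) :
    Ultra (fun x => posPow (f x) y) := by
  refine hf.comp (s := Set.Ici 0) (g := fun x => posPow x y)
    ((convexOn_rpow hy).congr fun x hx => (posPow_eq hx (by linarith)).symm) ?_ h0
  intro a ha b hb hab
  simp only [posPow_eq ha (zero_lt_one.trans_le hy), posPow_eq hb (zero_lt_one.trans_le hy)]
  exact Real.rpow_le_rpow ha hab (by linarith)

theorem posPow_nonneg (x y : ℝ) : 0 ≤ posPow x y := by
  unfold posPow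
  split_ifs
  · exact le_rfl
  · positivity

/-- The outer exponents `q / p` of the sums of `p`-th powers are at least `1`, which makes all
functions involved convex and monotone. -/
theorem ultra_lpPotential {m r : ℕ} {O : Oracle} (hO : ∀ i : Fin r, invExponent m O i ≤ 1) :
    Ultra (lpPotential O : (Fin r → Fin m → ℝ) → ℝ) := by
  refine Ultra.sum _ fun i _ => Ultra.rpow (Ultra.sum _ fun j _ => Ultra.rpow ?_ ?_ ?_) ?_
    (one_le_mul_invExponent O i)
  · exact ⟨fun x y _ h => h i j, fun x y o _ _ _ => by simp⟩
  · exact fun x hx => hx i j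
  · rw [one_div]
    exact (one_le_inv₀ (invExponent_pos O i)).mpr (hO i)
  · exact fun x _ => Finset.sum_nonneg fun j _ => posPow_nonneg _ _

section
variable {m r : ℕ} {p : Fin r → ENNReal}

theorem invExponent_eq (hm : 1 ≤ m) (hp : ∀ i, 1 ≤ p i) (i : Fin r) :
    invExponent m (ballOracle fun i => (lpNorm (p i) : (Fin m → ℝ) → ℝ)) i =
      if m = 1 then 1 else max (p i)⁻¹.toReal (1 / (1 + Real.log m)) := by
  unfold invExponent
  split_ifs with h
  · simp [h]
  · have hm1 : (1 : ℝ) < m := by exact_mod_cast (by omega : 1 < m)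
    rw [ballOracle_eq, dualNorm_one (hp i) hm, Real.log_rpow (by linarith),
      mul_div_cancel_right₀ _ (Real.log_pos hm1).ne', sub_sub_cancel]

theorem toReal_inv_le_one {p : ENNReal} (hp : 1 ≤ p) : p⁻¹.toReal ≤ 1 := by
  rw [← ENNReal.toReal_one]
  exact ENNReal.toReal_mono ENNReal.one_ne_top (ENNReal.inv_le_one.mpr hp)

theorem invExponent_le_one (hm : 1 ≤ m) (hp : ∀ i, 1 ≤ p i) (i : Fin r) :
    invExponent m (ballOracle fun i => (lpNorm (p i) : (Fin m → ℝ) → ℝ)) i ≤ 1 := by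
  have := Real.log_natCast_nonneg m
  rw [invExponent_eq hm hp]
  split_ifs
  · exact le_rfl
  · exact max_le (toReal_inv_le_one (hp i))
      ((div_le_one (by linarith)).mpr (by linarith))

/-- The replacement of `p` by `min p (1 + log m)` changes the norm by a factor of at most `e`. -/
theorem lpNorm_equiv (hm : 1 ≤ m) (hp : ∀ i, 1 ≤ p i) (i : Fin r) {x : Fin m → ℝ} (hx : 0 ≤ x)
    {θ : ℝ} (hθ : θ = invExponent m (ballOracle fun i => (lpNorm (p i) : (Fin m → ℝ) → ℝ)) i) :
    lpNorm (p i) x ≤ (∑ j, x j ^ (1 / θ)) ^ θ ∧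
      (∑ j, x j ^ (1 / θ)) ^ θ ≤ Real.exp 1 * lpNorm (p i) x := by
  have hθ0 : 0 < θ := hθ ▸ invExponent_pos _ _
  have hN := lpNorm_nonneg (p := p i) x
  have hlog := Real.log_natCast_nonneg m
  rw [invExponent_eq hm hp] at hθ
  split_ifs at hθ with h
  · refine ⟨lpNorm_le_rpow (hp i) hx hθ0 (hθ ▸ toReal_inv_le_one (hp i)),
      (rpow_le_lpNorm (hp i) hx hθ0).trans (mul_le_mul_of_nonneg_right ?_ hN)⟩
    rw [h, Nat.cast_one, Real.one_rpow]
    exact Real.one_le_exp zero_le_one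
  · refine ⟨lpNorm_le_rpow (hp i) hx hθ0 (hθ ▸ le_max_left _ _), ?_⟩
    rcases le_total (p i)⁻¹.toReal (1 / (1 + Real.log m)) with hle | hle
    · rw [max_eq_right hle] at hθ
      refine (rpow_le_lpNorm (hp i) hx hθ0).trans (mul_le_mul_of_nonneg_right ?_ hN)
      rw [Real.rpow_def_of_pos (by exact_mod_cast hm), hθ, Real.exp_le_exp, mul_one_div,
        div_le_one (by linarith)]
      linarith
    · rw [max_eq_left hle] at hθ
      have hp' : p i ≠ ⊤ := by
        intro htop
        rw [htop] at hθ
        simp at hθ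
        exact hθ0.ne' hθ
      rw [lpNorm_eq (hp i) hp', hθ, ENNReal.toReal_inv, one_div, inv_inv, one_div]
      simp only [abs_of_nonneg (hx _)]
      exact le_mul_of_one_le_left (Real.rpow_nonneg (Finset.sum_nonneg fun j _ =>
        Real.rpow_nonneg (hx j) _) _) (Real.one_le_exp zero_le_one)

theorem lpPotential_eq {O : Oracle} {x : Fin r → Fin m → ℝ} (hx : 0 ≤ x) :
    lpPotential O x = ∑ i : Fin r, ((∑ j, x i j ^ (1 / invExponent m O i)) ^ invExponent m O i) ^
      outerExponent m r := by
  refine Finset.sum_congr rfl fun i _ => ?_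
  have h0 := invExponent_pos (m := m) O i
  have hS : 0 ≤ ∑ j, x i j ^ (1 / invExponent m O i) :=
    Finset.sum_nonneg fun j _ => Real.rpow_nonneg (hx i j) _
  rw [← Real.rpow_mul hS, mul_comm (invExponent m O i)]
  simp only [fun j => posPow_eq (hx i j) (one_div_pos.mpr h0)]
  exact posPow_eq hS (zero_lt_one.trans_le (one_le_mul_invExponent O i))

/-- Minkowski's inequality for the potential function. -/
theorem lpPotential_add_le {O : Oracle} (hO : ∀ i : Fin r, invExponent m O i ≤ 1)
    {x y : Fin r → Fin m → ℝ} (hx : 0 ≤ x) (hy : 0 ≤ y) :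
    lpPotential O (x + y) ^ (1 / outerExponent m r) ≤
      lpPotential O x ^ (1 / outerExponent m r) + lpPotential O y ^ (1 / outerExponent m r) := by
  have h1 := Real.log_natCast_nonneg m
  have h2 := Real.log_natCast_nonneg r
  have hq : 1 ≤ outerExponent m r := by unfold outerExponent; linarith
  rw [lpPotential_eq hx, lpPotential_eq hy, lpPotential_eq (add_nonneg hx hy)]
  set n : (Fin r → Fin m → ℝ) → Fin r → ℝ := fun x i =>
    (∑ j, x i j ^ (1 / invExponent m O i)) ^ invExponent m O i with hn
  have hn0 : ∀ x, 0 ≤ x → ∀ i, 0 ≤ n x i := fun x hx i =>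
    Real.rpow_nonneg (Finset.sum_nonneg fun j _ => Real.rpow_nonneg (hx i j) _) _
  have hadd : ∀ i, n (x + y) i ≤ n x i + n y i := fun i => by
    have hθ := invExponent_pos (m := m) O i
    have := Real.Lp_add_le_of_nonneg Finset.univ (f := x i) (g := y i)
      (p := 1 / invExponent m O i) (by rw [one_div]; exact (one_le_inv₀ hθ).mpr (hO i))
      (fun j _ => hx i j) (fun j _ => hy i j)
    rwa [one_div_one_div] at this
  refine le_trans (Real.rpow_le_rpow (Finset.sum_nonneg fun i _ =>
    Real.rpow_nonneg (hn0 _ (add_nonneg hx hy) i) _) (Finset.sum_le_sum fun i _ =>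
      Real.rpow_le_rpow (hn0 _ (add_nonneg hx hy) i) (hadd i) (by linarith)) (by positivity)) ?_
  exact Real.Lp_add_le_of_nonneg Finset.univ hq (fun i _ => hn0 x hx i) (fun i _ => hn0 y hy i)

theorem maxNorm_le_lpPotential (hm : 1 ≤ m) (hr : 1 ≤ r) (hp : ∀ i, 1 ≤ p i)
    {x : Fin r → Fin m → ℝ} (hx : 0 ≤ x) :
    maxNorm (fun i => lpNorm (p i)) x ≤
      lpPotential (ballOracle fun i => (lpNorm (p i) : (Fin m → ℝ) → ℝ)) x ^
        (1 / outerExponent m r) := by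
  have h1 := Real.log_natCast_nonneg m
  have h2 := Real.log_natCast_nonneg r
  have hq : 0 < outerExponent m r := by unfold outerExponent; linarith
  refine maxNorm_le hr fun i => (lpNorm_equiv hm hp i (hx i) rfl).1.trans ?_
  rw [lpPotential_eq hx]
  have hn0 : ∀ i : Fin r, ∀ O : Oracle,
      0 ≤ (∑ j, x i j ^ (1 / invExponent m O i)) ^ invExponent m O i :=
    fun i O => Real.rpow_nonneg (Finset.sum_nonneg fun j _ => Real.rpow_nonneg (hx i j) _) _
  rw [one_div (outerExponent m r), Real.le_rpow_inv_iff_of_pos (hn0 _ _)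
    (Finset.sum_nonneg fun i _ => Real.rpow_nonneg (hn0 _ _) _) hq]
  exact Finset.single_le_sum (f := fun i : Fin r => ((∑ j, x i j ^ (1 / invExponent m
    (ballOracle fun i => (lpNorm (p i) : (Fin m → ℝ) → ℝ)) i)) ^ invExponent m
    (ballOracle fun i => (lpNorm (p i) : (Fin m → ℝ) → ℝ)) i) ^ outerExponent m r)
    (fun i _ => Real.rpow_nonneg (hn0 _ _) _) (Finset.mem_univ i)

theorem lpPotential_le_maxNorm (hm : 1 ≤ m) (hr : 1 ≤ r) (hp : ∀ i, 1 ≤ p i)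
    {x : Fin r → Fin m → ℝ} (hx : 0 ≤ x) :
    lpPotential (ballOracle fun i => (lpNorm (p i) : (Fin m → ℝ) → ℝ)) x ^
        (1 / outerExponent m r) ≤
      Real.exp 1 * (Real.exp 1 * maxNorm (fun i => lpNorm (p i)) x) := by
  have h1 := Real.log_natCast_nonneg m
  have h2 := Real.log_natCast_nonneg r
  have hr0 : (0 : ℝ) < r := by exact_mod_cast hr
  have hq : 0 < outerExponent m r := by unfold outerExponent; linarith
  have hV : 0 ≤ maxNorm (fun i => lpNorm (p i)) x :=
    (lpNorm_nonneg _).trans (le_maxNorm (fun i => lpNorm (p i)) x ⟨0, hr⟩)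
  rw [lpPotential_eq hx]
  refine (Real.rpow_le_rpow (Finset.sum_nonneg fun i _ => Real.rpow_nonneg (Real.rpow_nonneg
    (Finset.sum_nonneg fun j _ => Real.rpow_nonneg (hx i j) _) _) _) (Finset.sum_le_sum fun i _ =>
      Real.rpow_le_rpow (Real.rpow_nonneg (Finset.sum_nonneg fun j _ =>
        Real.rpow_nonneg (hx i j) _) _) ((lpNorm_equiv hm hp i (hx i) rfl).2.trans
        (mul_le_mul_of_nonneg_left (le_maxNorm (fun i => lpNorm (p i)) x i)
          (Real.exp_nonneg 1))) hq.le) (by positivity)).trans ?_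
  rw [Finset.sum_const, Finset.card_univ, Fintype.card_fin, nsmul_eq_mul,
    Real.mul_rpow hr0.le (by positivity), ← Real.rpow_mul (by positivity),
    mul_one_div_cancel hq.ne', Real.rpow_one]
  refine mul_le_mul_of_nonneg_right ?_ (by positivity)
  rw [Real.rpow_def_of_pos hr0, Real.exp_le_exp, mul_one_div, div_le_one hq]
  unfold outerExponent
  linarith

/-- The greedy algorithm for the potential function: if adding `y` to `x` at least doubles the
potential of `x`, then the cost of `x` is not much larger than that of `y`. -/
theorem maxNorm_le_of_two_mul_le (hm : 1 ≤ m) (hr : 1 ≤ r) (hp : ∀ i, 1 ≤ p i)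
    {x y : Fin r → Fin m → ℝ} (hx : 0 ≤ x) (hy : 0 ≤ y)
    (h : 2 * lpPotential (ballOracle fun i => (lpNorm (p i) : (Fin m → ℝ) → ℝ)) x ≤
      lpPotential (ballOracle fun i => (lpNorm (p i) : (Fin m → ℝ) → ℝ)) (x + y)) :
    maxNorm (fun i => lpNorm (p i)) x ≤
      12 * (1 + Real.log m + Real.log r) * maxNorm (fun i => lpNorm (p i)) y := by
  set O := ballOracle fun i => (lpNorm (p i) : (Fin m → ℝ) → ℝ) with hO
  have h1 := Real.log_natCast_nonneg m
  have h2 := Real.log_natCast_nonneg r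
  change _ ≤ 12 * outerExponent m r * _
  have hq : 0 < outerExponent m r := by unfold outerExponent; linarith
  set q := outerExponent m r with hqdef
  have hΨ : 0 ≤ lpPotential O x := Finset.sum_nonneg fun i _ => posPow_nonneg _ _
  have a1 := maxNorm_le_lpPotential hm hr hp hx
  have a2 := lpPotential_le_maxNorm hm hr hp hy
  have a3 := lpPotential_add_le (fun i => invExponent_le_one hm hp i) hx hy
  have a4 := Real.rpow_le_rpow (by positivity) h (one_div_nonneg.mpr hq.le)
  rw [← hqdef, ← hO] at a1 a2 a3
  rw [Real.mul_rpow zero_le_two hΨ] at a4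
  set a := lpPotential O x ^ (1 / q) with ha
  set V := maxNorm (fun i => lpNorm (p i)) y with hVdef
  have ha0 : 0 ≤ a := Real.rpow_nonneg hΨ _
  have hV : 0 ≤ V := (lpNorm_nonneg _).trans (le_maxNorm (fun i => lpNorm (p i)) y ⟨0, hr⟩)
  have h2q : 1 + Real.log 2 / q ≤ (2 : ℝ) ^ (1 / q) := by
    rw [Real.rpow_def_of_pos two_pos, mul_one_div, add_comm]
    exact Real.add_one_le_exp _
  have e1 := Real.exp_one_lt_d9
  have e2 := Real.log_two_gt_d9
  have a5 : Real.log 2 / q * a ≤ Real.exp 1 * (Real.exp 1 * V) := by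
    have := mul_le_mul_of_nonneg_right h2q ha0
    linarith
  have a6 : Real.exp 1 * (Real.exp 1 * V) ≤ 15 / 2 * V := by
    have : Real.exp 1 * Real.exp 1 ≤ 15 / 2 := by
      have := mul_le_mul e1.le e1.le (Real.exp_nonneg 1) (by norm_num)
      norm_num at this ⊢
      linarith
    rw [← mul_assoc]
    exact mul_le_mul_of_nonneg_right this hV
  have a7 : Real.log 2 * a ≤ 15 / 2 * V * q := by
    rw [← div_le_iff₀ hq, mul_div_right_comm]
    exact a5.trans a6
  have a8 : 0 ≤ V * q := by positivity
  nlinarith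

end

/-! ### The greedy algorithm for `ℓ_p` norms -/

/-- The rule for the choice: the option with the smallest potential. -/
noncomputable def lpChoiceRule (b : Base) : ℝ :=
  (argmin b.k fun c => lpPotential (m := b.m) (r := b.r) b.O
    (earlierLoad b.C b.Y b.k b.t b.s 0 + jobLoad b.C b.s c) : ℕ)

theorem isOnline_lpChoiceRule : IsOnline lpChoiceRule := by
  intro b t C h ht hC
  simp only [lpChoiceRule, earlierLoad_congr b.C b.Y b.k h ht hC]
  rw [jobLoad_congr (hC b.s le_rfl)]

namespace Comp
variable {α : Type} {V : Ctx α}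

theorem posPow {f g : α → ℝ} (hf : Comp V f) (hg : Comp V g) :
    Comp V fun a => VectorScheduling.posPow (f a) (g a) := by
  have h0 : Comp V fun _ => (0 : ℝ) := (const 0).congr fun _ => Nat.cast_zero
  exact ite (PComp.le hf h0) h0 (hf.log.mul hg).exp

theorem invExponent {i : α → ℕ} (hi : NComp V i) :
    Comp V fun a => VectorScheduling.invExponent (V.base a).m (V.base a).O (i a) := by
  have h1 : ∀ {β : Type} (U : Ctx β), Comp U fun _ => (1 : ℝ) :=
    fun U => (const 1).congr fun _ => Nat.cast_one
  have hm := (cast (NComp.m (V := V))).log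
  exact ((h1 V).sub ((oracle (f := fun _ _ => 1) hi fun i => h1 _).log.div hm)).max
    ((h1 V).div ((h1 V).add hm))

theorem outerExponent : Comp V fun a => VectorScheduling.outerExponent (V.base a).m (V.base a).r :=
  (((const 1).congr fun _ => Nat.cast_one).add (cast NComp.m).log).add (cast NComp.r).log

theorem lpPotential {X : (a : α) → Fin (V.base a).r → Fin (V.base a).m → ℝ}
    (hX : ∀ i i', Comp ((V.ext i fun a => (V.base a).r).ext i'
      fun x => (V.base x.1).m) fun x => X x.1.1 x.1.2 x.2) :
    Comp V fun a => VectorScheduling.lpPotential (V.base a).O (X a) := by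
  unfold VectorScheduling.lpPotential
  refine sum 1 (fun a => by unfold Base.size; omega) NComp.r fun i => ?_
  have hθ := invExponent (V := V.ext i fun a => (V.base a).r) (NComp.var i _)
  refine posPow (sum (V := V.ext i fun a => (V.base a).r) (B := fun p => (V.base p.1).m) 1
    (fun p => by simpa using (V.base p.1).m_le 1) NComp.m fun i' => ?_)
    ((outerExponent (V := V.ext i fun a => (V.base a).r)).mul hθ)
  exact posPow (hX i i') (((const 1).congr fun _ => Nat.cast_one).div (hθ.wk i' _))

theorem lpChoiceRule : Comp Ctx.nil VectorScheduling.lpChoiceRule := by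
  refine argmin 1 (fun b => by change _ ≤ 1 * (b.size + 1); unfold Base.size; omega) NComp.k
    fun i₀ => lpPotential (V := Ctx.nil.ext i₀ fun b => b.k)
      (X := fun x => earlierLoad x.1.C x.1.Y x.1.k x.1.t x.1.s 0 + jobLoad x.1.C x.1.s x.2)
      fun i i' => ?_
  exact (load (V := Ctx.nil.ext i₀ fun b => b.k) ((const 0).congr fun _ => Nat.cast_zero) i i').add
    (job (V := Ctx.nil.ext i₀ fun b => b.k) NComp.s (NComp.var i₀ _) i i')

end Comp

theorem exists_competitive_of_lpNorm :
    ∃ (K : ℝ) (P : Prog) (b d : ℕ), ∀ m r k : ℕ, 1 ≤ m → 1 ≤ r → 1 ≤ k →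
      ∀ p : Fin r → ENNReal, (∀ i, 1 ≤ p i) →
        ∃ A : OnlineAlgorithm m r k, Implements (fun i => lpNorm (p i)) P b d A ∧
          IsCompetitive (fun i => lpNorm (p i)) A (K * (1 + Real.log m + Real.log r)) := by
  have h0 : Comp Ctx.nil fun _ => (0 : ℝ) := (Comp.const 0).congr fun _ => Nat.cast_zero
  obtain ⟨P, q, e, hP⟩ := exists_algorithm h0 Comp.lpChoiceRule (fun _ _ _ _ _ _ => rfl)
    isOnline_lpChoiceRule fun b hk => ⟨_, (argmin_spec hk _).1, rfl⟩
  refine ⟨12, P, q, e, fun m r k hm hr hk p hp => ?_⟩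
  set N : Fin r → (Fin m → ℝ) → ℝ := fun i => lpNorm (p i) with hN
  obtain ⟨A, hA, hAx⟩ := hP m r k hm hk N
  have hr0 : 0 ≤ Real.log r := Real.log_natCast_nonneg r
  have hm0 : 0 ≤ Real.log m := Real.log_natCast_nonneg m
  refine ⟨A, hA, isCompetitive_of_forall hk (by positivity) fun js hjs x y hy hx => ?_⟩
  set R := results (fun _ => 0) lpChoiceRule (Base.ofJobs N js) with hR
  have hxR : ∀ s < js.length, R js.length (2 * s) = (x s : ℕ) := fun s hs => by
    rw [hx ⟨s, hs⟩]
    exact hAx js ⟨s, hs⟩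
  have hxk : ∀ s < js.length, x s < k := fun s hs => by
    rw [hx ⟨s, hs⟩]
    exact (A.choices js ⟨s, hs⟩).2
  -- all jobs are processed at the same scale `0`
  have hxs : ∀ s < js.length, x s = argmin k fun c => lpPotential (ballOracle N)
      (load (jobLoad (loads js)) (fun _ => 0) x s 0 + jobLoad (loads js) s c :
        Fin r → Fin m → ℝ) := by
    intro s hs
    have h1 := hxR s hs
    rw [hR, results_snd hs, ← hR] at h1
    set Y := Function.update (R s) (2 * s + 3) 0 with hY
    have h2 : lpChoiceRule ((Base.ofJobs N js).at s Y) = (argmin k fun c =>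
        lpPotential (ballOracle N) (earlierLoad (loads js) Y k js.length s 0 +
          jobLoad (loads js) s c : Fin r → Fin m → ℝ) : ℕ) := rfl
    rw [h2, earlierLoad_eq_load (Y := Y) (lam := fun _ => 0) (x := x) hs.le
      (fun s' hs' => by
        rw [hY, Function.update_of_ne (by omega), hR, results_fst hs'])
      (fun s' hs' => by
        rw [hY, Function.update_of_ne (by omega), ← hxR s' (hs'.trans hs), hR]
        exact (results_stable hs.le fun _ _ => by omega).symm)
      (fun s' hs' => hxk s' (hs'.trans hs))] at h1
    exact_mod_cast h1.symm
  have hC : ∀ s c, (0 : Fin r → Fin m → ℝ) ≤ jobLoad (loads js) s c := job_nonneg hjs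
  have hU : Ultra (lpPotential (ballOracle N) : (Fin r → Fin m → ℝ) → ℝ) :=
    ultra_lpPotential fun i => invExponent_le_one hm hp i
  have hg := greedy_le hU hC (lam := fun _ => 0) (x := x) (y := y) (Λ := 0) (s := js.length)
    fun s hs _ => by
      have := (argmin_spec hk fun c => lpPotential (ballOracle N)
        (load (jobLoad (loads js)) (fun _ => 0) x s 0 + jobLoad (loads js) s c :
          Fin r → Fin m → ℝ)).2 (y s) (hy s)
      rwa [← hxs s hs] at this
  have hz : lpPotential (ballOracle N) (0 : Fin r → Fin m → ℝ) = 0 := by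
    simp [lpPotential, posPow]
  have hall : ∀ z : ℕ → ℕ, (load (jobLoad (loads js)) (fun _ => 0) z js.length 0 :
      Fin r → Fin m → ℝ) = ∑ s ∈ Finset.range js.length, jobLoad (loads js) s (z s) := fun z => by
    simp [load]
  rw [hz, hall, hall] at hg
  exact maxNorm_le_of_two_mul_le hm hr hp (Finset.sum_nonneg fun s _ => hC s _)
    (Finset.sum_nonneg fun s _ => hC s _) (by linarith)

end VectorScheduling

theorem mainTheorem6 :
    (∃ (K : ℝ) (P : VectorScheduling.Prog) (b d : ℕ),
      ∀ m r k : ℕ, 1 ≤ m → 1 ≤ r → 1 ≤ k →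
      ∀ N : Fin r → (Fin m → ℝ) → ℝ,
        (∀ i, VectorScheduling.IsMonotoneSymmetricNorm (N i)) →
        ∃ A : VectorScheduling.OnlineAlgorithm m r k,
          VectorScheduling.Implements N P b d A ∧
          VectorScheduling.IsCompetitive N A
            (K * (1 + Real.log m ^ 2 + Real.log r))) ∧
    (∃ (K : ℝ) (P : VectorScheduling.Prog) (b d : ℕ),
      ∀ m r k : ℕ, 1 ≤ m → 1 ≤ r → 1 ≤ k →
      ∀ p : Fin r → ENNReal, (∀ i, 1 ≤ p i) →
        ∃ A : VectorScheduling.OnlineAlgorithm m r k,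
          VectorScheduling.Implements (fun i => VectorScheduling.lpNorm (p i)) P b d A ∧
          VectorScheduling.IsCompetitive (fun i => VectorScheduling.lpNorm (p i)) A
            (K * (1 + Real.log m + Real.log r))) :=
  ⟨VectorScheduling.exists_competitive_of_isMonotoneSymmetricNorm,
    VectorScheduling.exists_competitive_of_lpNorm⟩
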